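/- **Theorem (Lifshitz tails).** Let $\{\psi_n\}_{n\in\mathbb Z}$ be unit vectors in a complex Hilbert space $\mathcal H$ (inner product linear in the first argument) whose Gram matrix $\{\langle\psi_n,\psi_m\rangle\}_{n,m\in\mathbb Z}$ is bounded on $\ell^2(\mathbb Z)$ and shift-invariant, $\langle\psi_{n+1},\psi_{m+1}\rangle=\langle\psi_n,\psi_m\rangle$. Let $\mathbf P_0$ be a probability measure on $\mathbb R$ with compact support contained in $(0,\infty)$, let $\varkappa_{\min}=\inf\operatorname{supp}\mathbf P_0$ and $\varkappa_{\max}=\sup\operatorname{supp}\mathbf P_0$, and let $\varkappa=\{\varkappa_n\}_{n\in\mathbb Z}$ be i.i.d. random variables with distribution $\mathbf P_0$. Let $$\varphi(k)=\sum_{n\in\mathbb Z}\langle\psi_n,\psi_0\rangle e^{ink}$$ be the symbol, i.e. the function in $L^2(\mathbb T)$ with Fourier coefficients $\langle\psi_n,\psi_0\rangle$, let $\varphi_{\max}=\operatorname{ess\,sup}\varphi$ and $\sigma_{\max}=\varkappa_{\max}\varphi_{\max}$. For $N\ge0$ let $\mathcal P^{(N)}_\varkappa=\sum_{n=-N}^N\varkappa_n\langle\,\cdot\,,\psi_n\rangle\psi_n$,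 and let $\nu^{(N)}_{\mathcal P_\varkappa}$ be the measure with a point mass $\frac1{2N+1}$ at each non-zero eigenvalue of $\mathcal P^{(N)}_\varkappa$, counted with multiplicity. The integrated density of states (IDS) measure $\nu$ is the non-random probability measure on $\mathbb R$ such that, almost surely, $\int f\,d\nu^{(N)}_{\mathcal P_\varkappa}\to\int f\,d\nu$ as $N\to\infty$ for every continuous $f:\mathbb R\to\mathbb R$. Assume that $\varphi$ is $C^2$-smooth on the circle $\mathbb T=\mathbb R/2\pi\mathbb Z$, that its maximum is attained at a single point $k_{\max}\in\mathbb T$, and that the maximum is non-degenerate, $\varphi''(k_{\max})\ne0$. Assume further that $\varkappa_{\min}<\varkappa_{\max}$ and that, for some $C>0$ and $\ell>0$, $$\mathbf P_0\bigl((\varkappa_{\max}-\varepsilon,\varkappa_{\max}]\bigr)\ge C\varepsilon^{\ell}\qquad\text{for all sufficiently small }\varepsilon>0.$$ Then the IDS measure $\nu$ exists and is unique, and $$\lim_{\delta\to0_+}\frac{\log\bigl(-\log\nu((\sigma_{\max}-\delta,\sigma_{\max}])\bigr)}{\log\delta}=-\frac12 .$$ -/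

import Mathlib

open MeasureTheory Filter Topology Set

noncomputable section

namespace RankOneSums

variable {H : Type*} [NormedAddCommGroup H] [InnerProductSpace ℂ H]

/-- The Gram matrix with entries `G n m = ⟨ψ n, ψ m⟩`. The pairing here is linear in its left entry
and antilinear in its right entry, so it is Mathlib's `inner` with the two entries swapped. -/
def gram (ψ : ℤ → H) (n m : ℤ) : ℂ := inner ℂ (ψ m) (ψ n)

/-- The Gram matrix is (the matrix of) a bounded operator on `ℓ²(ℤ)`. -/
def GramBounded (ψ : ℤ → H) : Prop :=
  ∃ G : lp (fun _ : ℤ => ℂ) 2 →L[ℂ] lp (fun _ : ℤ => ℂ) 2,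
    ∀ n m : ℤ, G (lp.single 2 m (1 : ℂ)) n = gram ψ n m

/-- The Gram matrix is invariant with respect to shifts of the indices. -/
def GramShiftInvariant (ψ : ℤ → H) : Prop :=
  ∀ n m : ℤ, gram ψ (n + 1) (m + 1) = gram ψ n m

/-- `φ`, a function on the unit circle written as a `2π`-periodic function on the line, is the
symbol: the square-integrable function with Fourier series `∑ n, ⟨ψ n, ψ 0⟩ e^{i n k}`. -/
structure IsSymbol (ψ : ℤ → H) (φ : ℝ → ℝ) : Prop where
  periodic : Function.Periodic φ (2 * Real.pi)
  memLp : MemLp φ 2 (volume.restrict (Ioc (-Real.pi) Real.pi))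
  fourier : ∀ n : ℤ,
    (1 / (2 * Real.pi) : ℂ) *
      ∫ k in (-Real.pi)..Real.pi, (φ k : ℂ) * Complex.exp (-(Complex.I * n * k)) = gram ψ n 0

/-- The essential supremum of a function on the circle. -/
def symbolMax (φ : ℝ → ℝ) : ℝ := essSup φ (volume.restrict (Ioc (-Real.pi) Real.pi))

/-- The lower endpoint of the support of the single-site distribution. -/
def kappaMin (P₀ : Measure ℝ) : ℝ := sInf P₀.support

/-- The upper endpoint of the support of the single-site distribution. -/
def kappaMax (P₀ : Measure ℝ) : ℝ := sSup P₀.support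

/-- The top edge `σ_max = κ_max φ_max`. -/
def sigmaMax (P₀ : Measure ℝ) (φ : ℝ → ℝ) : ℝ := kappaMax P₀ * symbolMax φ

/-- The finite-rank operator `∑_{|n| ≤ N} κ n ⟨·, ψ n⟩ ψ n`. -/
def finiteRankSum (ψ : ℤ → H) (κ : ℤ → ℝ) (N : ℕ) : H →L[ℂ] H :=
  ∑ n ∈ Finset.Icc (-(N : ℤ)) (N : ℤ), (κ n : ℂ) • InnerProductSpace.rankOne ℂ (ψ n) (ψ n)

/-- The measure with a point mass `1 / (2N + 1)` at every non-zero eigenvalue of the finite-rank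
operator, eigenvalues being counted with multiplicity. -/
def eigenvalueMeasure (ψ : ℤ → H) (κ : ℤ → ℝ) (N : ℕ) : Measure ℝ :=
  (2 * (N : ENNReal) + 1)⁻¹ •
    Measure.sum fun x : {x : ℝ // x ≠ 0} =>
      (Module.finrank ℂ
        (Module.End.eigenspace (finiteRankSum ψ κ N : H →ₗ[ℂ] H) (x.1 : ℂ)) : ENNReal) •
        Measure.dirac x.1

/-- `ν` is the integrated density of states measure: a non-random probability measure such that,
for almost every realisation `κ` of the i.i.d. sequence with common law `P₀`, the normalised
eigenvalue counting measures converge to `ν` against every continuous function. -/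
structure IsIDSMeasure (ψ : ℤ → H) (P₀ : Measure ℝ) (ν : Measure ℝ) : Prop where
  isProbability : IsProbabilityMeasure ν
  tendsto : ∀ᵐ κ ∂(Measure.infinitePi fun _ : ℤ => P₀), ∀ f : ℝ → ℝ, Continuous f →
    Tendsto (fun N : ℕ => ∫ x, f x ∂(eigenvalueMeasure ψ κ N)) atTop (𝓝 (∫ x, f x ∂ν))

end RankOneSums

end

/-! The non-zero spectrum of `finiteRankSum` is the spectrum of the Gram matrix of the vectors `√κ n
• ψ n`: a truncated Toeplitz matrix with symbol φ, multiplied on both sides by the random diagonal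
√κ (`finrank_eigenspace_eq`, `eigenvalueMeasure_eq`). In the variable w = √κ v the Rayleigh quotient
is ‖∑ w n ψ n‖² / ∑ |w n|²/κ n. Since φ_max - φ(k) is comparable with 1 - cos(k - k_max), the
deficit φ_max ∑|w n|² - ‖∑ w n ψ n‖² is comparable with the discrete Dirichlet form of w, twisted by
the phase k_max (`exists_form_bounds`). Near the top edge the problem is therefore that of a random
Laplacian: an eigenvalue within δ of σ_max needs large couplings along a stretch of length about
δ^(-1/2).

Upper bound: cut the line into blocks of length L ~ δ^(-1/2). A block with one coupling at most
κ_max - η produces nothing above σ_max - δ (`bad_block_form_le`), so only the blocks without such a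
site count, and these have probability q^L with q < 1 (`IsIDSMeasure.real_Ioc_le`).

Lower bound: on a block of length 4m ~ δ^(-1/2) whose couplings all exceed κ_max - ε with ε ~ δ, a
modulated tent has Rayleigh quotient above σ_max - δ/2 (`trialVec_form_ge`). Such blocks have
probability at least (C ε^ℓ)^(4m) (`IsIDSMeasure.le_real_Ioc`). Hence -log ν lies between multiples
of δ^(-1/2) and δ^(-1/2) |log δ|, and the second logarithm gives -1/2 (`tendsto_log_neg_log`).

Existence of ν: traces of powers of the Gram matrix are approximated, uniformly per site, by those
of its block-diagonal part (`abs_moment_sub_le`), to which the law of large numbers applies. So all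
moments converge to non-random limits (`exists_moment`), and on a bounded interval moments determine
the limit against continuous functions. -/

noncomputable section

namespace RankOneSums

/-! ### Spectral theory of finite Gram matrices -/

section Spectral

variable {H : Type*} [NormedAddCommGroup H] [InnerProductSpace ℂ H]
  {ι : Type*} [Fintype ι]

/-- The linear combination of a finite family of vectors with given coefficients. -/
def synth (x : ι → H) : EuclideanSpace ℂ ι →ₗ[ℂ] H where
  toFun v := ∑ i, v i • x i
  map_add' v w := by simp [add_smul, Finset.sum_add_distrib]
  map_smul' c v := by simp [Finset.smul_sum, mul_smul]

lemma synth_apply (x : ι → H) (v : EuclideanSpace ℂ ι) : synth x v = ∑ i, v i • x i := rfl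

lemma eq_zero_of_synth_eq_zero {x : ι → H} (hx : LinearIndependent ℂ x)
    {v : EuclideanSpace ℂ ι} (hv : synth x v = 0) : v = 0 := by
  rw [Fintype.linearIndependent_iff] at hx
  ext i
  exact hx (fun i => v i) hv i

variable [DecidableEq ι]

/-- The eigenvalues of the Gram matrix of a finite family, with multiplicity. -/
def gramEig (x : ι → H) : ι → ℝ := (Matrix.isHermitian_gram ℂ x).eigenvalues

/-- An orthonormal eigenbasis of the Gram matrix of a finite family. -/
def gramBasis (x : ι → H) : OrthonormalBasis ι ℂ (EuclideanSpace ℂ ι) :=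
  (Matrix.isHermitian_gram ℂ x).eigenvectorBasis

lemma inner_synth_gramBasis (x : ι → H) (v : EuclideanSpace ℂ ι) (j : ι) :
    inner ℂ (synth x v) (synth x (gramBasis x j)) = gramEig x j * inner ℂ v (gramBasis x j) := by
  rw [synth_apply, synth_apply, ← Matrix.star_dotProduct_gram_mulVec, gramBasis,
    Matrix.IsHermitian.mulVec_eigenvectorBasis, gramEig, EuclideanSpace.inner_eq_star_dotProduct,
    dotProduct_smul, dotProduct_comm]
  simp

lemma norm_sq_synth (x : ι → H) (v : EuclideanSpace ℂ ι) :
    ‖synth x v‖ ^ 2 = ∑ i, gramEig x i * ‖inner ℂ (gramBasis x i) v‖ ^ 2 := by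
  have h : ((‖synth x v‖ ^ 2 : ℝ) : ℂ) = inner ℂ (synth x v) (synth x v) := by
    rw [inner_self_eq_norm_sq_to_K]; simp
  have hv : synth x v = ∑ i, inner ℂ (gramBasis x i) v • synth x (gramBasis x i) := by
    conv_lhs => rw [← (gramBasis x).sum_repr' v]
    simp
  rw [← Complex.ofReal_inj, h]
  conv_lhs => rw [hv, inner_sum, ← hv]
  simp only [inner_smul_right, inner_synth_gramBasis]
  push_cast
  refine Finset.sum_congr rfl fun i _ => ?_
  rw [← inner_conj_symm v, mul_left_comm, Complex.mul_conj, Complex.normSq_eq_norm_sq]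
  push_cast; rfl

lemma sum_norm_sq_gramBasis (x : ι → H) (v : EuclideanSpace ℂ ι) :
    ∑ i, ‖inner ℂ (gramBasis x i) v‖ ^ 2 = ‖v‖ ^ 2 :=
  (gramBasis x).sum_sq_norm_inner_right v

lemma gramEig_eq (x : ι → H) (i : ι) : gramEig x i = ‖synth x (gramBasis x i)‖ ^ 2 := by
  rw [norm_sq_synth, Finset.sum_eq_single i]
  · simp
  · intro j _ hj
    rw [(gramBasis x).orthonormal.2 hj]; simp
  · simp

lemma gramEig_nonneg (x : ι → H) (i : ι) : 0 ≤ gramEig x i := by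
  rw [gramEig_eq]; positivity

lemma gramEig_le {x : ι → H} {σ : ℝ} (h : ∀ v, ‖synth x v‖ ^ 2 ≤ σ * ‖v‖ ^ 2) (i : ι) :
    gramEig x i ≤ σ := by
  have := h (gramBasis x i)
  rw [gramEig_eq]
  simpa using this

lemma trace_gram_pow (x : ι → H) (p : ℕ) :
    (Matrix.gram ℂ x ^ p).trace = ((∑ i, gramEig x i ^ p : ℝ) : ℂ) := by
  have h := (Matrix.isHermitian_gram ℂ x).spectral_theorem
  rw [h, ← map_pow, Matrix.diagonal_pow, Unitary.conjStarAlgAut_apply, Matrix.trace_mul_comm,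
    ← mul_assoc, Unitary.coe_star_mul_self, one_mul, Matrix.trace_diagonal]
  simp [gramEig]

lemma gramEig_pos {x : ι → H} (hx : LinearIndependent ℂ x) (i : ι) : 0 < gramEig x i := by
  rw [gramEig_eq]
  have : synth x (gramBasis x i) ≠ 0 := fun h => by
    have := eq_zero_of_synth_eq_zero hx h
    exact (gramBasis x).orthonormal.ne_zero i this
  positivity

lemma linearIndependent_synth_gramBasis {x : ι → H} (hx : LinearIndependent ℂ x) :
    LinearIndependent ℂ fun i => synth x (gramBasis x i) := by
  have h := (gramBasis x).orthonormal.linearIndependent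
  exact h.map' (synth x) (LinearMap.ker_eq_bot'.2 fun v hv => eq_zero_of_synth_eq_zero hx hv)

lemma sum_rankOne_apply_gramBasis (x : ι → H) (i : ι) :
    ∑ j, inner ℂ (x j) (synth x (gramBasis x i)) • x j =
      (gramEig x i : ℂ) • synth x (gramBasis x i) := by
  have h : ∀ j, x j = synth x (EuclideanSpace.single j 1) := fun j => by
    rw [synth_apply, Finset.sum_eq_single j] <;> simp +contextual
  rw [synth_apply x (gramBasis x i), Finset.smul_sum]
  refine Finset.sum_congr rfl fun j _ => ?_
  rw [← synth_apply, smul_smul]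
  congr 1
  conv_lhs => rw [h j]
  rw [inner_synth_gramBasis, EuclideanSpace.inner_single_left]
  simp

/-- With T = `synth x`, the operator is T T* and the Gram matrix is T* T; these share their non-zero
spectrum with multiplicity. An eigenvector for `t ≠ 0` lies in the range of T, so it expands in the
images of the eigenbasis, and independence of these images leaves only the terms with eigenvalue
`t`. -/
lemma finrank_eigenspace_eq {x : ι → H} (hx : LinearIndependent ℂ x) (P : H →ₗ[ℂ] H)
    (hP : ∀ v, P v = ∑ j, inner ℂ (x j) v • x j) {t : ℝ} (ht : t ≠ 0) :
    Module.finrank ℂ (Module.End.eigenspace P (t : ℂ)) =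
      Fintype.card {i // gramEig x i = t} := by
  have hind := linearIndependent_synth_gramBasis hx
  have key : Module.End.eigenspace P (t : ℂ) =
      Submodule.span ℂ (Set.range fun i : {i // gramEig x i = t} => synth x (gramBasis x i)) := by
    have hPy : ∀ i, P (synth x (gramBasis x i)) = (gramEig x i : ℂ) • synth x (gramBasis x i) :=
      fun i => by rw [hP, sum_rankOne_apply_gramBasis]
    apply le_antisymm
    · intro v hv
      rw [Module.End.mem_eigenspace_iff] at hv
      have ht' : (t : ℂ) ≠ 0 := by exact_mod_cast ht
      have hvs : v = synth x ((t : ℂ)⁻¹ • WithLp.toLp 2 fun j => inner ℂ (x j) v) := by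
        rw [map_smul, synth_apply]
        simp only
        rw [← hP, hv, inv_smul_smul₀ ht']
      generalize (t : ℂ)⁻¹ • (WithLp.toLp 2 fun j => inner ℂ (x j) v : EuclideanSpace ℂ ι) = w at hvs
      have hvc : v = ∑ i, inner ℂ (gramBasis x i) w • synth x (gramBasis x i) := by
        rw [hvs]
        conv_lhs => rw [← (gramBasis x).sum_repr' w]
        simp
      generalize hc : (fun i => inner ℂ (gramBasis x i) w) = c at hvc
      simp only [funext_iff] at hc
      simp only [hc] at hvc
      have h0 : ∑ i, (c i * ((gramEig x i : ℂ) - t)) • synth x (gramBasis x i) = 0 := by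
        have : P v - (t : ℂ) • v = 0 := by rw [hv, sub_self]
        rw [hvc, map_sum, Finset.smul_sum, ← Finset.sum_sub_distrib] at this
        rw [← this]
        refine Finset.sum_congr rfl fun i _ => ?_
        rw [map_smul, hPy, smul_smul, smul_smul, ← sub_smul]
        congr 1; ring
      have h1 := Fintype.linearIndependent_iff.1 hind _ h0
      rw [hvc]
      refine Submodule.sum_mem _ fun i _ => ?_
      by_cases hi : gramEig x i = t
      · exact Submodule.smul_mem _ _ (Submodule.subset_span ⟨⟨i, hi⟩, rfl⟩)
      · have : c i = 0 := by
          rcases mul_eq_zero.1 (h1 i) with h | h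
          · exact h
          · exact absurd (by exact_mod_cast sub_eq_zero.1 h) hi
        simp [this]
    · rw [Submodule.span_le]
      rintro _ ⟨⟨i, hi⟩, rfl⟩
      simp only [SetLike.mem_coe, Module.End.mem_eigenspace_iff, hPy, hi]
  rw [key, finrank_span_eq_card]
  exact hind.comp _ Subtype.val_injective

/-- If the quadratic form of the Gram matrix is at most `E` on vectors vanishing on `S`, then at
most `#S` eigenvalues exceed `E`. -/
lemma card_gramEig_gt_le (x : ι → H) (S : Finset ι) (E : ℝ)
    (h : ∀ v : EuclideanSpace ℂ ι, (∀ i ∈ S, v i = 0) → ‖synth x v‖ ^ 2 ≤ E * ‖v‖ ^ 2) :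
    Fintype.card {i // E < gramEig x i} ≤ S.card := by
  classical
  -- On the span of the eigenvectors with eigenvalue above `E`, reading off the coordinates in `S`
  -- is injective: a vector in the kernel obeys `h`, whereas its form exceeds `E` times its squared
  -- norm unless it vanishes.
  let f : ({i // E < gramEig x i} → ℂ) →ₗ[ℂ] (S → ℂ) :=
    { toFun := fun c s => (∑ i, c i • gramBasis x i : EuclideanSpace ℂ ι) s
      map_add' := fun c d => by ext s; simp [add_mul, Finset.sum_add_distrib]
      map_smul' := fun c d => by ext s; simp [Finset.mul_sum, mul_assoc] }
  have hf : Function.Injective f := by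
    rw [injective_iff_map_eq_zero]
    intro c hc
    set v : EuclideanSpace ℂ ι := ∑ i, c i • gramBasis x i with hv
    have h1 := h v fun i hi => congrFun hc ⟨i, hi⟩
    rw [norm_sq_synth, ← sum_norm_sq_gramBasis x v, Finset.mul_sum, ← sub_nonpos,
      ← Finset.sum_sub_distrib] at h1
    have hin : ∀ j, inner ℂ (gramBasis x j) v =
        if hj : E < gramEig x j then c ⟨j, hj⟩ else 0 := by
      intro j
      rw [hv, inner_sum]
      simp only [inner_smul_right, orthonormal_iff_ite.1 (gramBasis x).orthonormal]
      split_ifs with hj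
      · rw [Finset.sum_eq_single ⟨j, hj⟩]
        · simp
        · rintro ⟨b, hb⟩ _ hne
          rw [if_neg (fun h => hne (Subtype.ext h.symm)), mul_zero]
        · simp
      · refine Finset.sum_eq_zero fun i _ => ?_
        rw [if_neg (fun h : j = i => hj (by rw [h]; exact i.2)), mul_zero]
    have h2 : ∀ j ∈ Finset.univ, 0 ≤ gramEig x j * ‖inner ℂ (gramBasis x j) v‖ ^ 2 -
        E * ‖inner ℂ (gramBasis x j) v‖ ^ 2 := by
      intro j _
      rw [hin, ← sub_mul]
      split_ifs with hj
      · have := sub_pos.2 hj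
        positivity
      · simp
    have h3 := (Finset.sum_eq_zero_iff_of_nonneg h2).1 (le_antisymm h1 (Finset.sum_nonneg h2))
    ext ⟨j, hj⟩
    have h4 := h3 j (Finset.mem_univ _)
    rw [hin, dif_pos hj, ← sub_mul] at h4
    rcases mul_eq_zero.1 h4 with h5 | h5
    · exact absurd (sub_eq_zero.1 h5) hj.ne'
    · simpa using h5
  have := LinearMap.finrank_le_finrank_of_injective hf
  simpa using this

/-- A family of orthonormal trial vectors whose Rayleigh quotients exceed `σ - δ / 2` gives a lower
bound for the sum of a function of the eigenvalues. -/
lemma card_le_sum_gramEig (x : ι → H) {β : Type*} [Fintype β] (v : β → EuclideanSpace ℂ ι)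
    (hv : Orthonormal ℂ v) {σ δ : ℝ} (hδ : 0 < δ) (hq : ∀ b, σ - δ / 2 ≤ ‖synth x (v b)‖ ^ 2)
    (f : ℝ → ℝ) (hf0 : ∀ t, 0 ≤ f t) (hf : ∀ i, 1 - (σ - gramEig x i) / δ ≤ f (gramEig x i)) :
    (Fintype.card β : ℝ) / 2 ≤ ∑ i, f (gramEig x i) := by
  calc (Fintype.card β : ℝ) / 2 = ∑ b : β, (1 / 2 : ℝ) := by simp; ring
    -- The function 1 - (σ - t)/δ is affine, so its average over the spectral weights of `v b`
    -- depends only on the Rayleigh quotient and is at least 1/2.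
    _ ≤ ∑ b, ∑ i, f (gramEig x i) * ‖inner ℂ (gramBasis x i) (v b)‖ ^ 2 := by
      refine Finset.sum_le_sum fun b _ => ?_
      calc (1 / 2 : ℝ) ≤ (1 - σ / δ) * ‖v b‖ ^ 2 + ‖synth x (v b)‖ ^ 2 / δ := by
            rw [hv.1 b]
            have := hq b
            have h2 : (σ - δ / 2) / δ ≤ ‖synth x (v b)‖ ^ 2 / δ := by gcongr
            have h3 : (σ - δ / 2) / δ = σ / δ - 1 / 2 := by field_simp
            linarith
        _ = ∑ i, (1 - (σ - gramEig x i) / δ) * ‖inner ℂ (gramBasis x i) (v b)‖ ^ 2 := by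
            rw [norm_sq_synth, ← sum_norm_sq_gramBasis x, Finset.mul_sum, Finset.sum_div,
              ← Finset.sum_add_distrib]
            refine Finset.sum_congr rfl fun i _ => ?_
            ring
        _ ≤ _ := by
            refine Finset.sum_le_sum fun i _ => ?_
            exact mul_le_mul_of_nonneg_right (hf i) (by positivity)
    _ = ∑ i, f (gramEig x i) * ∑ b, ‖inner ℂ (v b) (gramBasis x i)‖ ^ 2 := by
      rw [Finset.sum_comm]
      refine Finset.sum_congr rfl fun i _ => ?_
      rw [Finset.mul_sum]
      simp only [norm_inner_symm]
    _ ≤ ∑ i, f (gramEig x i) * 1 := by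
      refine Finset.sum_le_sum fun i _ => mul_le_mul_of_nonneg_left ?_ (hf0 _)
      have := hv.sum_inner_products_le (x := gramBasis x i) (s := Finset.univ)
      simpa using this
    _ = _ := by simp

end Spectral

/-! ### The eigenvalue measure in terms of Gram eigenvalues -/

section EigenvalueMeasure

variable {H : Type*} [NormedAddCommGroup H] [InnerProductSpace ℂ H]

/-- The vectors `√κ n ψ n` with `|n| ≤ N`. -/
def scaled (ψ : ℤ → H) (κ : ℤ → ℝ) (N : ℕ) : Finset.Icc (-(N : ℤ)) (N : ℤ) → H :=
  fun n => ((√(κ n) : ℝ) : ℂ) • ψ n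

lemma linearIndependent_scaled {ψ : ℤ → H} (hψ : LinearIndependent ℂ ψ) {κ : ℤ → ℝ}
    (hκ : ∀ n, 0 < κ n) (N : ℕ) : LinearIndependent ℂ (scaled ψ κ N) := by
  have h : LinearIndependent ℂ fun n : Finset.Icc (-(N : ℤ)) (N : ℤ) => ψ n :=
    hψ.comp _ Subtype.val_injective
  have hne : ∀ n : Finset.Icc (-(N : ℤ)) (N : ℤ), ((√(κ n) : ℝ) : ℂ) ≠ 0 := fun n => by
    have := Real.sqrt_pos.2 (hκ n)
    exact_mod_cast this.ne'
  exact h.units_smul fun n => Units.mk0 _ (hne n)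

lemma finiteRankSum_apply {κ : ℤ → ℝ} (hκ : ∀ n, 0 < κ n) (ψ : ℤ → H) (N : ℕ) (v : H) :
    finiteRankSum ψ κ N v = ∑ j, inner ℂ (scaled ψ κ N j) v • scaled ψ κ N j := by
  rw [finiteRankSum, ← Finset.sum_coe_sort]
  simp only [sum_apply, smul_apply,
    InnerProductSpace.rankOne_apply, scaled, inner_smul_left, smul_smul]
  refine Finset.sum_congr rfl fun j _ => ?_
  congr 1
  rw [Complex.conj_ofReal, mul_right_comm, ← Complex.ofReal_mul, Real.mul_self_sqrt (hκ _).le]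

lemma card_Icc_neg (N : ℕ) : Fintype.card (Finset.Icc (-(N : ℤ)) (N : ℤ)) = 2 * N + 1 := by
  simp; omega

/-- By linear independence every Gram eigenvalue is positive, so excluding the eigenvalue zero loses
none of the 2N + 1 of them and the measure has mass one. -/
lemma eigenvalueMeasure_eq {ψ : ℤ → H} (hψ : LinearIndependent ℂ ψ) {κ : ℤ → ℝ}
    (hκ : ∀ n, 0 < κ n) (N : ℕ) :
    eigenvalueMeasure ψ κ N =
      (2 * (N : ENNReal) + 1)⁻¹ • ∑ i, Measure.dirac (gramEig (scaled ψ κ N) i) := by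
  rw [eigenvalueMeasure]
  congr 1
  have hx := linearIndependent_scaled hψ hκ N
  ext s hs
  rw [Measure.sum_apply _ hs, Measure.coe_finsetSum, Finset.sum_apply]
  have h1 : ∀ t : {x : ℝ // x ≠ 0},
      ((Module.finrank ℂ
        (Module.End.eigenspace (finiteRankSum ψ κ N : H →ₗ[ℂ] H) (t.1 : ℂ)) : ENNReal) •
        Measure.dirac t.1) s =
      ∑ i, if gramEig (scaled ψ κ N) i = t.1 then s.indicator 1 t.1 else 0 := by
    intro t
    rw [finrank_eigenspace_eq hx _ (fun v => finiteRankSum_apply hκ ψ N v) t.2,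
      Measure.smul_apply, Measure.dirac_apply' _ hs, Finset.sum_ite, Finset.sum_const_zero,
      add_zero, Finset.sum_const, Fintype.card_subtype, nsmul_eq_mul, smul_eq_mul]
  simp only [h1]
  rw [Summable.tsum_finsetSum fun i _ => ENNReal.summable]
  refine Finset.sum_congr rfl fun i _ => ?_
  rw [tsum_eq_single ⟨gramEig (scaled ψ κ N) i, (gramEig_pos hx i).ne'⟩, if_pos rfl,
    Measure.dirac_apply' _ hs]
  intro t ht
  rw [if_neg]
  exact fun h => ht (Subtype.ext h.symm)

lemma integral_eigenvalueMeasure {ψ : ℤ → H} (hψ : LinearIndependent ℂ ψ) {κ : ℤ → ℝ}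
    (hκ : ∀ n, 0 < κ n) (N : ℕ) (f : ℝ → ℝ) :
    ∫ t, f t ∂(eigenvalueMeasure ψ κ N) =
      (∑ i, f (gramEig (scaled ψ κ N) i)) / (2 * N + 1) := by
  rw [eigenvalueMeasure_eq hψ hκ, integral_smul_measure, integral_finsetSum_measure]
  · simp only [integral_dirac]
    rw [ENNReal.toReal_inv, ENNReal.toReal_add (by finiteness) (by simp)]
    simp [div_eq_inv_mul]
  · intro i _
    exact integrable_dirac (by simp)

end EigenvalueMeasure

/-! ### Shift-invariant Gram matrices and linear independence -/

section GramSequence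

variable {H : Type*} [NormedAddCommGroup H] [InnerProductSpace ℂ H] {ψ : ℤ → H}

lemma GramShiftInvariant.gram_add (h : GramShiftInvariant ψ) (n m s : ℤ) :
    gram ψ (n + s) (m + s) = gram ψ n m := by
  induction s using Int.induction_on with
  | zero => simp
  | succ k ih => rw [← add_assoc, ← add_assoc, h, ih]
  | pred k ih =>
    rw [← ih, ← h (n + (-k - 1)) (m + (-k - 1))]
    congr 1 <;> ring

lemma GramShiftInvariant.gram_eq (h : GramShiftInvariant ψ) (n m : ℤ) :
    gram ψ n m = gram ψ (n - m) 0 := by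
  rw [← h.gram_add n m (-m), sub_eq_add_neg, add_neg_cancel]

/-- The zeroth column is the image of a basis vector, hence in ℓ². -/
lemma GramBounded.summable (h : GramBounded ψ) : Summable fun n => ‖gram ψ n 0‖ ^ 2 := by
  obtain ⟨G, hG⟩ := h
  have := (lp.memℓp (G (lp.single 2 0 (1 : ℂ)))).summable (by norm_num)
  simpa [hG] using this

/-- The squared norm of a finite combination in terms of the Gram matrix. -/
lemma norm_sq_sum_smul (h : GramShiftInvariant ψ) (S : Finset ℤ) (w : ℤ → ℂ) (s : ℤ) :
    ((‖∑ n ∈ S, w n • ψ (n + s)‖ ^ 2 : ℝ) : ℂ) =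
      ∑ n ∈ S, ∑ m ∈ S, w n * starRingEnd ℂ (w m) * gram ψ (n - m) 0 := by
  have h1 : ((‖∑ n ∈ S, w n • ψ (n + s)‖ ^ 2 : ℝ) : ℂ) =
      inner ℂ (∑ n ∈ S, w n • ψ (n + s)) (∑ n ∈ S, w n • ψ (n + s)) := by
    rw [inner_self_eq_norm_sq_to_K]; simp
  rw [h1, inner_sum]
  refine Finset.sum_congr rfl fun n _ => ?_
  rw [sum_inner]
  refine Finset.sum_congr rfl fun m _ => ?_
  rw [inner_smul_left, inner_smul_right, ← h.gram_eq, ← h.gram_add n m s, gram]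
  ring

lemma tendsto_inner_of_summable (h : GramShiftInvariant ψ)
    (hs : Summable fun n => ‖gram ψ n 0‖ ^ 2) (a m : ℤ) :
    Tendsto (fun k : ℕ => inner ℂ (ψ m) (ψ (a + k))) atTop (𝓝 0) := by
  have h1 : Tendsto (fun n : ℤ => ‖gram ψ n 0‖ ^ 2) cofinite (𝓝 0) := hs.tendsto_cofinite_zero
  have hinj : Function.Injective fun k : ℕ => a + (k : ℤ) - m := fun i j hij => by
    simp only at hij; omega
  have h2 := h1.comp hinj.tendsto_cofinite
  rw [Nat.cofinite_eq_atTop] at h2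
  rw [tendsto_zero_iff_norm_tendsto_zero]
  have h3 := h2.sqrt
  simp only [Function.comp_def, Real.sqrt_sq (norm_nonneg _), Real.sqrt_zero] at h3
  simp only [← h.gram_eq] at h3
  exact h3

/-- Unit vectors with a shift-invariant square-summable Gram matrix are linearly independent. -/
lemma linearIndependent_of_summable (hnorm : ∀ n, ‖ψ n‖ = 1) (h : GramShiftInvariant ψ)
    (hs : Summable fun n => ‖gram ψ n 0‖ ^ 2) : LinearIndependent ℂ ψ := by
  rw [linearIndependent_iff']
  by_contra! hcon
  obtain ⟨s, w, hw, i₀, hi₀, hwi₀⟩ := hcon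
  set t := s.filter fun n => w n ≠ 0 with ht
  have htne : t.Nonempty := ⟨i₀, by simp [ht, hi₀, hwi₀]⟩
  -- Norms of finite combinations are invariant under shifts of the vectors, so one relation yields
  -- all its translates.
  have hsum : ∀ r : ℤ, ∑ n ∈ t, w n • ψ (n + r) = 0 := by
    intro r
    have h0 : ∑ n ∈ t, w n • ψ (n + 0) = 0 := by
      rw [ht, Finset.sum_filter_of_ne]
      · simpa using hw
      · intro n _ hn h0
        simp [h0] at hn
    have h1 := norm_sq_sum_smul h t w 0
    rw [h0, ← norm_sq_sum_smul h t w r] at h1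
    simpa using h1.symm
  set a := t.max' htne with ha
  set b := t.min' htne with hb
  have hwa : w a ≠ 0 := (Finset.mem_filter.1 (t.max'_mem htne)).2
  set V := Submodule.span ℂ (ψ '' Ico b a) with hV
  -- Solving the translated relation for its leading term keeps every later vector in the span of
  -- the finitely many vectors indexed by [b, a).
  have hmem : ∀ k : ℕ, ψ (a + k) ∈ V := by
    intro k
    induction k using Nat.strong_induction_on with
    | _ k ih =>
      have h1 := hsum k
      rw [← Finset.add_sum_erase t _ (t.max'_mem htne)] at h1
      have h2 : ψ (a + k) = -((w a)⁻¹ • ∑ n ∈ t.erase a, w n • ψ (n + k)) := by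
        rw [← ha] at h1
        rw [eq_neg_of_add_eq_zero_right h1, smul_neg, neg_neg, inv_smul_smul₀ hwa]
      rw [h2]
      refine V.neg_mem (V.smul_mem _ (V.sum_mem fun n hn => V.smul_mem _ ?_))
      have hn1 := t.min'_le n (Finset.mem_of_mem_erase hn)
      have hn2 := t.le_max' n (Finset.mem_of_mem_erase hn)
      have hn3 := Finset.ne_of_mem_erase hn
      rw [← ha] at hn2
      rw [← hb] at hn1
      by_cases hc : n + k < a
      · exact Submodule.subset_span ⟨n + k, ⟨by omega, hc⟩, rfl⟩
      · have := ih (n + k - a).toNat (by omega)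
        rwa [show a + ((n + k - a).toNat : ℤ) = n + k by omega] at this
  have hfin : FiniteDimensional ℂ V :=
    FiniteDimensional.span_of_finite ℂ ((Set.finite_Ico b a).image ψ)
  -- The vectors `ψ (a + k)` tend weakly to zero; in the finite-dimensional `V` they then tend to
  -- zero in norm, against their being unit vectors.
  have hlim : ∀ v ∈ V, Tendsto (fun k : ℕ => inner ℂ v (ψ (a + k))) atTop (𝓝 0) := by
    intro v hv
    induction hv using Submodule.span_induction with
    | mem v hv =>
      obtain ⟨m, _, rfl⟩ := hv
      exact tendsto_inner_of_summable h hs a m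
    | zero => simp
    | add u v _ _ hu hv => simpa [inner_add_left] using hu.add hv
    | smul c v _ hv => 
      simp only [inner_smul_left]
      simpa using hv.const_mul (starRingEnd ℂ c)
  let e := stdOrthonormalBasis ℂ V
  have h1 : Tendsto (fun k : ℕ => ∑ i, ‖inner ℂ (e i : H) (ψ (a + k))‖ ^ 2) atTop (𝓝 0) := by
    have := tendsto_finsetSum (Finset.univ : Finset (Fin (Module.finrank ℂ V)))
      fun i _ => ((hlim (e i) (e i).2).norm.pow 2)
    simpa using this
  have h2 : ∀ k : ℕ, ∑ i, ‖inner ℂ (e i : H) (ψ (a + k))‖ ^ 2 = 1 := by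
    intro k
    have := e.sum_sq_norm_inner_right ⟨ψ (a + k), hmem k⟩
    simpa [hnorm] using this
  simp only [h2] at h1
  exact one_ne_zero (tendsto_nhds_unique tendsto_const_nhds h1)

end GramSequence

/-! ### Trigonometric polynomials and the twisted Dirichlet form -/

section Trig

/-- The trigonometric polynomial with prescribed coefficients. -/
def trig (S : Finset ℤ) (w : ℤ → ℂ) (k : ℝ) : ℂ :=
  ∑ n ∈ S, w n * Complex.exp (-(Complex.I * n * k))

lemma continuous_trig (S : Finset ℤ) (w : ℤ → ℂ) : Continuous (trig S w) := by
  unfold trig; fun_prop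

/-- Used with `F` = φ, where the right side is the Gram form, and with `F` = 1, where it reduces to
Parseval's identity. -/
lemma integral_mul_norm_sq_trig {F : ℝ → ℝ} (hF : Continuous F) {c : ℤ → ℂ}
    (hc : ∀ n : ℤ, (1 / (2 * Real.pi) : ℂ) *
      ∫ k in (-Real.pi)..Real.pi, (F k : ℂ) * Complex.exp (-(Complex.I * n * k)) = c n)
    (S : Finset ℤ) (w : ℤ → ℂ) :
    (((1 / (2 * Real.pi)) * ∫ k in (-Real.pi)..Real.pi, F k * ‖trig S w k‖ ^ 2 : ℝ) : ℂ) =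
      ∑ n ∈ S, ∑ m ∈ S, w n * starRingEnd ℂ (w m) * c (n - m) := by
  have hpt : ∀ k : ℝ, ((F k * ‖trig S w k‖ ^ 2 : ℝ) : ℂ) =
      ∑ n ∈ S, ∑ m ∈ S, (w n * starRingEnd ℂ (w m)) *
        ((F k : ℂ) * Complex.exp (-(Complex.I * (n - m : ℤ) * k))) := by
    intro k
    push_cast
    rw [← Complex.mul_conj', trig, map_sum, Finset.sum_mul_sum, Finset.mul_sum]
    refine Finset.sum_congr rfl fun n _ => ?_
    rw [Finset.mul_sum]
    refine Finset.sum_congr rfl fun m _ => ?_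
    rw [map_mul, ← Complex.exp_conj]
    have : Complex.exp (-(Complex.I * ((n : ℂ) - m) * k)) = Complex.exp (-(Complex.I * n * k)) *
        Complex.exp (starRingEnd ℂ (-(Complex.I * m * k))) := by
      rw [← Complex.exp_add]
      congr 1
      simp
      ring
    rw [this]
    ring
  rw [Complex.ofReal_mul, ← intervalIntegral.integral_ofReal]
  simp only [hpt]
  rw [intervalIntegral.integral_finsetSum, Finset.mul_sum]
  · refine Finset.sum_congr rfl fun n _ => ?_
    rw [intervalIntegral.integral_finsetSum, Finset.mul_sum]
    · refine Finset.sum_congr rfl fun m _ => ?_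
      rw [intervalIntegral.integral_const_mul, ← hc (n - m)]
      push_cast
      ring
    · intro m _
      exact Continuous.intervalIntegrable (by fun_prop) _ _
  · intro n _
    exact Continuous.intervalIntegrable (by fun_prop) _ _

lemma fourier_one (n : ℤ) : (1 / (2 * Real.pi) : ℂ) *
    ∫ k in (-Real.pi)..Real.pi, ((1 : ℝ) : ℂ) * Complex.exp (-(Complex.I * n * k)) =
      if n = 0 then 1 else 0 := by
  have hpi : (Real.pi : ℂ) ≠ 0 := by exact_mod_cast Real.pi_ne_zero
  split_ifs with h
  · subst h
    simp
    field_simp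
    ring
  · have hne : -(Complex.I * n) ≠ 0 := by simp [h]
    have : ∀ k : ℝ, ((1 : ℝ) : ℂ) * Complex.exp (-(Complex.I * n * k)) =
        Complex.exp (-(Complex.I * n) * k) := fun k => by rw [Complex.ofReal_one, one_mul, neg_mul]
    simp only [this]
    rw [integral_exp_mul_complex hne]
    have h1 : -(Complex.I * n) * ((Real.pi : ℝ) : ℂ) =
        -(Complex.I * n) * ((-Real.pi : ℝ) : ℂ) + (-n : ℤ) * (2 * Real.pi * Complex.I) := by
      push_cast; ring
    rw [h1, Complex.exp_add, Complex.exp_int_mul_two_pi_mul_I]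
    simp

lemma parseval_trig (S : Finset ℤ) (w : ℤ → ℂ) :
    (1 / (2 * Real.pi)) * ∫ k in (-Real.pi)..Real.pi, ‖trig S w k‖ ^ 2 = ∑ n ∈ S, ‖w n‖ ^ 2 := by
  have h := integral_mul_norm_sq_trig (F := fun _ => 1) continuous_const fourier_one S w
  simp only [one_mul] at h
  rw [← Complex.ofReal_inj, h]
  push_cast
  refine Finset.sum_congr rfl fun n hn => ?_
  rw [Finset.sum_eq_single n]
  · simp [Complex.mul_conj']
  · intro m _ hm
    rw [if_neg (by omega), mul_zero]
  · exact fun h => absurd hn h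

/-- The twisted difference of a sequence. -/
def twistDiff (θ : ℝ) (w : ℤ → ℂ) (n : ℤ) : ℂ := w n - Complex.exp (Complex.I * θ) * w (n - 1)

lemma norm_sq_one_sub_exp (θ k : ℝ) :
    ‖1 - Complex.exp (Complex.I * θ) * Complex.exp (-(Complex.I * k))‖ ^ 2 =
      2 * (1 - Real.cos (k - θ)) := by
  rw [← Complex.exp_add, show Complex.I * θ + -(Complex.I * k) = ((θ - k : ℝ) : ℂ) * Complex.I by
    push_cast; ring, Complex.sq_norm, Complex.normSq_apply]
  simp only [Complex.sub_re, Complex.one_re, Complex.exp_ofReal_mul_I_re, Complex.sub_im,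
    Complex.one_im, Complex.exp_ofReal_mul_I_im]
  rw [← Real.cos_neg (k - θ), neg_sub]
  nlinarith [Real.sin_sq_add_cos_sq (θ - k)]

/-- The twisted difference is a Fourier multiplier. The condition `hw` keeps both the support of `w`
and its right translate inside `S`, so nothing is cut off. -/
lemma trig_twistDiff (θ : ℝ) (S : Finset ℤ) (w : ℤ → ℂ) (hw : ∀ n, w n ≠ 0 → n ∈ S ∧ n + 1 ∈ S)
    (k : ℝ) : trig S (twistDiff θ w) k =
      (1 - Complex.exp (Complex.I * θ) * Complex.exp (-(Complex.I * k))) * trig S w k := by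
  have h1 : ∑ n ∈ S, w (n - 1) * Complex.exp (-(Complex.I * n * k)) =
      Complex.exp (-(Complex.I * k)) * trig S w k := by
    have e1 : ∑ n ∈ S, w (n - 1) * Complex.exp (-(Complex.I * n * k)) =
        ∑ᶠ n : ℤ, w (n - 1) * Complex.exp (-(Complex.I * n * k)) := by
      rw [finsum_eq_sum_of_support_subset]
      intro n hn
      simp only [Function.mem_support] at hn
      simpa using (hw _ (left_ne_zero_of_mul hn)).2
    have e2 : trig S w k = ∑ᶠ n : ℤ, w n * Complex.exp (-(Complex.I * n * k)) := by
      rw [trig, finsum_eq_sum_of_support_subset]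
      intro n hn
      simp only [Function.mem_support] at hn
      simpa using (hw _ (left_ne_zero_of_mul hn)).1
    rw [e1, e2, ← finsum_comp_equiv (Equiv.subRight (1 : ℤ))
      (f := fun n : ℤ => w n * Complex.exp (-(Complex.I * n * k)))]
    rw [← smul_eq_mul, smul_finsum]
    refine finsum_congr fun n => ?_
    simp only [Equiv.subRight_apply, smul_eq_mul]
    have : Complex.exp (-(Complex.I * n * k)) = Complex.exp (-(Complex.I * k)) *
        Complex.exp (-(Complex.I * (n - 1 : ℤ) * k)) := by
      rw [← Complex.exp_add]; congr 1; push_cast; ring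
    rw [this]; ring
  rw [sub_mul, one_mul, mul_assoc, ← h1]
  simp only [trig, twistDiff, sub_mul, Finset.sum_sub_distrib, Finset.mul_sum, mul_assoc]

lemma integral_one_sub_cos_trig (θ : ℝ) (S : Finset ℤ) (w : ℤ → ℂ)
    (hw : ∀ n, w n ≠ 0 → n ∈ S ∧ n + 1 ∈ S) :
    (1 / (2 * Real.pi)) * ∫ k in (-Real.pi)..Real.pi,
      2 * (1 - Real.cos (k - θ)) * ‖trig S w k‖ ^ 2 = ∑ n ∈ S, ‖twistDiff θ w n‖ ^ 2 := by
  rw [← parseval_trig]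
  simp only [trig_twistDiff θ S w hw, norm_mul, mul_pow, norm_sq_one_sub_exp]

end Trig

/-! ### The symbol near its maximum and the resulting form bounds -/

section Symbol

variable {φ : ℝ → ℝ} {kmax : ℝ}

/-- L'Hôpital reduces the ratio to -φ'(k) / sin(k - kmax), which is a quotient of two slopes at
`kmax` because φ' vanishes there. -/
lemma tendsto_symbol_ratio (hsmooth : ContDiff ℝ 2 φ) (hmax : ∀ k, φ k ≤ φ kmax) :
    Tendsto (fun k => (φ kmax - φ k) / (1 - Real.cos (k - kmax))) (𝓝[≠] kmax)
      (𝓝 (-iteratedDeriv 2 φ kmax)) := by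
  have hd : Differentiable ℝ φ := hsmooth.differentiable (by norm_num)
  have hd1 : ContDiff ℝ 1 (deriv φ) :=
    ((contDiff_succ_iff_deriv (n := 1)).1 (by exact_mod_cast hsmooth)).2.2
  have hd2 : HasDerivAt (deriv φ) (iteratedDeriv 2 φ kmax) kmax := by
    rw [iteratedDeriv_succ, iteratedDeriv_one]
    exact (hd1.differentiable (by norm_num) _).hasDerivAt
  have h0 : deriv φ kmax = 0 := IsLocalMax.deriv_eq_zero (Eventually.of_forall hmax)
  have hsin : HasDerivAt (fun k => Real.sin (k - kmax)) 1 kmax := by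
    have := (Real.hasDerivAt_sin (kmax - kmax)).comp_sub_const kmax kmax
    simpa using this
  have hsl : Tendsto (fun k => -deriv φ k / Real.sin (k - kmax)) (𝓝[≠] kmax)
      (𝓝 (-iteratedDeriv 2 φ kmax)) := by
    have h1 := (hasDerivAt_iff_tendsto_slope.1 hd2)
    have h2 := (hasDerivAt_iff_tendsto_slope.1 hsin)
    have h3 := (h1.div h2 one_ne_zero).neg
    rw [div_one] at h3
    refine h3.congr' ?_
    filter_upwards [self_mem_nhdsWithin] with k hk
    have hk' : k - kmax ≠ 0 := sub_ne_zero.2 hk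
    simp only [Pi.div_apply, slope_def_field, h0, sub_self, Real.sin_zero, sub_zero]
    field_simp
  refine HasDerivAt.lhopital_zero_nhdsNE (f' := fun k => -deriv φ k)
    (g' := fun k => Real.sin (k - kmax)) ?_ ?_ ?_ ?_ ?_ hsl
  · exact Eventually.of_forall fun k => ((hd k).hasDerivAt.const_sub _)
  · refine Eventually.of_forall fun k => ?_
    have := ((Real.hasDerivAt_cos (k - kmax)).comp_sub_const k kmax).const_sub 1
    simpa using this
  · have h2 := hsin.eventually_ne (c := 0) one_ne_zero
    exact h2
  · have : Tendsto (fun k => φ kmax - φ k) (𝓝 kmax) (𝓝 (φ kmax - φ kmax)) :=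
      (continuous_const.sub hsmooth.continuous).tendsto _
    rw [sub_self] at this
    exact this.mono_left nhdsWithin_le_nhds
  · have : Tendsto (fun k => 1 - Real.cos (k - kmax)) (𝓝 kmax)
        (𝓝 (1 - Real.cos (kmax - kmax))) :=
      Continuous.tendsto (by fun_prop) _
    rw [sub_self kmax, Real.cos_zero, sub_self] at this
    exact this.mono_left nhdsWithin_le_nhds

lemma one_sub_cos_pos {k θ : ℝ} (hk : k ∈ Icc (θ - Real.pi) (θ + Real.pi)) (hne : k ≠ θ) :
    0 < 1 - Real.cos (k - θ) := by
  have hle := Real.cos_le_one (k - θ)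
  refine sub_pos.2 (lt_of_le_of_ne hle fun h => ?_)
  have hpi := Real.pi_pos
  have := (Real.cos_eq_one_iff_of_lt_of_lt (by linarith [hk.1]) (by linarith [hk.2])).1 h
  exact hne (sub_eq_zero.1 this)

/-- A non-degenerate maximum attained at a single point is comparable with `1 - cos`. -/
lemma exists_symbol_bounds (hper : Function.Periodic φ (2 * Real.pi)) (hsmooth : ContDiff ℝ 2 φ)
    (hmax : ∀ k, φ k ≤ φ kmax)
    (hsingle : ∀ k, φ k = φ kmax → ∃ m : ℤ, k = kmax + m * (2 * Real.pi))
    (hnondeg : iteratedDeriv 2 φ kmax ≠ 0) :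
    ∃ c₁ > 0, ∃ c₂ > 0, ∀ k, c₂ * (2 * (1 - Real.cos (k - kmax))) ≤ φ kmax - φ k ∧
      φ kmax - φ k ≤ c₁ * (2 * (1 - Real.cos (k - kmax))) := by
  have hpi := Real.pi_pos
  have hlim := tendsto_symbol_ratio hsmooth hmax
  set r := fun k => (φ kmax - φ k) / (1 - Real.cos (k - kmax)) with hr
  set l := -iteratedDeriv 2 φ kmax with hl
  have hr0 : ∀ k, 0 ≤ r k := fun k =>
    div_nonneg (sub_nonneg.2 (hmax k)) (sub_nonneg.2 (Real.cos_le_one _))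
  have hl0 : 0 < l := lt_of_le_of_ne (ge_of_tendsto' hlim hr0) (by rw [hl]; exact (neg_ne_zero.2 hnondeg).symm)
  set I := Icc (kmax - Real.pi) (kmax + Real.pi) with hI
  -- Filling in the limit at `kmax` makes the ratio continuous and positive on a full period centred
  -- there; its minimum and maximum give the two constants.
  set R := Function.update r kmax l with hR
  have hcont : ContinuousOn R I := by
    intro k hk
    by_cases hkk : k = kmax
    · subst hkk
      exact (continuousAt_update_same.2 hlim).continuousWithinAt
    · refine ContinuousAt.continuousWithinAt ?_
      rw [hR, continuousAt_update_of_ne hkk]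
      refine ContinuousAt.div ?_ (by fun_prop) (one_sub_cos_pos hk hkk).ne'
      exact (continuous_const.sub hsmooth.continuous).continuousAt
  have hpos : ∀ k ∈ I, 0 < R k := by
    intro k hk
    by_cases hkk : k = kmax
    · subst hkk
      rw [hR, Function.update_self]; exact hl0
    · rw [hR, Function.update_of_ne hkk]
      refine div_pos (lt_of_le_of_ne (sub_nonneg.2 (hmax k)) fun h => ?_) (one_sub_cos_pos hk hkk)
      obtain ⟨m, hm⟩ := hsingle k (sub_eq_zero.1 h.symm).symm
      -- A translate of `kmax` by a multiple of 2π at distance at most π is `kmax` itself.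
      have hm1 : (m : ℝ) * (2 * Real.pi) ≤ 1 / 2 * (2 * Real.pi) := by linarith [hk.2]
      have hm2 : (-1 / 2 : ℝ) * (2 * Real.pi) ≤ m * (2 * Real.pi) := by linarith [hk.1]
      have hm3 := le_of_mul_le_mul_right hm1 (by positivity)
      have hm4 := le_of_mul_le_mul_right hm2 (by positivity)
      have hm5 : m < 1 := by
        have : (m : ℝ) < (1 : ℤ) := by push_cast; linarith
        exact_mod_cast this
      have hm6 : -1 < m := by
        have : ((-1 : ℤ) : ℝ) < m := by push_cast; linarith
        exact_mod_cast this
      have : m = 0 := by omega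
      subst this
      simp at hm
      exact hkk hm
  have hne : I.Nonempty := ⟨kmax, by constructor <;> linarith⟩
  obtain ⟨k₁, hk₁, hmin⟩ := isCompact_Icc.exists_isMinOn hne hcont
  obtain ⟨k₂, hk₂, hmx⟩ := isCompact_Icc.exists_isMaxOn hne hcont
  have key : ∀ k ∈ I, R k₁ / 2 * (2 * (1 - Real.cos (k - kmax))) ≤ φ kmax - φ k ∧
      φ kmax - φ k ≤ R k₂ / 2 * (2 * (1 - Real.cos (k - kmax))) := by
    intro k hk
    by_cases hkk : k = kmax
    · subst hkk; simp
    · have h1 : R k₁ ≤ R k := hmin hk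
      have h2 : R k ≤ R k₂ := hmx hk
      have hp := one_sub_cos_pos hk hkk
      have h3 : R k = r k := by rw [hR, Function.update_of_ne hkk]
      have h4 : φ kmax - φ k = r k * (1 - Real.cos (k - kmax)) := by
        rw [hr]; field_simp
      rw [h3] at h1 h2
      rw [h4]
      constructor
      · nlinarith [mul_le_mul_of_nonneg_right h1 hp.le]
      · nlinarith [mul_le_mul_of_nonneg_right h2 hp.le]
  refine ⟨R k₂ / 2, half_pos (hpos _ hk₂), R k₁ / 2, half_pos (hpos _ hk₁), fun k => ?_⟩
  have hcos : Function.Periodic (fun k => Real.cos (k - kmax)) (2 * Real.pi) := fun k => by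
    simp only [show k + 2 * Real.pi - kmax = k - kmax + 2 * Real.pi by ring, Real.cos_add_two_pi]
  have hpair : Function.Periodic (fun k => (φ k, Real.cos (k - kmax))) (2 * Real.pi) := fun k =>
    Prod.ext (hper k) (hcos k)
  obtain ⟨k', hk', he⟩ := hpair.exists_mem_Ico (by positivity) k (kmax - Real.pi)
  have h1 := key k' ⟨hk'.1, by linarith [hk'.2]⟩
  simp only [Prod.mk.injEq] at he
  rw [he.1, he.2]
  exact h1

/-- Non-empty superlevel sets of a continuous function are open and so have positive measure.
Passing through the closure of the open period covers a maximiser sitting at the endpoint π. -/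
lemma symbolMax_eq (hper : Function.Periodic φ (2 * Real.pi)) (hcont : Continuous φ)
    (hmax : ∀ k, φ k ≤ φ kmax) : symbolMax φ = φ kmax := by
  have hpi := Real.pi_pos
  have hset : {a | ∀ᵐ k ∂(volume.restrict (Ioc (-Real.pi) Real.pi)), φ k ≤ a} = Ici (φ kmax) := by
    ext a
    simp only [mem_ofPred_eq, mem_Ici]
    refine ⟨fun h => ?_, fun h => Eventually.of_forall fun k => (hmax k).trans h⟩
    by_contra! hlt
    obtain ⟨k, hk, he⟩ := hper.exists_mem_Ioc (by positivity) kmax (-Real.pi)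
    rw [he] at hlt
    have hopen : IsOpen {x | a < φ x} := isOpen_lt continuous_const hcont
    have hclos : k ∈ closure (Ioo (-Real.pi) Real.pi) := by
      rw [closure_Ioo (by linarith)]
      exact ⟨hk.1.le, by linarith [hk.2]⟩
    obtain ⟨y, hy1, hy2⟩ := mem_closure_iff.1 hclos _ hopen hlt
    have hpos : 0 < volume ({x | a < φ x} ∩ Ioo (-Real.pi) Real.pi) :=
      (hopen.inter isOpen_Ioo).measure_pos volume ⟨y, hy1, hy2⟩
    rw [ae_restrict_iff' measurableSet_Ioc, ae_iff] at h
    refine hpos.ne' (measure_mono_null ?_ h)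
    intro x hx
    simp only [mem_ofPred_eq, Classical.not_imp, not_le]
    exact ⟨⟨hx.2.1, hx.2.2.le⟩, hx.1⟩
  rw [symbolMax, essSup_eq_sInf]
  have : {a | volume.restrict (Ioc (-Real.pi) Real.pi) {x | a < φ x} = 0} = Ici (φ kmax) := by
    rw [← hset]
    ext a
    simp only [mem_ofPred_eq, ae_iff, not_le]
  rw [this, csInf_Ici]

variable {H : Type*} [NormedAddCommGroup H] [InnerProductSpace ℂ H] {ψ : ℤ → H}

/-- Two-sided comparison of the Gram form with the twisted discrete Dirichlet form. -/
lemma exists_form_bounds (hshift : GramShiftInvariant ψ) (hφ : IsSymbol ψ φ)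
    (hsmooth : ContDiff ℝ 2 φ) (hmax : ∀ k, φ k ≤ φ kmax)
    (hsingle : ∀ k, φ k = φ kmax → ∃ m : ℤ, k = kmax + m * (2 * Real.pi))
    (hnondeg : iteratedDeriv 2 φ kmax ≠ 0) :
    ∃ c₁ > 0, ∃ c₂ > 0, ∀ (S : Finset ℤ) (w : ℤ → ℂ), (∀ n, w n ≠ 0 → n ∈ S ∧ n + 1 ∈ S) →
      c₂ * ∑ n ∈ S, ‖twistDiff kmax w n‖ ^ 2 ≤
        φ kmax * ∑ n ∈ S, ‖w n‖ ^ 2 - ‖∑ n ∈ S, w n • ψ n‖ ^ 2 ∧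
      φ kmax * ∑ n ∈ S, ‖w n‖ ^ 2 - ‖∑ n ∈ S, w n • ψ n‖ ^ 2 ≤
        c₁ * ∑ n ∈ S, ‖twistDiff kmax w n‖ ^ 2 := by
  obtain ⟨c₁, hc₁, c₂, hc₂, hb⟩ := exists_symbol_bounds hφ.periodic hsmooth hmax hsingle hnondeg
  refine ⟨c₁, hc₁, c₂, hc₂, fun S w hw => ?_⟩
  have hpi := Real.pi_pos
  have hcφ := hsmooth.continuous
  have hct := continuous_trig S w
  have h1 : ‖∑ n ∈ S, w n • ψ n‖ ^ 2 =
      (1 / (2 * Real.pi)) * ∫ k in (-Real.pi)..Real.pi, φ k * ‖trig S w k‖ ^ 2 := by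
    rw [← Complex.ofReal_inj, integral_mul_norm_sq_trig hcφ hφ.fourier]
    have := norm_sq_sum_smul hshift S w 0
    simpa using this
  have h2 : φ kmax * ∑ n ∈ S, ‖w n‖ ^ 2 - ‖∑ n ∈ S, w n • ψ n‖ ^ 2 =
      (1 / (2 * Real.pi)) *
        ∫ k in (-Real.pi)..Real.pi, (φ kmax - φ k) * ‖trig S w k‖ ^ 2 := by
    rw [h1, ← parseval_trig, mul_left_comm, ← mul_sub, ← intervalIntegral.integral_const_mul,
      ← intervalIntegral.integral_sub]
    · simp only [sub_mul]
    · exact Continuous.intervalIntegrable (by fun_prop) _ _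
    · exact Continuous.intervalIntegrable (by fun_prop) _ _
  rw [h2, ← integral_one_sub_cos_trig kmax S w hw, mul_left_comm c₂, mul_left_comm c₁,
    ← intervalIntegral.integral_const_mul c₁, ← intervalIntegral.integral_const_mul c₂]
  have hnn : 0 ≤ 1 / (2 * Real.pi) := by positivity
  have hle : -Real.pi ≤ Real.pi := by linarith
  constructor
  · apply mul_le_mul_of_nonneg_left _ hnn
    apply intervalIntegral.integral_mono_on hle
    · exact Continuous.intervalIntegrable (by fun_prop) _ _
    · exact Continuous.intervalIntegrable (by fun_prop) _ _
    · intro k _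
      rw [← mul_assoc]
      exact mul_le_mul_of_nonneg_right (hb k).1 (by positivity)
  · apply mul_le_mul_of_nonneg_left _ hnn
    apply intervalIntegral.integral_mono_on hle
    · exact Continuous.intervalIntegrable (by fun_prop) _ _
    · exact Continuous.intervalIntegrable (by fun_prop) _ _
    · intro k _
      rw [← mul_assoc]
      exact mul_le_mul_of_nonneg_right (hb k).2 (by positivity)

end Symbol

/-! ### Law of large numbers over disjoint blocks -/

section BlockAverages

/-- The restriction of a sequence to the `j`-th block of length `L`. -/
def block (κ : ℤ → ℝ) (L : ℕ) (j : ℤ) : Fin L → ℝ := fun a => κ (j * L + (a : ℕ))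

/-- The indices of the blocks of length `L` contained in `[-N, N]`. -/
def blockIndices (L N : ℕ) : Finset ℤ := Finset.Ico (-((N / L : ℕ) : ℤ)) ((N / L : ℕ) : ℤ)

lemma mul_add_injective {L : ℕ} {e : ℕ → ℤ} (he : Function.Injective e) :
    Function.Injective fun p : ℕ × Fin L => e p.1 * L + ((p.2 : ℕ) : ℤ) := by
  rintro ⟨i, a⟩ ⟨j, b⟩ h
  simp only at h
  have ha : ((a : ℕ) : ℤ) < L := by exact_mod_cast a.2
  have hb : ((b : ℕ) : ℤ) < L := by exact_mod_cast b.2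
  have hL : (0 : ℤ) < L := by omega
  have h1 : e i = e j := by
    have := congrArg (· / (L : ℤ)) h
    rwa [add_comm, add_comm (e j * L), Int.add_mul_ediv_right _ _ hL.ne',
      Int.add_mul_ediv_right _ _ hL.ne', Int.ediv_eq_zero_of_lt (by omega) ha,
      Int.ediv_eq_zero_of_lt (by omega) hb, zero_add, zero_add] at this
  have h2 : a = b := by
    rw [h1] at h
    exact Fin.ext (by omega)
  rw [he h1, h2]

variable (P₀ : Measure ℝ) [IsProbabilityMeasure P₀]

/-- Disjoint blocks of an i.i.d. sequence are i.i.d.; `e` lists the chosen blocks along ℕ, as the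
strong law requires. -/
lemma map_block_infinitePi {L : ℕ} {e : ℕ → ℤ} (he : Function.Injective e) :
    MeasurePreserving (fun (κ : ℤ → ℝ) (i : ℕ) => block κ L (e i))
      (Measure.infinitePi fun _ : ℤ => P₀)
      (Measure.infinitePi fun _ : ℕ => Measure.pi fun _ : Fin L => P₀) := by
  refine ⟨by unfold block; fun_prop, ?_⟩
  have h1 := Measure.map_infinitePi_infinitePi_of_inj (P := fun _ : ℤ => P₀)
    (mul_add_injective (L := L) he)
  have h2 := Measure.infinitePi_map_curry fun (_ : ℕ) (_ : Fin L) => P₀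
  rw [← h1, Measure.map_map (MeasurableEquiv.measurable _) (by fun_prop)] at h2
  simp only [Measure.infinitePi_eq_pi] at h2
  exact h2

lemma ae_tendsto_average {L : ℕ} {e : ℕ → ℤ} (he : Function.Injective e)
    {F : (Fin L → ℝ) → ℝ} (hF : Measurable F)
    (hint : Integrable F (Measure.pi fun _ => P₀)) :
    ∀ᵐ κ ∂(Measure.infinitePi fun _ : ℤ => P₀),
      Tendsto (fun M : ℕ => (∑ i ∈ Finset.range M, F (block κ L (e i))) / M) atTop
        (𝓝 (∫ x, F x ∂(Measure.pi fun _ => P₀))) := by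
  set μ := Measure.infinitePi fun _ : ℕ => Measure.pi fun _ : Fin L => P₀
  have hev : ∀ i : ℕ, MeasurePreserving (fun ω : ℕ → Fin L → ℝ => ω i) μ
      (Measure.pi fun _ : Fin L => P₀) := fun i => measurePreserving_eval_infinitePi _ i
  have hindep := ProbabilityTheory.iIndepFun_infinitePi
    (P := fun _ : ℕ => Measure.pi fun _ : Fin L => P₀) (X := fun _ => F) (fun _ => hF)
  have hlaw := ProbabilityTheory.strong_law_ae_real (μ := μ)
    (fun (i : ℕ) (ω : ℕ → Fin L → ℝ) => F (ω i))
    ((hev 0).integrable_comp_of_integrable hint)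
    (fun i j hij => hindep.indepFun hij)
    (fun i => by
      refine ⟨(hF.comp (measurable_pi_apply i)).aemeasurable,
        (hF.comp (measurable_pi_apply 0)).aemeasurable, ?_⟩
      change μ.map (F ∘ fun ω => ω i) = μ.map (F ∘ fun ω => ω 0)
      rw [← Measure.map_map hF (measurable_pi_apply i), ← Measure.map_map hF (measurable_pi_apply 0),
        (hev i).map_eq, (hev 0).map_eq])
  have h0 : ∫ ω, F (ω 0) ∂μ = ∫ x, F x ∂(Measure.pi fun _ : Fin L => P₀) := by
    rw [← (hev 0).map_eq, integral_map (measurable_pi_apply 0).aemeasurable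
      hF.aestronglyMeasurable]
  rw [h0] at hlaw
  exact (map_block_infinitePi P₀ he).quasiMeasurePreserving.ae hlaw

lemma tendsto_div_two_mul_add_one {L : ℕ} (hL : 0 < L) :
    Tendsto (fun N : ℕ => ((N / L : ℕ) : ℝ) / (2 * N + 1)) atTop (𝓝 (1 / (2 * L))) := by
  have hL' : (0 : ℝ) < L := by exact_mod_cast hL
  have h1 : Tendsto (fun N : ℕ => (N : ℝ) / (2 * N + 1)) atTop (𝓝 (1 / 2)) := by
    have := (tendsto_inv_atTop_nhds_zero_nat (𝕜 := ℝ)).const_add 2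
    have h2 := this.inv₀ (by norm_num)
    rw [add_zero, inv_eq_one_div] at h2
    refine h2.congr' ?_
    filter_upwards [eventually_gt_atTop 0] with N hN
    have : (0 : ℝ) < N := by exact_mod_cast hN
    field_simp
  have h2 : Tendsto (fun N : ℕ => (1 : ℝ) / (2 * N + 1)) atTop (𝓝 0) := by
    have h3 : Tendsto (fun N : ℕ => 2 * (N : ℝ) + 1) atTop atTop :=
      tendsto_atTop_add_const_right _ _
        (tendsto_natCast_atTop_atTop.const_mul_atTop (by norm_num))
    simp only [one_div]
    exact h3.inv_tendsto_atTop
  have h4 : (1 : ℝ) / (2 * L) = 1 / 2 / L := by field_simp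
  rw [h4]
  refine tendsto_of_tendsto_of_tendsto_of_le_of_le (g := fun N : ℕ =>
    (N : ℝ) / (2 * N + 1) / L - 1 / (2 * N + 1)) (h := fun N : ℕ => (N : ℝ) / (2 * N + 1) / L)
    ?_ (h1.div_const _) ?_ ?_
  · simpa using (h1.div_const (L : ℝ)).sub h2
  · intro N
    have h5 : (N : ℝ) / L ≤ (N / L : ℕ) + 1 := (Nat.lt_floor_add_one _).le.trans_eq (by
      rw [Nat.floor_div_eq_div])
    have h6 : (0 : ℝ) < 2 * N + 1 := by positivity
    simp only
    rw [div_right_comm, ← sub_div]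
    gcongr
    linarith
  · intro N
    simp only
    rw [div_right_comm]
    gcongr
    exact Nat.cast_div_le

/-- The law of large numbers for functions of disjoint blocks. -/
lemma ae_tendsto_block_average {L : ℕ} (hL : 0 < L) {F : (Fin L → ℝ) → ℝ} (hF : Measurable F)
    (hint : Integrable F (Measure.pi fun _ => P₀)) :
    ∀ᵐ κ ∂(Measure.infinitePi fun _ : ℤ => P₀),
      Tendsto (fun N : ℕ => (∑ j ∈ blockIndices L N, F (block κ L j)) / (2 * N + 1)) atTop
        (𝓝 ((∫ x, F x ∂(Measure.pi fun _ => P₀)) / L)) := by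
  -- The blocks to the right and to the left of the origin form two one-sided sequences, each
  -- obeying the strong law.
  have e1 : Function.Injective fun i : ℕ => (i : ℤ) := Nat.cast_injective
  have e2 : Function.Injective fun i : ℕ => -(i : ℤ) - 1 := fun i j h => by
    simp only at h; omega
  filter_upwards [ae_tendsto_average P₀ e1 hF hint, ae_tendsto_average P₀ e2 hF hint] with κ h1 h2
  have hdiv : Tendsto (fun N : ℕ => N / L) atTop atTop := Nat.tendsto_div_const_atTop hL.ne'
  have h3 := (((h1.add h2).comp hdiv).mul (tendsto_div_two_mul_add_one hL))
  have h4 : (∫ x, F x ∂(Measure.pi fun _ : Fin L => P₀) +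
      ∫ x, F x ∂(Measure.pi fun _ : Fin L => P₀)) * (1 / (2 * L)) =
      (∫ x, F x ∂(Measure.pi fun _ : Fin L => P₀)) / L := by
    have hL' : (L : ℝ) ≠ 0 := by exact_mod_cast hL.ne'
    field_simp
    ring
  rw [h4] at h3
  refine h3.congr' ?_
  filter_upwards [hdiv.eventually_gt_atTop 0] with N hN
  have hN' : ((N / L : ℕ) : ℝ) ≠ 0 := by exact_mod_cast hN.ne'
  have hsum : ∀ M : ℕ, ∑ j ∈ Finset.Ico (-(M : ℤ)) (M : ℤ), F (block κ L j) =
      ∑ i ∈ Finset.range M, F (block κ L (i : ℤ)) +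
        ∑ i ∈ Finset.range M, F (block κ L (-(i : ℤ) - 1)) := by
    intro M
    induction M with
    | zero => simp
    | succ M ih =>
      rw [Finset.sum_range_succ, Finset.sum_range_succ]
      have hI : Finset.Ico (-((M + 1 : ℕ) : ℤ)) ((M + 1 : ℕ) : ℤ) =
          insert (M : ℤ) (insert (-(M : ℤ) - 1) (Finset.Ico (-(M : ℤ)) (M : ℤ))) := by
        ext x
        simp only [Finset.mem_Ico, Finset.mem_insert]
        omega
      rw [hI, Finset.sum_insert (by simp; omega), Finset.sum_insert (by simp), ih]
      ring
  rw [blockIndices, hsum]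
  simp only [Function.comp_apply]
  field_simp

end BlockAverages

/-! ### Comparing traces of powers through the Hilbert–Schmidt norm -/

section TraceComparison

variable {ι τ : Type*} [Fintype ι] [Fintype τ]

/-- The operator norm of a matrix on `ℓ²` is at most `M`. -/
def OpBound (X : Matrix ι τ ℂ) (M : ℝ) : Prop :=
  ∀ v : τ → ℂ, ∑ i, ‖X.mulVec v i‖ ^ 2 ≤ M ^ 2 * ∑ j, ‖v j‖ ^ 2

/-- The squared Hilbert–Schmidt norm of a matrix. -/
def hsSq (X : Matrix ι τ ℂ) : ℝ := ∑ j, ∑ i, ‖X i j‖ ^ 2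

lemma OpBound.mul {ρ : Type*} [Fintype ρ] {X : Matrix ι τ ℂ} {Y : Matrix τ ρ ℂ} {M N : ℝ}
    (hX : OpBound X M) (hY : OpBound Y N) : OpBound (X * Y) (M * N) := fun v => by
  rw [← Matrix.mulVec_mulVec, mul_pow, mul_assoc]
  exact (hX _).trans (mul_le_mul_of_nonneg_left (hY v) (sq_nonneg M))

lemma OpBound.one [DecidableEq ι] : OpBound (1 : Matrix ι ι ℂ) 1 := fun v => by simp

lemma OpBound.pow [DecidableEq ι] {X : Matrix ι ι ℂ} {M : ℝ} (hX : OpBound X M) (p : ℕ) :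
    OpBound (X ^ p) (M ^ p) := by
  induction p with
  | zero => simpa using OpBound.one
  | succ p ih => rw [pow_succ, pow_succ]; exact ih.mul hX

lemma OpBound.hsSq_mul_le {ρ : Type*} [Fintype ρ] {X : Matrix ι τ ℂ} {M : ℝ} (hX : OpBound X M)
    (Y : Matrix τ ρ ℂ) : hsSq (X * Y) ≤ M ^ 2 * hsSq Y := by
  rw [hsSq, hsSq, Finset.mul_sum]
  exact Finset.sum_le_sum fun j _ => hX fun i => Y i j

lemma norm_trace_le (X : Matrix ι ι ℂ) : ‖X.trace‖ ≤ √(Fintype.card ι) * √(hsSq X) := by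
  rw [← Real.sqrt_mul (Nat.cast_nonneg _)]
  refine Real.le_sqrt_of_sq_le ?_
  calc ‖X.trace‖ ^ 2 ≤ (∑ i, ‖X i i‖) ^ 2 := by
        gcongr
        exact norm_sum_le _ _
    _ ≤ Fintype.card ι * ∑ i, ‖X i i‖ ^ 2 := sq_sum_le_card_mul_sum_sq
    _ ≤ Fintype.card ι * hsSq X := by
        refine mul_le_mul_of_nonneg_left (Finset.sum_le_sum fun j _ => ?_) (Nat.cast_nonneg _)
        exact Finset.single_le_sum (f := fun i => ‖X i j‖ ^ 2) (fun i _ => sq_nonneg _)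
          (Finset.mem_univ j)

/-- Telescoping, one factor `A` being replaced by `B` at a time. The cofactor `C` is what closes the
induction: by cyclicity of the trace each new `B` moves to the left and joins `C`. The assumption `1
≤ M` only serves to round `M ^ p` up to `M ^ (p + 1)`. -/
lemma norm_trace_mul_pow_sub_le [DecidableEq ι] {A B : Matrix ι ι ℂ} {M : ℝ} (hM : 1 ≤ M)
    (hA : OpBound A M) (hB : OpBound B M) (p : ℕ) :
    ∀ (C : Matrix ι ι ℂ) (c : ℝ), 0 ≤ c → OpBound C c →
      ‖(C * A ^ p).trace - (C * B ^ p).trace‖ ≤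
        p * c * M ^ p * (√(Fintype.card ι) * √(hsSq (A - B))) := by
  induction p with
  | zero => intro C c _ _; simp
  | succ p ih =>
    intro C c hc hC
    set R := √(Fintype.card ι) * √(hsSq (A - B)) with hR
    have hR0 : 0 ≤ R := by positivity
    have hM0 : 0 ≤ M := by linarith
    have hsplit : (C * A ^ (p + 1)).trace - (C * B ^ (p + 1)).trace =
        (C * A ^ p * (A - B)).trace + ((B * C * A ^ p).trace - (B * C * B ^ p).trace) := by
      rw [mul_sub, Matrix.trace_sub, mul_assoc B C, mul_assoc B C, Matrix.trace_mul_comm B,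
        Matrix.trace_mul_comm B, pow_succ, pow_succ, ← mul_assoc, ← mul_assoc]
      ring
    have h1 : ‖(C * A ^ p * (A - B)).trace‖ ≤ c * M ^ p * R := by
      refine (norm_trace_le _).trans ?_
      have h2 := (hC.mul (hA.pow p)).hsSq_mul_le (A - B)
      have h3 : √(hsSq (C * A ^ p * (A - B))) ≤ c * M ^ p * √(hsSq (A - B)) := by
        refine (Real.sqrt_le_sqrt h2).trans_eq ?_
        rw [Real.sqrt_mul (sq_nonneg _), Real.sqrt_sq (by positivity)]
      calc _ ≤ √(Fintype.card ι) * (c * M ^ p * √(hsSq (A - B))) := by gcongr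
        _ = _ := by rw [hR]; ring
    have h2 := ih (B * C) (M * c) (by positivity) (hB.mul hC)
    rw [hsplit]
    calc _ ≤ c * M ^ p * R + p * (M * c) * M ^ p * R := (norm_add_le _ _).trans (add_le_add h1 h2)
      _ ≤ c * M ^ (p + 1) * R + p * (M * c) * M ^ p * R := by
        gcongr ?_ + _
        refine mul_le_mul_of_nonneg_right (mul_le_mul_of_nonneg_left ?_ hc) hR0
        exact pow_le_pow_right₀ hM p.le_succ
      _ = _ := by push_cast; ring

/-- The `0`-`1` matrix of a map between index types. -/
def embMatrix [DecidableEq ι] (e : τ → ι) : Matrix ι τ ℂ :=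
  Matrix.of fun i t => if i = e t then 1 else 0

variable [DecidableEq ι] [DecidableEq τ] {e : τ → ι}

omit [Fintype τ] in
lemma embMatrix_transpose_mul (he : Function.Injective e) :
    (embMatrix e).transpose * embMatrix e = 1 := by
  ext s t
  simp [Matrix.mul_apply, embMatrix, Matrix.one_apply, he.eq_iff, eq_comm]

omit [DecidableEq τ] in
lemma opBound_embMatrix_transpose (he : Function.Injective e) :
    OpBound (embMatrix e).transpose 1 := fun v => by
  have h : ∀ t, (embMatrix e).transpose.mulVec v t = v (e t) := fun t => by
    simp [Matrix.mulVec, dotProduct, embMatrix]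
  simp only [h, one_pow, one_mul]
  rw [← Finset.sum_image (f := fun i => ‖v i‖ ^ 2) (fun a _ b _ hab => he hab)]
  exact Finset.sum_le_sum_of_subset_of_nonneg (Finset.subset_univ _) fun _ _ _ => sq_nonneg _

omit [DecidableEq τ] in
lemma opBound_embMatrix (he : Function.Injective e) : OpBound (embMatrix e) 1 := fun v => by
  classical
  have h : ∀ t, (embMatrix e).mulVec v (e t) = v t := fun t => by
    simp [Matrix.mulVec, dotProduct, embMatrix, he.eq_iff]
  have h0 : ∀ i ∉ Finset.univ.image e, ‖(embMatrix e).mulVec v i‖ ^ 2 = 0 := fun i hi => by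
    have : (embMatrix e).mulVec v i = 0 := by
      simp only [Matrix.mulVec, dotProduct, embMatrix, Matrix.of_apply]
      refine Finset.sum_eq_zero fun t _ => ?_
      rw [if_neg, zero_mul]
      rintro rfl
      exact hi (by simp)
    simp [this]
  rw [← Finset.sum_subset (Finset.subset_univ (Finset.univ.image e)) fun i _ hi => h0 i hi,
    Finset.sum_image fun a _ b _ hab => he hab]
  simp [h]

/-- The extension by zero of a matrix along an injection of index types. -/
def extendMatrix (e : τ → ι) (D : Matrix τ τ ℂ) : Matrix ι ι ℂ :=
  embMatrix e * D * (embMatrix e).transpose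

omit [DecidableEq τ] in
lemma opBound_extendMatrix (he : Function.Injective e) {D : Matrix τ τ ℂ} {M : ℝ}
    (hD : OpBound D M) : OpBound (extendMatrix e D) M := by
  have := ((opBound_embMatrix he).mul hD).mul (opBound_embMatrix_transpose he)
  rwa [one_mul, mul_one] at this

lemma trace_extendMatrix_pow (he : Function.Injective e) (D : Matrix τ τ ℂ) (p : ℕ) :
    (extendMatrix e D ^ (p + 1)).trace = (D ^ (p + 1)).trace := by
  have h : extendMatrix e D ^ (p + 1) = extendMatrix e (D ^ (p + 1)) := by
    induction p with
    | zero => simp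
    | succ p ih =>
      rw [pow_succ, ih, extendMatrix, extendMatrix, extendMatrix, pow_succ D (p + 1)]
      simp only [Matrix.mul_assoc]
      rw [← Matrix.mul_assoc (embMatrix e).transpose, embMatrix_transpose_mul he, Matrix.one_mul]
  rw [h, extendMatrix, Matrix.trace_mul_comm, ← Matrix.mul_assoc, embMatrix_transpose_mul he,
    Matrix.one_mul]

omit [Fintype ι] [DecidableEq τ] in
lemma extendMatrix_apply (he : Function.Injective e) (D : Matrix τ τ ℂ) (s t : τ) :
    extendMatrix e D (e s) (e t) = D s t := by
  classical
  simp [extendMatrix, Matrix.mul_apply, embMatrix, he.eq_iff]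

omit [Fintype ι] [DecidableEq τ] in
lemma extendMatrix_apply_eq_zero (D : Matrix τ τ ℂ) {i j : ι} (h : i ∉ range e ∨ j ∉ range e) :
    extendMatrix e D i j = 0 := by
  simp only [extendMatrix, Matrix.mul_apply, embMatrix, Matrix.of_apply, Matrix.transpose_apply]
  rcases h with h | h
  · refine Finset.sum_eq_zero fun t _ => ?_
    rw [Finset.sum_eq_zero, zero_mul]
    intro s _
    rw [if_neg (fun hs => h ⟨s, hs.symm⟩), zero_mul]
  · refine Finset.sum_eq_zero fun t _ => ?_
    rw [if_neg (fun hs => h ⟨t, hs.symm⟩), mul_zero]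

/-- The power is positive because the zeroth power of the zero extension is the identity, whose
trace counts all of `ι` rather than `τ`. -/
lemma norm_trace_pow_sub_le (he : Function.Injective e) {A : Matrix ι ι ℂ} {D : Matrix τ τ ℂ}
    {M : ℝ} (hM : 1 ≤ M) (hA : OpBound A M) (hD : OpBound D M) {p : ℕ} (hp : p ≠ 0) :
    ‖(A ^ p).trace - (D ^ p).trace‖ ≤
      p * M ^ p * (√(Fintype.card ι) * √(hsSq (A - extendMatrix e D))) := by
  have h := norm_trace_mul_pow_sub_le hM hA (opBound_extendMatrix he hD) p 1 1 zero_le_one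
    OpBound.one
  obtain ⟨q, rfl⟩ := Nat.exists_eq_succ_of_ne_zero hp
  simpa [trace_extendMatrix_pow he] using h

omit [DecidableEq ι] [DecidableEq τ] in
lemma opBound_blockDiagonal [DecidableEq τ] {D : τ → Matrix ι ι ℂ} {M : ℝ}
    (hD : ∀ j, OpBound (D j) M) : OpBound (Matrix.blockDiagonal D) M := fun v => by
  have h : ∀ p : ι × τ, (Matrix.blockDiagonal D).mulVec v p =
      (D p.2).mulVec (fun a => v (a, p.2)) p.1 := by
    rintro ⟨a, j⟩
    simp only [Matrix.mulVec, dotProduct, Matrix.blockDiagonal_apply, Fintype.sum_prod_type]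
    refine Finset.sum_congr rfl fun b _ => ?_
    rw [Finset.sum_eq_single j] <;> simp +contextual [eq_comm]
  simp only [h, Fintype.sum_prod_type_right]
  rw [Finset.mul_sum]
  exact Finset.sum_le_sum fun j _ => hD j _

variable {H : Type*} [NormedAddCommGroup H] [InnerProductSpace ℂ H]

-- With T = `synth x` the matrix is T* T, and `h` bounds the norm of T by √M.
omit [DecidableEq ι] in
lemma opBound_gram {x : ι → H} {M : ℝ} (h : ∀ v, ‖synth x v‖ ^ 2 ≤ M * ‖v‖ ^ 2) (hM : 0 ≤ M) :
    OpBound (Matrix.gram ℂ x) M := fun v => by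
  set u := (Matrix.gram ℂ x).mulVec v with hu
  set u' : EuclideanSpace ℂ ι := WithLp.toLp 2 u with hu'
  set v' : EuclideanSpace ℂ ι := WithLp.toLp 2 v with hv'
  have h1 : ∑ i, ‖u i‖ ^ 2 = ‖u'‖ ^ 2 := by rw [EuclideanSpace.norm_sq_eq]
  have h2 : ∑ i, ‖v i‖ ^ 2 = ‖v'‖ ^ 2 := by rw [EuclideanSpace.norm_sq_eq]
  have h3 : ((‖u'‖ ^ 2 : ℝ) : ℂ) = inner ℂ (synth x u') (synth x v') := by
    rw [synth_apply, synth_apply, ← Matrix.star_dotProduct_gram_mulVec]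
    change _ = star u ⬝ᵥ (Matrix.gram ℂ x).mulVec v
    rw [← hu, ← h1, dotProduct]
    push_cast
    refine Finset.sum_congr rfl fun i _ => ?_
    rw [Pi.star_apply, ← Complex.conj_mul']
    rfl
  have hsq : ∀ w, ‖synth x w‖ ≤ √M * ‖w‖ := fun w => by
    rw [← Real.sqrt_sq (norm_nonneg w), ← Real.sqrt_mul hM]
    exact Real.le_sqrt_of_sq_le (h w)
  have h4 : ‖u'‖ ^ 2 ≤ M * ‖v'‖ * ‖u'‖ := by
    calc ‖u'‖ ^ 2 = ‖((‖u'‖ ^ 2 : ℝ) : ℂ)‖ := by simp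
      _ ≤ ‖synth x u'‖ * ‖synth x v'‖ := by rw [h3]; exact norm_inner_le_norm _ _
      _ ≤ (√M * ‖u'‖) * (√M * ‖v'‖) := by gcongr <;> exact hsq _
      _ = (√M * √M) * ‖v'‖ * ‖u'‖ := by ring
      _ = _ := by rw [Real.mul_self_sqrt hM]
  rw [h1, h2, ← mul_pow]
  have h5 : ‖u'‖ ≤ M * ‖v'‖ := by
    rcases (norm_nonneg u').eq_or_lt with h0 | h0
    · rw [← h0]; positivity
    · rw [sq] at h4
      exact le_of_mul_le_mul_right h4 h0
  gcongr

end TraceComparison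

/-! ### Counting sites relative to the block decomposition -/

section BlockGeometry

lemma ediv_mul_add_fin {L : ℕ} (j : ℤ) (a : Fin L) : (j * L + ((a : ℕ) : ℤ)) / L = j := by
  have ha : ((a : ℕ) : ℤ) < L := by exact_mod_cast a.2
  rw [add_comm, Int.add_mul_ediv_right _ _ (by omega),
    Int.ediv_eq_zero_of_lt (by omega) ha, zero_add]

lemma exists_eq_mul_add_fin {L : ℕ} (hL : 0 < L) (s : ℤ) :
    ∃ a : Fin L, s = s / L * L + ((a : ℕ) : ℤ) := by
  have hL' : (0 : ℤ) < L := by exact_mod_cast hL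
  have h0 := Int.emod_nonneg s hL'.ne'
  have h1 := Int.emod_lt_of_pos s hL'
  refine ⟨⟨(s % L).toNat, by omega⟩, ?_⟩
  have := Int.mul_ediv_add_emod s L
  simp only [Int.toNat_of_nonneg h0]
  linarith

lemma mem_Icc_of_mem_blockIndices {L N : ℕ} {j : ℤ} (hj : j ∈ blockIndices L N) (a : Fin L) :
    j * L + ((a : ℕ) : ℤ) ∈ Finset.Icc (-(N : ℤ)) (N : ℤ) := by
  rw [blockIndices, Finset.mem_Ico] at hj
  have ha : ((a : ℕ) : ℤ) < L := by exact_mod_cast a.2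
  have hN : ((N / L : ℕ) : ℤ) * L ≤ N := by exact_mod_cast Nat.div_mul_le_self N L
  rw [Finset.mem_Icc]
  constructor
  · nlinarith
  · nlinarith

/-- The embedding of the union of the blocks contained in `[-N, N]`. -/
def blockEmb (L N : ℕ) (p : Fin L × blockIndices L N) : Finset.Icc (-(N : ℤ)) (N : ℤ) :=
  ⟨(p.2 : ℤ) * L + ((p.1 : ℕ) : ℤ), mem_Icc_of_mem_blockIndices p.2.2 p.1⟩

lemma blockEmb_injective (L N : ℕ) : Function.Injective (blockEmb L N) := by
  rintro ⟨a, i, hi⟩ ⟨b, j, hj⟩ h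
  have h0 : i * L + ((a : ℕ) : ℤ) = j * L + ((b : ℕ) : ℤ) := congrArg Subtype.val h
  have h1 : i = j := by
    rw [← ediv_mul_add_fin i a, h0, ediv_mul_add_fin]
  subst h1
  have : a = b := Fin.ext (by omega)
  rw [this]

lemma mem_range_blockEmb {L N : ℕ} (hL : 0 < L) {s : Finset.Icc (-(N : ℤ)) (N : ℤ)}
    (hs : (s : ℤ) / L ∈ blockIndices L N) : ∃ a, s = blockEmb L N (a, ⟨(s : ℤ) / L, hs⟩) := by
  obtain ⟨a, ha⟩ := exists_eq_mul_add_fin hL (s : ℤ)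
  exact ⟨a, Subtype.ext ha⟩

/-- The blocks fill [-(N / L) L, (N / L) L), which leaves at most `L` sites at either end of the
window. -/
lemma card_not_mem_blocks_le {L : ℕ} (hL : 0 < L) (N : ℕ) :
    ((Finset.Icc (-(N : ℤ)) (N : ℤ)).filter fun s : ℤ => s / (L : ℤ) ∉ blockIndices L N).card ≤
      2 * L := by
  have hL' : (0 : ℤ) < L := by exact_mod_cast hL
  have hM : (N : ℤ) < ((N / L : ℕ) : ℤ) * L + L := by
    have := Nat.lt_div_mul_add hL (a := N)
    exact_mod_cast this
  set M : ℤ := ((N / L : ℕ) : ℤ) with hMdef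
  have hsub : ((Finset.Icc (-(N : ℤ)) (N : ℤ)).filter fun s : ℤ => s / (L : ℤ) ∉ blockIndices L N) ⊆
      Finset.Ico (-(N : ℤ)) (-(M * L)) ∪ Finset.Icc (M * L) N := by
    intro s hs
    simp only [Finset.mem_filter, Finset.mem_Icc, blockIndices, Finset.mem_Ico, ← hMdef,
      Int.ediv_lt_iff_lt_mul hL', Int.le_ediv_iff_mul_le hL'] at hs
    simp only [Finset.mem_union, Finset.mem_Ico, Finset.mem_Icc]
    rw [neg_mul] at hs
    omega
  refine (Finset.card_le_card hsub).trans ((Finset.card_union_le _ _).trans ?_)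
  rw [Int.card_Ico, Int.card_Icc]
  omega

lemma card_shift_out_le (L : ℕ) (d : ℤ) :
    ((Finset.univ : Finset (Fin L)).filter fun a : Fin L => (((a : ℕ) : ℤ) + d) / L ≠ 0).card ≤
      min d.natAbs L := by
  refine le_min ?_ ((Finset.card_le_univ _).trans_eq (Fintype.card_fin L))
  have hinj : Function.Injective fun a : Fin L => ((a : ℕ) : ℤ) := fun a b h => by
    simp only at h; exact Fin.ext (by omega)
  rw [← Finset.card_image_of_injective _ hinj]
  have hsub : ((Finset.univ : Finset (Fin L)).filter fun a : Fin L => (((a : ℕ) : ℤ) + d) / L ≠ 0).image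
      (fun a : Fin L => ((a : ℕ) : ℤ)) ⊆
      if 0 ≤ d then Finset.Ico ((L : ℤ) - d) L else Finset.Ico 0 (-d) := by
    intro s hs
    simp only [Finset.mem_image, Finset.mem_filter, Finset.mem_univ, true_and] at hs
    obtain ⟨a, ha, rfl⟩ := hs
    have haL : ((a : ℕ) : ℤ) < L := by exact_mod_cast a.2
    have ha' : ¬ (0 ≤ ((a : ℕ) : ℤ) + d ∧ ((a : ℕ) : ℤ) + d < L) := fun h =>
      ha (Int.ediv_eq_zero_of_lt h.1 h.2)
    split_ifs <;> rw [Finset.mem_Ico] <;> omega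
  refine (Finset.card_le_card hsub).trans ?_
  split_ifs <;> rw [Int.card_Ico] <;> omega

/-- Two sites lie in the same block contained in `[-N, N]`. -/
def SameBlock (L N : ℕ) (s t : ℤ) : Prop := s / L ∈ blockIndices L N ∧ s / L = t / L

instance (L N : ℕ) (s t : ℤ) : Decidable (SameBlock L N s t) := by
  unfold SameBlock; infer_instance

lemma card_blockIndices (L N : ℕ) : (blockIndices L N).card = 2 * (N / L) := by
  rw [blockIndices, Int.card_Ico]; omega

/-- A site fails either because it lies in no block of the window, or because the shift by `d`
carries it out of its own block; the latter happens for at most min(|d|, L) sites per block. -/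
lemma card_not_sameBlock_le {L : ℕ} (hL : 0 < L) (N : ℕ) (d : ℤ) :
    ((Finset.Icc (-(N : ℤ)) (N : ℤ)).filter fun s => ¬ SameBlock L N s (s + d)).card ≤
      2 * L + 2 * (N / L) * min d.natAbs L := by
  have hL' : (L : ℤ) ≠ 0 := by exact_mod_cast hL.ne'
  have hsub : ((Finset.Icc (-(N : ℤ)) (N : ℤ)).filter fun s => ¬ SameBlock L N s (s + d)) ⊆
      ((Finset.Icc (-(N : ℤ)) (N : ℤ)).filter fun s : ℤ => s / (L : ℤ) ∉ blockIndices L N) ∪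
      (blockIndices L N ×ˢ
        ((Finset.univ : Finset (Fin L)).filter fun a : Fin L => (((a : ℕ) : ℤ) + d) / L ≠ 0)).image
          fun p => p.1 * L + ((p.2 : ℕ) : ℤ) := by
    intro s hs
    rw [Finset.mem_filter] at hs
    rw [Finset.mem_union]
    by_cases hb : s / L ∈ blockIndices L N
    · right
      obtain ⟨a, ha⟩ := exists_eq_mul_add_fin hL s
      refine Finset.mem_image.2 ⟨(s / L, a), ?_, ha.symm⟩
      rw [Finset.mem_product, Finset.mem_filter]
      refine ⟨hb, Finset.mem_univ _, fun h => hs.2 ⟨hb, ?_⟩⟩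
      conv_rhs => rw [ha]
      rw [add_assoc, add_comm, Int.add_mul_ediv_right _ _ hL', h, zero_add]
    · left
      exact Finset.mem_filter.2 ⟨hs.1, hb⟩
  refine (Finset.card_le_card hsub).trans ((Finset.card_union_le _ _).trans ?_)
  refine add_le_add (card_not_mem_blocks_le hL N) (Finset.card_image_le.trans ?_)
  rw [Finset.card_product, card_blockIndices]
  exact Nat.mul_le_mul_left _ (card_shift_out_le L d)

end BlockGeometry

/-! ### Distance of the Gram matrix from its block-diagonal part -/

section BlockTrace

variable {H : Type*} [NormedAddCommGroup H] [InnerProductSpace ℂ H] {ψ : ℤ → H}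

/-- The injection `idx` lets one bound serve both the whole window and a single block. -/
lemma norm_sq_synth_le {Φ K : ℝ} (hΦ : 0 ≤ Φ)
    (hform : ∀ (S : Finset ℤ) (w : ℤ → ℂ), ‖∑ n ∈ S, w n • ψ n‖ ^ 2 ≤ Φ * ∑ n ∈ S, ‖w n‖ ^ 2)
    {ι : Type*} [Fintype ι] {idx : ι → ℤ} (hidx : Function.Injective idx) {y : ι → ℝ}
    (hy0 : ∀ i, 0 ≤ y i) (hyK : ∀ i, y i ≤ K) (v : EuclideanSpace ℂ ι) :
    ‖synth (fun i => ((√(y i) : ℝ) : ℂ) • ψ (idx i)) v‖ ^ 2 ≤ K * Φ * ‖v‖ ^ 2 := by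
  classical
  set u : ι → ℂ := fun i => v i * ((√(y i) : ℝ) : ℂ) with hu
  have h := hform (Finset.univ.image idx) (Function.extend idx u 0)
  rw [Finset.sum_image fun a _ b _ hab => hidx hab,
    Finset.sum_image fun a _ b _ hab => hidx hab] at h
  simp only [hidx.extend_apply] at h
  rw [synth_apply]
  simp only [smul_smul]
  refine h.trans ?_
  rw [EuclideanSpace.norm_sq_eq, mul_comm K, mul_assoc, Finset.mul_sum (a := K)]
  refine mul_le_mul_of_nonneg_left (Finset.sum_le_sum fun i _ => ?_) hΦ
  rw [hu]
  simp only [norm_mul, Complex.norm_real, Real.norm_eq_abs]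
  rw [mul_pow, sq_abs, Real.sq_sqrt (hy0 i), mul_comm]
  exact mul_le_mul_of_nonneg_right (hyK i) (by positivity)

/-- The rescaled vectors in a block of length `L`. -/
def blockVec (ψ : ℤ → H) {L : ℕ} (y : Fin L → ℝ) : Fin L → H :=
  fun a => ((√(y a) : ℝ) : ℂ) • ψ ((a : ℕ) : ℤ)

/-- The trace of a power of the Gram matrix of the rescaled vectors in a block. -/
def blockTrace (ψ : ℤ → H) {L : ℕ} (p : ℕ) (y : Fin L → ℝ) : ℝ :=
  ((Matrix.gram ℂ (blockVec ψ y)) ^ p).trace.re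

lemma continuous_blockTrace (ψ : ℤ → H) (L p : ℕ) :
    Continuous (blockTrace ψ p : (Fin L → ℝ) → ℝ) := by
  have h : Continuous fun y : Fin L → ℝ => Matrix.gram ℂ (blockVec ψ y) := by
    refine continuous_matrix fun a b => ?_
    simp only [Matrix.gram_apply, blockVec, inner_smul_left, inner_smul_right]
    fun_prop
  exact Complex.continuous_re.comp (h.pow p).matrix_trace

lemma idx_fin_injective (L : ℕ) : Function.Injective fun a : Fin L => ((a : ℕ) : ℤ) :=
  fun a b h => by simp only at h; exact Fin.ext (by omega)

lemma gram_scaled_apply (hshift : GramShiftInvariant ψ) (κ : ℤ → ℝ) (N : ℕ)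
    (s t : Finset.Icc (-(N : ℤ)) (N : ℤ)) :
    Matrix.gram ℂ (scaled ψ κ N) s t =
      ((√(κ s) : ℝ) : ℂ) * ((√(κ t) : ℝ) : ℂ) * gram ψ ((t : ℤ) - s) 0 := by
  rw [Matrix.gram_apply, scaled, scaled, inner_smul_left, inner_smul_right, ← hshift.gram_eq, gram,
    Complex.conj_ofReal, mul_assoc]

lemma gram_blockVec_apply (hshift : GramShiftInvariant ψ) (κ : ℤ → ℝ) {L : ℕ} (j : ℤ)
    (a b : Fin L) :
    Matrix.gram ℂ (blockVec ψ (block κ L j)) a b =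
      ((√(κ (j * L + (a : ℕ))) : ℝ) : ℂ) * ((√(κ (j * L + (b : ℕ))) : ℝ) : ℂ) *
        gram ψ (((b : ℕ) : ℤ) - (a : ℕ)) 0 := by
  rw [Matrix.gram_apply, blockVec, blockVec, inner_smul_left, inner_smul_right, ← hshift.gram_eq,
    gram, Complex.conj_ofReal, mul_assoc, block, block]

/-- The block-diagonal part of the Gram matrix of the rescaled vectors. -/
def blockDiag (ψ : ℤ → H) (κ : ℤ → ℝ) (L N : ℕ) :
    Matrix (Fin L × blockIndices L N) (Fin L × blockIndices L N) ℂ :=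
  Matrix.blockDiagonal fun j => Matrix.gram ℂ (blockVec ψ (block κ L j))

/-- Shift invariance makes both matrices agree inside a block; elsewhere the block part vanishes and
each square root costs at most √K. -/
lemma norm_sq_gram_sub_le (hshift : GramShiftInvariant ψ) {κ : ℤ → ℝ} {K : ℝ}
    (hκ0 : ∀ n, 0 ≤ κ n) (hκK : ∀ n, κ n ≤ K) {L : ℕ} (hL : 0 < L) (N : ℕ)
    (s t : Finset.Icc (-(N : ℤ)) (N : ℤ)) :
    ‖(Matrix.gram ℂ (scaled ψ κ N) - extendMatrix (blockEmb L N) (blockDiag ψ κ L N)) s t‖ ^ 2 ≤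
      K ^ 2 * if SameBlock L N s t then 0 else ‖gram ψ ((t : ℤ) - s) 0‖ ^ 2 := by
  have hinj := blockEmb_injective L N
  rw [Matrix.sub_apply]
  split_ifs with h
  · have h2 : (t : ℤ) / L ∈ blockIndices L N := h.2 ▸ h.1
    obtain ⟨a, ha⟩ := mem_range_blockEmb hL h.1
    obtain ⟨b, hb⟩ := mem_range_blockEmb hL h2
    have hj : (⟨(t : ℤ) / L, h2⟩ : blockIndices L N) = ⟨(s : ℤ) / L, h.1⟩ :=
      Subtype.ext h.2.symm
    rw [hj] at hb
    generalize (⟨(s : ℤ) / L, h.1⟩ : blockIndices L N) = j at ha hb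
    rw [ha, hb, extendMatrix_apply hinj, blockDiag, Matrix.blockDiagonal_apply_eq,
      gram_blockVec_apply hshift, gram_scaled_apply hshift]
    simp [blockEmb]
  · have h0 : extendMatrix (blockEmb L N) (blockDiag ψ κ L N) s t = 0 := by
      by_cases hr : s ∉ range (blockEmb L N) ∨ t ∉ range (blockEmb L N)
      · exact extendMatrix_apply_eq_zero _ hr
      · push Not at hr
        obtain ⟨⟨⟨a, i⟩, rfl⟩, ⟨⟨b, j⟩, rfl⟩⟩ := hr
        rw [extendMatrix_apply hinj, blockDiag, Matrix.blockDiagonal_apply_ne]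
        rintro rfl
        apply h
        simp only [SameBlock, blockEmb, ediv_mul_add_fin]
        exact ⟨i.2, trivial⟩
    rw [h0, sub_zero, gram_scaled_apply hshift, norm_mul, norm_mul, Complex.norm_real,
      Complex.norm_real, mul_pow, mul_pow, Real.norm_eq_abs, Real.norm_eq_abs, sq_abs, sq_abs,
      Real.sq_sqrt (hκ0 _), Real.sq_sqrt (hκ0 _), sq K]
    refine mul_le_mul_of_nonneg_right ?_ (by positivity)
    exact mul_le_mul (hκK _) (hκK _) (hκ0 _) ((hκ0 s).trans (hκK s))

/-- The weighted tail of a square-summable sequence that controls the block decomposition. -/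
def offBlock (ψ : ℤ → H) (L : ℕ) : ℝ :=
  ∑' d : ℤ, min ((d.natAbs : ℝ) / L) 1 * ‖gram ψ d 0‖ ^ 2

lemma summable_offBlock (hs : Summable fun n => ‖gram ψ n 0‖ ^ 2) (L : ℕ) :
    Summable fun d : ℤ => min ((d.natAbs : ℝ) / L) 1 * ‖gram ψ d 0‖ ^ 2 := by
  refine Summable.of_nonneg_of_le (fun d => by positivity) (fun d => ?_) hs
  exact mul_le_of_le_one_left (by positivity) (min_le_right _ _)

/-- Dominated convergence: each weight tends to zero and is at most one, so square-summability of
the Gram coefficients suffices. -/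
lemma tendsto_offBlock (hs : Summable fun n => ‖gram ψ n 0‖ ^ 2) :
    Tendsto (offBlock ψ) atTop (𝓝 0) := by
  have h := tendsto_tsum_of_dominated_convergence (𝓕 := atTop)
    (f := fun (L : ℕ) (d : ℤ) => min ((d.natAbs : ℝ) / L) 1 * ‖gram ψ d 0‖ ^ 2)
    (g := fun _ => 0) hs ?_ ?_
  · rw [tsum_zero] at h
    exact h
  · intro d
    have h1 : Tendsto (fun L : ℕ => (d.natAbs : ℝ) / L) atTop (𝓝 0) :=
      tendsto_const_div_atTop_nhds_zero_nat _
    have h2 := (h1.min (tendsto_const_nhds (x := (1 : ℝ)))).mul_const (‖gram ψ d 0‖ ^ 2)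
    simpa using h2
  · refine Eventually.of_forall fun L d => ?_
    rw [Real.norm_of_nonneg (by positivity)]
    exact mul_le_of_le_one_left (by positivity) (min_le_right _ _)

/-- Entries are grouped by the diagonal t - s = d, along which they share the bound K² ‖gram ψ d
0‖², and the offending sites on each diagonal are counted by `card_not_sameBlock_le`. -/
lemma hsSq_gram_sub_le (hshift : GramShiftInvariant ψ)
    (hs : Summable fun n => ‖gram ψ n 0‖ ^ 2) {κ : ℤ → ℝ} {K : ℝ}
    (hκ0 : ∀ n, 0 ≤ κ n) (hκK : ∀ n, κ n ≤ K) {L : ℕ} (hL : 0 < L) (N : ℕ) :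
    hsSq (Matrix.gram ℂ (scaled ψ κ N) - extendMatrix (blockEmb L N) (blockDiag ψ κ L N)) ≤
      K ^ 2 * (2 * L * ∑' d, ‖gram ψ d 0‖ ^ 2 + (2 * N + 1) * offBlock ψ L) := by
  set S := Finset.Icc (-(N : ℤ)) (N : ℤ) with hS
  set f : ℤ → ℤ → ℝ := fun s d => if SameBlock L N s (s + d) then 0 else ‖gram ψ d 0‖ ^ 2 with hf
  have hf0 : ∀ s d, 0 ≤ f s d := fun s d => by simp only [hf]; split_ifs <;> positivity
  have hfs : ∀ s, Summable (f s) := fun s =>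
    Summable.of_nonneg_of_le (hf0 s) (fun d => by simp only [hf]; split_ifs <;> simp) hs
  have h1 : hsSq (Matrix.gram ℂ (scaled ψ κ N) -
      extendMatrix (blockEmb L N) (blockDiag ψ κ L N)) ≤ K ^ 2 * ∑ s ∈ S, ∑ t ∈ S, f s (t - s) := by
    rw [hsSq, Finset.sum_comm, Finset.mul_sum, ← Finset.sum_coe_sort S]
    refine Finset.sum_le_sum fun s _ => ?_
    rw [Finset.mul_sum, ← Finset.sum_coe_sort S]
    refine Finset.sum_le_sum fun t _ => ?_
    refine (norm_sq_gram_sub_le hshift hκ0 hκK hL N s t).trans_eq ?_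
    simp only [hf, add_sub_cancel]
  refine h1.trans (mul_le_mul_of_nonneg_left ?_ (sq_nonneg K))
  have h2 : ∀ s ∈ S, ∑ t ∈ S, f s (t - s) ≤ ∑' d, f s d := fun s _ => by
    have := (hfs s).sum_le_tsum (S.image fun t => t - s) fun d _ => hf0 s d
    rwa [Finset.sum_image (by intro a _ b _ hab; simpa using hab)] at this
  refine (Finset.sum_le_sum h2).trans ?_
  rw [← Summable.tsum_finsetSum fun s _ => hfs s, offBlock, ← tsum_mul_left, ← tsum_mul_left,
    ← (hs.mul_left _).tsum_add ((summable_offBlock hs L).mul_left _)]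
  refine (summable_sum fun s _ => hfs s).tsum_le_tsum (fun d => ?_)
    ((hs.mul_left _).add ((summable_offBlock hs L).mul_left _))
  have h3 : ∑ s ∈ S, f s d = (S.filter fun s => ¬ SameBlock L N s (s + d)).card *
      ‖gram ψ d 0‖ ^ 2 := by
    simp only [hf]
    rw [Finset.sum_ite, Finset.sum_const_zero, zero_add, Finset.sum_const, nsmul_eq_mul]
  rw [h3, ← mul_assoc, ← add_mul]
  refine mul_le_mul_of_nonneg_right ?_ (by positivity)
  have h4 : ((S.filter fun s => ¬ SameBlock L N s (s + d)).card : ℝ) ≤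
      2 * L + 2 * (N / L : ℕ) * min (d.natAbs : ℝ) L := by
    exact_mod_cast card_not_sameBlock_le hL N d
  refine h4.trans (add_le_add_right ?_ _)
  have hL' : (0 : ℝ) < L := by exact_mod_cast hL
  have h5 : min (d.natAbs : ℝ) L = L * min ((d.natAbs : ℝ) / L) 1 := by
    rw [mul_min_of_nonneg _ _ hL'.le, mul_one, mul_div_cancel₀ _ hL'.ne']
  rw [h5, ← mul_assoc]
  refine mul_le_mul_of_nonneg_right ?_ (by positivity)
  have h6 : ((N / L : ℕ) : ℝ) * L ≤ N := by exact_mod_cast Nat.div_mul_le_self N L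
  linarith

end BlockTrace

/-! ### Almost sure convergence of the moments -/

section Moments

variable {H : Type*} [NormedAddCommGroup H] [InnerProductSpace ℂ H] {ψ : ℤ → H}

/-- The average of a function over the non-zero eigenvalues of the finite-rank operator. -/
def eigAvg (ψ : ℤ → H) (κ : ℤ → ℝ) (N : ℕ) (f : ℝ → ℝ) : ℝ :=
  (∑ i, f (gramEig (scaled ψ κ N) i)) / (2 * N + 1)

lemma sum_const_div (N : ℕ) (c : ℝ) :
    (∑ _i : Finset.Icc (-(N : ℤ)) (N : ℤ), c) / (2 * N + 1) = c := by
  rw [Finset.sum_const, Finset.card_univ, card_Icc_neg, nsmul_eq_mul]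
  have : (2 * (N : ℝ) + 1) ≠ 0 := by positivity
  push_cast
  field_simp

lemma abs_eigAvg_sub_le {κ : ℤ → ℝ} {N : ℕ} {f g : ℝ → ℝ} {ε : ℝ}
    (h : ∀ i, |f (gramEig (scaled ψ κ N) i) - g (gramEig (scaled ψ κ N) i)| ≤ ε) :
    |eigAvg ψ κ N f - eigAvg ψ κ N g| ≤ ε := by
  rw [eigAvg, eigAvg, ← sub_div, ← Finset.sum_sub_distrib, abs_div,
    abs_of_nonneg (by positivity : (0 : ℝ) ≤ 2 * N + 1)]
  refine le_trans ?_ (sum_const_div N ε).le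
  gcongr
  exact (Finset.abs_sum_le_sum_abs _ _).trans (Finset.sum_le_sum fun i _ => h i)

variable {Φ K M : ℝ}

lemma opBound_gram_scaled (hΦ : 0 ≤ Φ)
    (hform : ∀ (S : Finset ℤ) (w : ℤ → ℂ), ‖∑ n ∈ S, w n • ψ n‖ ^ 2 ≤ Φ * ∑ n ∈ S, ‖w n‖ ^ 2)
    {κ : ℤ → ℝ} (hκ0 : ∀ n, 0 ≤ κ n) (hκK : ∀ n, κ n ≤ K) (N : ℕ)
    (v : EuclideanSpace ℂ (Finset.Icc (-(N : ℤ)) (N : ℤ))) :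
    ‖synth (scaled ψ κ N) v‖ ^ 2 ≤ K * Φ * ‖v‖ ^ 2 :=
  norm_sq_synth_le (y := fun n : Finset.Icc (-(N : ℤ)) (N : ℤ) => κ n) hΦ hform
    Subtype.val_injective (fun i => hκ0 i) (fun i => hκK i) v

lemma gramEig_scaled_mem_Icc (hΦ : 0 ≤ Φ)
    (hform : ∀ (S : Finset ℤ) (w : ℤ → ℂ), ‖∑ n ∈ S, w n • ψ n‖ ^ 2 ≤ Φ * ∑ n ∈ S, ‖w n‖ ^ 2)
    {κ : ℤ → ℝ} (hκ0 : ∀ n, 0 ≤ κ n) (hκK : ∀ n, κ n ≤ K) (N : ℕ)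
    (i : Finset.Icc (-(N : ℤ)) (N : ℤ)) :
    gramEig (scaled ψ κ N) i ∈ Icc 0 (K * Φ) :=
  ⟨gramEig_nonneg _ _, gramEig_le (opBound_gram_scaled hΦ hform hκ0 hκK N) i⟩

/-- The Hilbert–Schmidt error grows like √N and the trace bound contributes another √(2N + 1). After
normalisation there remains, for large `N`, a multiple of √`offBlock`, which is small for long
blocks. -/
lemma abs_moment_sub_le (hshift : GramShiftInvariant ψ)
    (hs : Summable fun n => ‖gram ψ n 0‖ ^ 2) (hΦ : 0 ≤ Φ)
    (hform : ∀ (S : Finset ℤ) (w : ℤ → ℂ), ‖∑ n ∈ S, w n • ψ n‖ ^ 2 ≤ Φ * ∑ n ∈ S, ‖w n‖ ^ 2)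
    (hM : 1 ≤ M) (hKM : K * Φ ≤ M) {κ : ℤ → ℝ} (hκ0 : ∀ n, 0 ≤ κ n) (hκK : ∀ n, κ n ≤ K)
    {L : ℕ} (hL : 0 < L) {p : ℕ} (hp : p ≠ 0) (N : ℕ) :
    |eigAvg ψ κ N (fun t => t ^ p) -
        (∑ j ∈ blockIndices L N, blockTrace ψ p (block κ L j)) / (2 * N + 1)| ≤
      p * M ^ p * √(K ^ 2 * (2 * L * (∑' d, ‖gram ψ d 0‖ ^ 2) / (2 * N + 1) + offBlock ψ L)) := by
  have hM0 : 0 ≤ M := by linarith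
  have hA : OpBound (Matrix.gram ℂ (scaled ψ κ N)) M := opBound_gram (fun v =>
    (opBound_gram_scaled hΦ hform hκ0 hκK N v).trans (by gcongr)) hM0
  have hD : OpBound (blockDiag ψ κ L N) M := opBound_blockDiagonal fun j => opBound_gram (fun v =>
    (norm_sq_synth_le hΦ hform (idx_fin_injective L) (fun a => hκ0 _) (fun a => hκK _) v).trans
      (by gcongr)) hM0
  have h := norm_trace_pow_sub_le (blockEmb_injective L N) hM hA hD hp
  have htr : (blockDiag ψ κ L N ^ p).trace.re =
      ∑ j ∈ blockIndices L N, blockTrace ψ p (block κ L j) := by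
    rw [blockDiag, ← Matrix.blockDiagonal_pow, Matrix.trace_blockDiagonal, Complex.re_sum,
      ← Finset.sum_coe_sort (blockIndices L N)]
    rfl
  have hre := (Complex.abs_re_le_norm _).trans h
  rw [Complex.sub_re, htr, trace_gram_pow, Complex.ofReal_re, card_Icc_neg] at hre
  have hn : (0 : ℝ) < 2 * N + 1 := by positivity
  rw [eigAvg, ← sub_div, abs_div, abs_of_pos hn, div_le_iff₀ hn]
  refine hre.trans ?_
  rw [mul_assoc (p * M ^ p : ℝ)]
  refine mul_le_mul_of_nonneg_left ?_ (by positivity)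
  rw [← Real.sqrt_mul (Nat.cast_nonneg _)]
  refine Real.sqrt_le_iff.2 ⟨by positivity, ?_⟩
  have hoff : 0 ≤ offBlock ψ L := tsum_nonneg fun d => by positivity
  have htau : 0 ≤ ∑' d, ‖gram ψ d 0‖ ^ 2 := tsum_nonneg fun d => by positivity
  rw [mul_pow, Real.sq_sqrt (by positivity)]
  calc ((2 * N + 1 : ℕ) : ℝ) * hsSq _ ≤ (2 * N + 1) *
        (K ^ 2 * (2 * L * ∑' d, ‖gram ψ d 0‖ ^ 2 + (2 * N + 1) * offBlock ψ L)) := by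
        push_cast
        exact mul_le_mul_of_nonneg_left (hsSq_gram_sub_le hshift hs hκ0 hκK hL N) hn.le
    _ = _ := by field_simp

/-- The constants are non-random and only countably many ε matter. One good realisation gives a
Cauchy sequence, and every other good realisation is eventually close to it. -/
lemma exists_tendsto_of_forall_eventually {Ω : Type*} [MeasurableSpace Ω] {μ : Measure Ω}
    [NeBot (ae μ)] {a : Ω → ℕ → ℝ}
    (h : ∀ ε > 0, ∃ c, ∀ᵐ ω ∂μ, ∀ᶠ N in atTop, |a ω N - c| ≤ ε) :
    ∃ m, ∀ᵐ ω ∂μ, Tendsto (a ω) atTop (𝓝 m) := by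
  choose! c hc using h
  have hpos : ∀ k : ℕ, (0 : ℝ) < 1 / (k + 1) := fun k => by positivity
  have hall : ∀ᵐ ω ∂μ, ∀ k : ℕ, ∀ᶠ N in atTop, |a ω N - c (1 / (k + 1))| ≤ 1 / (k + 1) :=
    ae_all_iff.2 fun k => hc _ (hpos k)
  obtain ⟨ω₀, hω₀⟩ := hall.exists
  have hsmall : ∀ ε > (0 : ℝ), ∃ k : ℕ, 2 * (1 / ((k : ℝ) + 1)) < ε := fun ε hε => by
    obtain ⟨k, hk⟩ := exists_nat_one_div_lt (half_pos hε)
    exact ⟨k, by linarith⟩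
  have hcauchy : CauchySeq (a ω₀) := by
    rw [Metric.cauchySeq_iff']
    intro ε hε
    obtain ⟨k, hk⟩ := hsmall ε hε
    obtain ⟨N, hN⟩ := eventually_atTop.1 (hω₀ k)
    refine ⟨N, fun n hn => ?_⟩
    rw [Real.dist_eq]
    have h1 := hN n hn
    have h2 := hN N le_rfl
    rw [abs_le] at h1 h2
    rw [abs_lt]
    constructor <;> linarith [h1.1, h1.2, h2.1, h2.2]
  obtain ⟨m, hm⟩ := cauchySeq_tendsto_of_complete hcauchy
  refine ⟨m, ?_⟩
  filter_upwards [hall] with ω hω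
  have hdiff : Tendsto (fun N => a ω N - a ω₀ N) atTop (𝓝 0) := by
    rw [Metric.tendsto_atTop']
    intro ε hε
    obtain ⟨k, hk⟩ := hsmall ε hε
    obtain ⟨N, hN⟩ := eventually_atTop.1 ((hω k).and (hω₀ k))
    refine ⟨N, fun n hn => ?_⟩
    obtain ⟨h1, h2⟩ := hN n hn.le
    rw [Real.dist_eq, sub_zero]
    rw [abs_le] at h1 h2
    rw [abs_lt]
    constructor <;> linarith [h1.1, h1.2, h2.1, h2.2]
  simpa using hdiff.add hm

variable {P₀ : Measure ℝ} [IsProbabilityMeasure P₀]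

lemma ae_forall_mem {s : Set ℝ} (hs : ∀ᵐ x ∂P₀, x ∈ s) :
    ∀ᵐ κ ∂(Measure.infinitePi fun _ : ℤ => P₀), ∀ n, κ n ∈ s :=
  ae_all_iff.2 fun n => (measurePreserving_eval_infinitePi (fun _ : ℤ => P₀) n).quasiMeasurePreserving.ae hs

lemma abs_blockTrace_le (hΦ : 0 ≤ Φ)
    (hform : ∀ (S : Finset ℤ) (w : ℤ → ℂ), ‖∑ n ∈ S, w n • ψ n‖ ^ 2 ≤ Φ * ∑ n ∈ S, ‖w n‖ ^ 2)
    {L : ℕ} {y : Fin L → ℝ} (hy : ∀ a, y a ∈ Icc 0 K) (p : ℕ) :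
    ‖blockTrace ψ p y‖ ≤ L * (K * Φ) ^ p := by
  have hmem : ∀ i, gramEig (blockVec ψ y) i ≤ K * Φ := gramEig_le
    (norm_sq_synth_le hΦ hform (idx_fin_injective L) (fun a => (hy a).1) (fun a => (hy a).2))
  rw [blockTrace, trace_gram_pow, Complex.ofReal_re]
  refine (norm_sum_le _ _).trans ?_
  calc _ ≤ ∑ i : Fin L, (K * Φ) ^ p := by
        refine Finset.sum_le_sum fun i _ => ?_
        have := gramEig_nonneg (blockVec ψ y) i
        rw [Real.norm_of_nonneg (by positivity)]
        exact pow_le_pow_left₀ this (hmem i) p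
    _ = _ := by simp

lemma integrable_blockTrace (hΦ : 0 ≤ Φ)
    (hform : ∀ (S : Finset ℤ) (w : ℤ → ℂ), ‖∑ n ∈ S, w n • ψ n‖ ^ 2 ≤ Φ * ∑ n ∈ S, ‖w n‖ ^ 2)
    (hP : ∀ᵐ x ∂P₀, x ∈ Icc 0 K) (L p : ℕ) :
    Integrable (blockTrace ψ p) (Measure.pi fun _ : Fin L => P₀) := by
  refine Integrable.of_bound (continuous_blockTrace ψ L p).aestronglyMeasurable
    (L * (K * Φ) ^ p) ?_
  have h : ∀ᵐ y ∂(Measure.pi fun _ : Fin L => P₀), ∀ a, y a ∈ Icc 0 K := ae_all_iff.2 fun a =>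
    (measurePreserving_eval (fun _ : Fin L => P₀) a).quasiMeasurePreserving.ae hP
  filter_upwards [h] with y hy
  exact abs_blockTrace_le hΦ hform hy p

lemma exists_moment (hshift : GramShiftInvariant ψ)
    (hs : Summable fun n => ‖gram ψ n 0‖ ^ 2) (hΦ : 0 ≤ Φ)
    (hform : ∀ (S : Finset ℤ) (w : ℤ → ℂ), ‖∑ n ∈ S, w n • ψ n‖ ^ 2 ≤ Φ * ∑ n ∈ S, ‖w n‖ ^ 2)
    (hP : ∀ᵐ x ∂P₀, x ∈ Icc 0 K) (p : ℕ) :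
    ∃ m, ∀ᵐ κ ∂(Measure.infinitePi fun _ : ℤ => P₀),
      Tendsto (fun N => eigAvg ψ κ N fun t => t ^ p) atTop (𝓝 m) := by
  -- The zeroth moment is exactly one; the trace comparison needs a positive power.
  rcases eq_or_ne p 0 with rfl | hp
  · refine ⟨1, Eventually.of_forall fun κ => ?_⟩
    simp only [eigAvg, pow_zero, sum_const_div]
    exact tendsto_const_nhds
  set M := max 1 (K * Φ) with hMdef
  have hM : 1 ≤ M := le_max_left _ _
  have hlimL : Tendsto (fun L => p * M ^ p * √(K ^ 2 * (0 + offBlock ψ L))) atTop (𝓝 0) := by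
    have h1 := ((((tendsto_offBlock hs).const_add 0).const_mul (K ^ 2)).sqrt).const_mul (p * M ^ p)
    simpa using h1
  refine exists_tendsto_of_forall_eventually fun ε hε => ?_
  -- The block length is fixed before `N` grows, so that the boundary term, of order L / N,
  -- disappears and only the `offBlock` error is left.
  obtain ⟨L, hLε, hL⟩ := ((hlimL.eventually (gt_mem_nhds (half_pos hε))).and
    (eventually_gt_atTop 0)).exists
  refine ⟨(∫ y, blockTrace ψ p y ∂(Measure.pi fun _ : Fin L => P₀)) / L, ?_⟩
  filter_upwards [ae_forall_mem hP, ae_tendsto_block_average P₀ hL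
    (continuous_blockTrace ψ L p).measurable (integrable_blockTrace hΦ hform hP L p)] with κ hκ hav
  have hlimN : Tendsto (fun N : ℕ => p * M ^ p *
      √(K ^ 2 * (2 * L * (∑' d, ‖gram ψ d 0‖ ^ 2) / (2 * N + 1) + offBlock ψ L))) atTop
      (𝓝 (p * M ^ p * √(K ^ 2 * (0 + offBlock ψ L)))) := by
    have h3 : Tendsto (fun N : ℕ => 2 * (N : ℝ) + 1) atTop atTop :=
      tendsto_atTop_add_const_right _ _
        (tendsto_natCast_atTop_atTop.const_mul_atTop (by norm_num))
    exact ((((h3.const_div_atTop _).add_const _).const_mul _).sqrt).const_mul _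
  filter_upwards [hlimN.eventually (gt_mem_nhds hLε),
    hav.eventually (Metric.closedBall_mem_nhds _ (half_pos hε))] with N h1 h2
  have h3 := abs_moment_sub_le hshift hs hΦ hform hM (le_max_right _ _) (fun n => (hκ n).1)
    (fun n => (hκ n).2) hL hp N
  rw [Real.dist_eq] at h2
  exact (abs_sub_le _ _ _).trans (by linarith)

end Moments

/-! ### Existence and uniqueness of the IDS measure -/

section Existence

variable {H : Type*} [NormedAddCommGroup H] [InnerProductSpace ℂ H] {ψ : ℤ → H} {Φ K : ℝ}
  {P₀ : Measure ℝ} [IsProbabilityMeasure P₀]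

lemma eigAvg_polynomial (κ : ℤ → ℝ) (N : ℕ) (q : Polynomial ℝ) :
    eigAvg ψ κ N (fun t => q.eval t) =
      ∑ k ∈ Finset.range (q.natDegree + 1), q.coeff k * eigAvg ψ κ N fun t => t ^ k := by
  simp only [eigAvg, Polynomial.eval_eq_sum_range]
  rw [Finset.sum_comm, Finset.sum_div]
  refine Finset.sum_congr rfl fun k _ => ?_
  rw [← Finset.mul_sum, mul_div_assoc]

/-- The limits of the moments of the eigenvalue averages, when the eigenvalues lie in `[0, R]`, are
the moments of a probability measure on `[0, R]`. -/
lemma exists_measure_of_moments {R : ℝ} {m : ℕ → ℝ} {κ₀ : ℤ → ℝ}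
    (hmem : ∀ N i, gramEig (scaled ψ κ₀ N) i ∈ Icc 0 R)
    (hm : ∀ p, Tendsto (fun N => eigAvg ψ κ₀ N fun t => t ^ p) atTop (𝓝 (m p))) :
    ∃ ν : Measure ℝ, IsProbabilityMeasure ν ∧ ν (Icc 0 R)ᶜ = 0 ∧ ∀ q : Polynomial ℝ,
      ∫ x, q.eval x ∂ν = ∑ k ∈ Finset.range (q.natDegree + 1), q.coeff k * m k := by
  let μ₀ : ℕ → Measure (Icc (0 : ℝ) R) := fun N =>
    (2 * (N : ENNReal) + 1)⁻¹ • ∑ i, Measure.dirac ⟨gramEig (scaled ψ κ₀ N) i, hmem N i⟩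
  have hprob : ∀ N, IsProbabilityMeasure (μ₀ N) := fun N => ⟨by
    simp only [μ₀, Measure.smul_apply, Measure.coe_finsetSum, Finset.sum_apply, measure_univ,
      Finset.sum_const, Finset.card_univ, card_Icc_neg, nsmul_eq_mul, smul_eq_mul, mul_one]
    push_cast
    exact ENNReal.inv_mul_cancel (by simp) (by finiteness)⟩
  let μ : ℕ → ProbabilityMeasure (Icc (0 : ℝ) R) := fun N => ⟨μ₀ N, hprob N⟩
  -- Probability measures on a compact interval form a compact space, so a limit along an
  -- ultrafilter exists; convergence of the moments then identifies its moments.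
  let U : Ultrafilter (ProbabilityMeasure (Icc (0 : ℝ) R)) := (hyperfilter ℕ).map μ
  obtain ⟨ν₀, -, hν₀⟩ := isCompact_univ.ultrafilter_le_nhds U (by simp)
  have htend : Tendsto μ (hyperfilter ℕ) (𝓝 ν₀) := hν₀
  rw [ProbabilityMeasure.tendsto_iff_forall_integral_tendsto] at htend
  refine ⟨(ν₀ : Measure (Icc (0 : ℝ) R)).map Subtype.val,
    Measure.isProbabilityMeasure_map measurable_subtype_coe.aemeasurable, ?_, fun q => ?_⟩
  · rw [Measure.map_apply measurable_subtype_coe measurableSet_Icc.compl]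
    convert measure_empty (μ := (ν₀ : Measure (Icc (0 : ℝ) R)))
    ext x
    simp only [mem_preimage, mem_compl_iff, x.2, not_true_eq_false, mem_empty_iff_false]
  · rw [integral_map measurable_subtype_coe.aemeasurable q.continuous.aestronglyMeasurable]
    have h1 := htend (BoundedContinuousFunction.mkOfCompact
      ⟨fun x : Icc (0 : ℝ) R => q.eval (x : ℝ), by fun_prop⟩)
    have h2 : ∀ N, ∫ x : Icc (0 : ℝ) R, q.eval (x : ℝ) ∂(μ₀ N) =
        eigAvg ψ κ₀ N (fun t => q.eval t) := by
      intro N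
      simp only [μ₀]
      rw [integral_smul_measure, integral_finsetSum_measure]
      · simp only [integral_dirac]
        rw [ENNReal.toReal_inv, ENNReal.toReal_add (by finiteness) (by simp), eigAvg]
        simp [div_eq_inv_mul]
      · intro i _
        exact integrable_dirac (by simp)
    have h3 : Tendsto (fun N => eigAvg ψ κ₀ N (fun t => q.eval t)) atTop
        (𝓝 (∑ k ∈ Finset.range (q.natDegree + 1), q.coeff k * m k)) := by
      simp only [eigAvg_polynomial]
      exact tendsto_finsetSum _ fun k _ => (hm k).const_mul _
    have h4 := h3.mono_left Nat.hyperfilter_le_atTop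
    refine tendsto_nhds_unique (h1.congr fun N => ?_) h4
    exact h2 N

/-- Convergence of moments on `[0, R]` gives convergence against continuous functions. -/
lemma tendsto_eigAvg_of_moments {R : ℝ} {m : ℕ → ℝ} {ν : Measure ℝ} [IsProbabilityMeasure ν]
    (hν : ν (Icc 0 R)ᶜ = 0) (hνm : ∀ q : Polynomial ℝ,
      ∫ x, q.eval x ∂ν = ∑ k ∈ Finset.range (q.natDegree + 1), q.coeff k * m k) {κ : ℤ → ℝ}
    (hmem : ∀ N i, gramEig (scaled ψ κ N) i ∈ Icc 0 R)
    (hm : ∀ p, Tendsto (fun N => eigAvg ψ κ N fun t => t ^ p) atTop (𝓝 (m p)))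
    {f : ℝ → ℝ} (hf : Continuous f) :
    Tendsto (fun N => eigAvg ψ κ N f) atTop (𝓝 (∫ x, f x ∂ν)) := by
  have hres : ν.restrict (Icc 0 R) = ν :=
    Measure.restrict_eq_self_of_ae_mem (by rwa [← compl_mem_ae_iff, compl_compl] at hν)
  have hint : ∀ g : ℝ → ℝ, Continuous g → Integrable g ν := fun g hg => by
    have := hg.continuousOn.integrableOn_compact (μ := ν) (isCompact_Icc (a := 0) (b := R))
    rwa [IntegrableOn, hres] at this
  rw [Metric.tendsto_atTop']
  intro ε hε
  obtain ⟨q, hq⟩ := exists_polynomial_near_of_continuousOn 0 R f hf.continuousOn (ε / 4)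
    (by positivity)
  have h3 : Tendsto (fun N => eigAvg ψ κ N (fun t => q.eval t)) atTop (𝓝 (∫ x, q.eval x ∂ν)) := by
    simp only [eigAvg_polynomial, hνm]
    exact tendsto_finsetSum _ fun k _ => (hm k).const_mul _
  have h4 : |∫ x, q.eval x ∂ν - ∫ x, f x ∂ν| ≤ ε / 4 := by
    rw [← integral_sub (hint _ q.continuous) (hint _ hf), ← Real.norm_eq_abs]
    have := norm_integral_le_of_norm_le_const (μ := ν) (f := fun x => q.eval x - f x)
      (C := ε / 4) ?_
    · simpa using this
    · have hae : ∀ᵐ x ∂ν, x ∈ Icc 0 R := hν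
      filter_upwards [hae] with x hx
      exact (hq x hx).le
  obtain ⟨N₀, hN₀⟩ := (Metric.tendsto_atTop'.1 h3) (ε / 4) (by positivity)
  refine ⟨N₀, fun N hN => ?_⟩
  have h5 := hN₀ N hN
  have h6 : |eigAvg ψ κ N (fun t => q.eval t) - eigAvg ψ κ N f| ≤ ε / 4 :=
    abs_eigAvg_sub_le fun i => (hq _ (hmem N i)).le
  rw [Real.dist_eq] at h5 ⊢
  rw [abs_lt] at h5 ⊢
  rw [abs_le] at h4 h6
  constructor <;> linarith [h4.1, h4.2, h5.1, h5.2, h6.1, h6.2]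

/-- The limiting moments are non-random, so the measure built from a single realisation is the limit
for almost every other one. -/
lemma exists_isIDSMeasure (hψ : LinearIndependent ℂ ψ) (hshift : GramShiftInvariant ψ)
    (hs : Summable fun n => ‖gram ψ n 0‖ ^ 2) (hΦ : 0 ≤ Φ)
    (hform : ∀ (S : Finset ℤ) (w : ℤ → ℂ), ‖∑ n ∈ S, w n • ψ n‖ ^ 2 ≤ Φ * ∑ n ∈ S, ‖w n‖ ^ 2)
    (hP : ∀ᵐ x ∂P₀, x ∈ Ioc 0 K) : ∃ ν, IsIDSMeasure ψ P₀ ν := by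
  have hP' : ∀ᵐ x ∂P₀, x ∈ Icc 0 K := hP.mono fun x hx => Ioc_subset_Icc_self hx
  choose m hm using exists_moment hshift hs hΦ hform hP'
  have hall := ae_all_iff.2 hm
  obtain ⟨κ₀, hκ₀, hm₀⟩ := ((ae_forall_mem hP').and hall).exists
  have hmem : ∀ κ : ℤ → ℝ, (∀ n, κ n ∈ Icc 0 K) → ∀ N i,
      gramEig (scaled ψ κ N) i ∈ Icc 0 (K * Φ) := fun κ hκ N i =>
    gramEig_scaled_mem_Icc hΦ hform (fun n => (hκ n).1) (fun n => (hκ n).2) N i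
  obtain ⟨ν, hν, hν0, hνm⟩ := exists_measure_of_moments (hmem κ₀ hκ₀) hm₀
  refine ⟨ν, hν, ?_⟩
  filter_upwards [ae_forall_mem hP, ae_forall_mem hP', hall] with κ hκ hκ' hmκ f hf
  simp only [integral_eigenvalueMeasure hψ (fun n => (hκ n).1)]
  exact tendsto_eigAvg_of_moments hν0 hνm (hmem κ hκ') hmκ hf

lemma IsIDSMeasure.unique {ν ν' : Measure ℝ} (h : IsIDSMeasure ψ P₀ ν)
    (h' : IsIDSMeasure ψ P₀ ν') : ν = ν' := by
  have := h.isProbability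
  have := h'.isProbability
  obtain ⟨κ, h1, h2⟩ := (h.tendsto.and h'.tendsto).exists
  exact ext_of_forall_integral_eq_of_IsFiniteMeasure fun f =>
    tendsto_nhds_unique (h1 f f.continuous) (h2 f f.continuous)

end Existence

/-! ### Energy estimate on a block with a small coupling -/

section BadBlock

/-- A one-dimensional Sobolev bound: by Cauchy–Schwarz the squared oscillation over the block is at
most `L` times its Dirichlet energy. -/
lemma sq_le_of_dirichlet {L : ℕ} (r : ℕ → ℝ) {a m : ℕ} (ha : a < L) (hm : m < L) :
    r a ^ 2 ≤ 2 * r m ^ 2 + 2 * (L * ∑ i ∈ Finset.range (L - 1), (r (i + 1) - r i) ^ 2) := by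
  have hdist : |r a - r m| ≤ ∑ i ∈ Finset.range (L - 1), |r (i + 1) - r i| := by
    have key : ∀ s t : ℕ, s ≤ t → t < L →
        dist (r s) (r t) ≤ ∑ i ∈ Finset.range (L - 1), |r (i + 1) - r i| := by
      intro s t hst ht
      refine (dist_le_Ico_sum_dist r hst).trans ?_
      have hsub : Finset.Ico s t ⊆ Finset.range (L - 1) := fun i hi => by
        rw [Finset.mem_Ico] at hi
        rw [Finset.mem_range]; omega
      refine (Finset.sum_le_sum_of_subset_of_nonneg hsub fun _ _ _ => dist_nonneg).trans_eq ?_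
      exact Finset.sum_congr rfl fun i _ => by rw [dist_comm, Real.dist_eq]
    rw [← Real.dist_eq]
    rcases le_total a m with h | h
    · exact key a m h hm
    · rw [dist_comm]; exact key m a h ha
  have hsq : (r a - r m) ^ 2 ≤ L * ∑ i ∈ Finset.range (L - 1), (r (i + 1) - r i) ^ 2 := by
    calc (r a - r m) ^ 2 = |r a - r m| ^ 2 := (sq_abs _).symm
      _ ≤ (∑ i ∈ Finset.range (L - 1), |r (i + 1) - r i|) ^ 2 := by gcongr
      _ ≤ (Finset.range (L - 1)).card * ∑ i ∈ Finset.range (L - 1), |r (i + 1) - r i| ^ 2 :=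
        sq_sum_le_card_mul_sum_sq
      _ ≤ L * ∑ i ∈ Finset.range (L - 1), (r (i + 1) - r i) ^ 2 := by
        simp only [sq_abs, Finset.card_range]
        gcongr
        omega
  nlinarith [sq_nonneg (r a - 2 * r m)]

/-- A block containing a site with a small coupling has no spectrum near the top edge. -/
lemma bad_block_form_le {L : ℕ} {Φ K η δ c : ℝ} (hΦ : 0 < Φ) (hK : 0 < K) (hη : 0 < η)
    (hδ : 0 ≤ δ) (hc : 2 * (L : ℝ) ^ 2 * δ ≤ K * c) (hηδ : 4 * (L : ℝ) ^ 2 * δ ≤ η * Φ)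
    (r κ : ℕ → ℝ) (hκ0 : ∀ a, 0 < κ a) (hκK : ∀ a, κ a ≤ K) {m : ℕ} (hm : m < L)
    (hbad : κ m ≤ K - η) :
    Φ * ∑ a ∈ Finset.range L, r a ^ 2 - c * ∑ a ∈ Finset.range (L - 1), (r (a + 1) - r a) ^ 2 ≤
      (K * Φ - δ) * ∑ a ∈ Finset.range L, r a ^ 2 / κ a := by
  set D := ∑ a ∈ Finset.range (L - 1), (r (a + 1) - r a) ^ 2 with hD
  have hD0 : 0 ≤ D := by positivity
  have hL : (1 : ℝ) ≤ L := by exact_mod_cast (by omega : 1 ≤ L)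
  have hL2 : (L : ℝ) ≤ (L : ℝ) ^ 2 := by nlinarith
  have hκm := hκ0 m
  have hKη : 0 < K - η := by linarith
  have hδ1 : 4 * L * δ ≤ η * Φ := le_trans (by gcongr) hηδ
  have hδ2 : 4 * δ ≤ η * Φ := le_trans (by nlinarith) hδ1
  have hE : 0 ≤ K * Φ - δ := by nlinarith
  have hsum : ∑ a ∈ Finset.range L, r a ^ 2 ≤ 2 * L * r m ^ 2 + 2 * (L : ℝ) ^ 2 * D := by
    calc _ ≤ ∑ a ∈ Finset.range L, (2 * r m ^ 2 + 2 * (L * D)) :=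
          Finset.sum_le_sum fun a ha => sq_le_of_dirichlet r (Finset.mem_range.1 ha) hm
      _ = _ := by rw [Finset.sum_const, Finset.card_range, nsmul_eq_mul]; ring
  -- The weight (KΦ - δ)/κ a is at least Φ - δ/K at every site, and at the bad site it exceeds this
  -- by at least ηΦ/(2K).
  have hpt : ∀ a ∈ Finset.range L, (Φ - δ / K) * r a ^ 2 + (if a = m then
      (η * Φ / (2 * K)) * r m ^ 2 else 0) ≤ (K * Φ - δ) * (r a ^ 2 / κ a) := by
    intro a _
    have h1 : (K * Φ - δ) * (r a ^ 2 / κ a) = (K * Φ - δ) / κ a * r a ^ 2 := by ring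
    rw [h1]
    split_ifs with h
    · subst h
      rw [← add_mul]
      refine mul_le_mul_of_nonneg_right ?_ (sq_nonneg _)
      calc Φ - δ / K + η * Φ / (2 * K) ≤ Φ + η * Φ / (2 * K) := by
            have : 0 ≤ δ / K := by positivity
            linarith
        _ ≤ (K * Φ - δ) / (K - η) := by
            rw [le_div_iff₀ hKη, add_mul]
            have h2 : η * Φ / (2 * K) * (K - η) ≤ η * Φ / 2 := by
              rw [div_mul_eq_mul_div, div_le_div_iff₀ (by positivity) (by norm_num)]
              have : 0 < η * Φ := by positivity
              linarith [mul_pos this hη]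
            linarith
        _ ≤ (K * Φ - δ) / κ a := by gcongr
    · rw [add_zero]
      refine mul_le_mul_of_nonneg_right ?_ (sq_nonneg _)
      calc Φ - δ / K = (K * Φ - δ) / K := by field_simp
        _ ≤ (K * Φ - δ) / κ a := div_le_div_of_nonneg_left hE (hκ0 a) (hκK a)
  have h2 := Finset.sum_le_sum hpt
  rw [Finset.sum_add_distrib, Finset.sum_ite_eq' , if_pos (Finset.mem_range.2 hm),
    ← Finset.mul_sum, ← Finset.mul_sum] at h2
  refine le_trans ?_ h2
  -- By `hsum` the total loss is controlled by the Dirichlet energy and the value at `m`. The first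
  -- part is absorbed by the kinetic term through `hc`, the second by the gain at the bad site
  -- through `hηδ`.
  have h3 : δ / K * ∑ a ∈ Finset.range L, r a ^ 2 ≤ c * D + η * Φ / (2 * K) * r m ^ 2 := by
    calc _ ≤ δ / K * (2 * L * r m ^ 2 + 2 * (L : ℝ) ^ 2 * D) := by gcongr
      _ = (2 * (L : ℝ) ^ 2 * δ / K) * D + (2 * L * δ / K) * r m ^ 2 := by ring
      _ ≤ _ := by
        gcongr ?_ * _ + ?_ * _
        · rw [div_le_iff₀ hK]; linarith
        · rw [div_le_div_iff₀ hK (by positivity)]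
          linarith [mul_le_mul_of_nonneg_right hδ1 hK.le]
  rw [sub_mul]
  linarith

end BadBlock

/-! ### Upper bound on the number of eigenvalues near the edge -/

section Upper

variable {H : Type*} [NormedAddCommGroup H] [InnerProductSpace ℂ H] {ψ : ℤ → H}

lemma sum_blocks_eq {L : ℕ} (J : Finset ℤ) (f : ℤ → ℝ) :
    ∑ j ∈ J, ∑ a ∈ Finset.range L, f (j * L + (a : ℤ)) =
      ∑ n ∈ (J ×ˢ Finset.range L).image (fun p => p.1 * L + (p.2 : ℤ)), f n := by
  rw [Finset.sum_image, Finset.sum_product]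
  rintro ⟨i, a⟩ hi ⟨j, b⟩ hj h
  simp only [Finset.coe_product, Set.mem_prod, Finset.mem_coe, Finset.mem_range] at hi hj
  simp only at h
  have h1 := ediv_mul_add_fin i (⟨a, hi.2⟩ : Fin L)
  have h2 := ediv_mul_add_fin j (⟨b, hj.2⟩ : Fin L)
  simp only at h1 h2
  rw [h, h2] at h1
  subst h1
  have : a = b := by omega
  rw [this]

lemma mem_image_blocks {L : ℕ} (hL : 0 < L) {J : Finset ℤ} {n : ℤ} :
    n ∈ (J ×ˢ Finset.range L).image (fun p => p.1 * L + (p.2 : ℤ)) ↔ n / L ∈ J := by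
  constructor
  · intro h
    obtain ⟨⟨j, a⟩, hja, rfl⟩ := Finset.mem_image.1 h
    rw [Finset.mem_product, Finset.mem_range] at hja
    have := ediv_mul_add_fin j (⟨a, hja.2⟩ : Fin L)
    simp only at this ⊢
    rw [this]; exact hja.1
  · intro h
    obtain ⟨a, ha⟩ := exists_eq_mul_add_fin hL n
    exact Finset.mem_image.2 ⟨(n / L, a), by simp [h], ha.symm⟩

/-- The blocks in `[-N, N]` all of whose couplings exceed `t`. -/
def goodBlocks (κ : ℤ → ℝ) (L N : ℕ) (t : ℝ) : Finset ℤ :=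
  open scoped Classical in (blockIndices L N).filter fun j => ∀ a, t < block κ L j a

/-- Taking moduli removes the phase, as in the diamagnetic inequality, and reduces the twisted form
to the real one of `bad_block_form_le`. -/
lemma norm_twistDiff_ge (θ : ℝ) (w : ℤ → ℂ) (n : ℤ) :
    (‖w n‖ - ‖w (n - 1)‖) ^ 2 ≤ ‖twistDiff θ w n‖ ^ 2 := by
  have h := abs_norm_sub_norm_le (w n) (Complex.exp (Complex.I * θ) * w (n - 1))
  have h1 : ‖Complex.exp (Complex.I * θ)‖ = 1 := by
    rw [mul_comm]; exact Complex.norm_exp_ofReal_mul_I θ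
  rw [norm_mul, h1, one_mul] at h
  rw [← sq_abs]
  exact pow_le_pow_left₀ (abs_nonneg _) h 2

/-- The coefficients, with respect to `ψ`, of a combination of the rescaled vectors. -/
def coeffs (κ : ℤ → ℝ) {N : ℕ} (v : EuclideanSpace ℂ (Finset.Icc (-(N : ℤ)) (N : ℤ))) (n : ℤ) : ℂ :=
  if h : n ∈ Finset.Icc (-(N : ℤ)) (N : ℤ) then ((√(κ n) : ℝ) : ℂ) * v ⟨n, h⟩ else 0

lemma synth_scaled_eq (ψ : ℤ → H) (κ : ℤ → ℝ) {N : ℕ}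
    (v : EuclideanSpace ℂ (Finset.Icc (-(N : ℤ)) (N : ℤ))) {S : Finset ℤ}
    (hS : Finset.Icc (-(N : ℤ)) (N : ℤ) ⊆ S) :
    synth (scaled ψ κ N) v = ∑ n ∈ S, coeffs κ v n • ψ n := by
  rw [← Finset.sum_subset hS, ← Finset.sum_coe_sort (Finset.Icc (-(N : ℤ)) (N : ℤ)), synth_apply]
  · refine Finset.sum_congr rfl fun n _ => ?_
    rw [coeffs, dif_pos n.2, scaled, smul_smul, mul_comm]
  · intro n _ hn
    rw [coeffs, dif_neg hn, zero_smul]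

lemma norm_sq_coeffs_div {κ : ℤ → ℝ} (hκ0 : ∀ n, 0 < κ n) {N : ℕ}
    (v : EuclideanSpace ℂ (Finset.Icc (-(N : ℤ)) (N : ℤ))) :
    ‖v‖ ^ 2 = ∑ n ∈ Finset.Icc (-(N : ℤ)) (N : ℤ), ‖coeffs κ v n‖ ^ 2 / κ n := by
  rw [EuclideanSpace.norm_sq_eq, ← Finset.sum_coe_sort (Finset.Icc (-(N : ℤ)) (N : ℤ))]
  refine Finset.sum_congr rfl fun n _ => ?_
  rw [coeffs, dif_pos n.2, norm_mul, mul_pow, Complex.norm_real, Real.norm_eq_abs, sq_abs,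
    Real.sq_sqrt (hκ0 _).le, mul_div_cancel_left₀ _ (hκ0 _).ne']

/-- Forcing a vector to vanish off the bad blocks costs one dimension for each site at the ends of
the window or in a good block. On the vectors that remain, the form is bounded block by block. -/
lemma card_gramEig_gt_le_goodBlocks {θ Φ K η δ c : ℝ} (hΦ : 0 < Φ) (hK : 0 < K) (hη : 0 < η)
    (hδ : 0 ≤ δ) (hc0 : 0 ≤ c)
    (hform : ∀ (S : Finset ℤ) (w : ℤ → ℂ), (∀ n, w n ≠ 0 → n ∈ S ∧ n + 1 ∈ S) →
      c * ∑ n ∈ S, ‖twistDiff θ w n‖ ^ 2 ≤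
        Φ * ∑ n ∈ S, ‖w n‖ ^ 2 - ‖∑ n ∈ S, w n • ψ n‖ ^ 2)
    {L : ℕ} (hL : 0 < L)
    (hc : 2 * (L : ℝ) ^ 2 * δ ≤ K * c) (hηδ : 4 * (L : ℝ) ^ 2 * δ ≤ η * Φ)
    {κ : ℤ → ℝ} (hκ0 : ∀ n, 0 < κ n) (hκK : ∀ n, κ n ≤ K) (N : ℕ) :
    Fintype.card {i // K * Φ - δ < gramEig (scaled ψ κ N) i} ≤
      2 * L + L * (goodBlocks κ L N (K - η)).card := by
  classical
  set T := Finset.Icc (-(N : ℤ)) (N : ℤ) with hT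
  set J := blockIndices L N \ goodBlocks κ L N (K - η) with hJ
  set G : Finset ↥T := Finset.univ.filter fun n => (n : ℤ) / L ∉ J with hG
  have hcard : G.card ≤ 2 * L + L * (goodBlocks κ L N (K - η)).card := by
    rw [← Finset.card_map (Function.Embedding.subtype _)]
    have hsub : G.map (Function.Embedding.subtype _) ⊆
        (T.filter fun s : ℤ => s / (L : ℤ) ∉ blockIndices L N) ∪
        ((goodBlocks κ L N (K - η)) ×ˢ Finset.range L).image (fun p => p.1 * L + (p.2 : ℤ)) := by
      intro n hn
      obtain ⟨s, hs, rfl⟩ := Finset.mem_map.1 hn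
      rw [hG, Finset.mem_filter, hJ, Finset.mem_sdiff] at hs
      rw [Finset.mem_union, mem_image_blocks hL, Finset.mem_filter]
      by_cases hb : (s : ℤ) / L ∈ blockIndices L N
      · right
        by_contra hg
        exact hs.2 ⟨hb, hg⟩
      · exact Or.inl ⟨s.2, hb⟩
    refine (Finset.card_le_card hsub).trans ((Finset.card_union_le _ _).trans ?_)
    refine add_le_add (card_not_mem_blocks_le hL N) (Finset.card_image_le.trans ?_)
    rw [Finset.card_product, Finset.card_range, mul_comm]
  refine (card_gramEig_gt_le _ G _ fun v hv => ?_).trans hcard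
  set w := coeffs κ v with hw
  have hw0 : ∀ n : ℤ, n / (L : ℤ) ∉ J → w n = 0 := by
    intro n hn
    rw [hw, coeffs]
    split_ifs with h
    · rw [hv ⟨n, h⟩ (by rw [hG, Finset.mem_filter]; exact ⟨Finset.mem_univ _, hn⟩), mul_zero]
    · rfl
  -- The extra site on the right holds the translate of the support required by `hform`.
  set S := Finset.Icc (-(N : ℤ)) ((N : ℤ) + 1) with hS
  have hTS : T ⊆ S := Finset.Icc_subset_Icc le_rfl (by omega)
  have hsupp : ∀ n, w n ≠ 0 → n ∈ S ∧ n + 1 ∈ S := by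
    intro n hn
    have : n ∈ T := by
      by_contra h
      exact hn (by rw [hw, coeffs, dif_neg h])
    rw [hT, Finset.mem_Icc] at this
    rw [hS, Finset.mem_Icc, Finset.mem_Icc]
    omega
  have hJT : (J ×ˢ Finset.range L).image (fun p => p.1 * L + (p.2 : ℤ)) ⊆ T := by
    intro n hn
    rw [mem_image_blocks hL] at hn
    obtain ⟨a, ha⟩ := exists_eq_mul_add_fin hL n
    rw [ha]
    exact mem_Icc_of_mem_blockIndices (Finset.mem_sdiff.1 hn).1 a
  have h1 := hform S w hsupp
  rw [← synth_scaled_eq ψ κ v hTS] at h1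
  have hsumw : ∑ n ∈ S, ‖w n‖ ^ 2 =
      ∑ j ∈ J, ∑ a ∈ Finset.range L, ‖w (j * L + (a : ℤ))‖ ^ 2 := by
    rw [sum_blocks_eq J fun n => ‖w n‖ ^ 2]
    refine (Finset.sum_subset (hJT.trans hTS) fun n _ hn => ?_).symm
    rw [mem_image_blocks hL] at hn
    rw [hw0 n hn]; simp
  have hsumv : ‖v‖ ^ 2 = ∑ j ∈ J, ∑ a ∈ Finset.range L,
      ‖w (j * L + (a : ℤ))‖ ^ 2 / κ (j * L + (a : ℤ)) := by
    rw [norm_sq_coeffs_div hκ0 v, sum_blocks_eq J fun n => ‖w n‖ ^ 2 / κ n]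
    refine (Finset.sum_subset hJT fun n _ hn => ?_).symm
    rw [mem_image_blocks hL] at hn
    rw [← hw, hw0 n hn]; simp
  -- Dropping the squared differences across block boundaries decouples the blocks, as in Neumann
  -- bracketing.
  have hsumd : ∑ j ∈ J, ∑ a ∈ Finset.range (L - 1),
      (‖w (j * L + ((a + 1 : ℕ) : ℤ))‖ - ‖w (j * L + (a : ℤ))‖) ^ 2 ≤
      ∑ n ∈ S, ‖twistDiff θ w n‖ ^ 2 := by
    calc _ ≤ ∑ j ∈ J, ∑ a ∈ Finset.range L, ‖twistDiff θ w (j * L + (a : ℤ))‖ ^ 2 := by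
          refine Finset.sum_le_sum fun j _ => ?_
          obtain ⟨l, rfl⟩ : ∃ l, L = l + 1 := ⟨L - 1, by omega⟩
          rw [Finset.sum_range_succ', Nat.add_sub_cancel]
          refine le_add_of_le_of_nonneg (Finset.sum_le_sum fun a _ => ?_) (sq_nonneg _)
          refine le_trans (le_of_eq ?_) (norm_twistDiff_ge θ w _)
          congr 4
          push_cast; ring
      _ = _ := sum_blocks_eq J fun n => ‖twistDiff θ w n‖ ^ 2
      _ ≤ _ := Finset.sum_le_sum_of_subset_of_nonneg (hJT.trans hTS) fun _ _ _ => sq_nonneg _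
  have hmain : ∀ j ∈ J, Φ * ∑ a ∈ Finset.range L, ‖w (j * L + (a : ℤ))‖ ^ 2 -
      c * ∑ a ∈ Finset.range (L - 1),
        (‖w (j * L + ((a + 1 : ℕ) : ℤ))‖ - ‖w (j * L + (a : ℤ))‖) ^ 2 ≤
      (K * Φ - δ) * ∑ a ∈ Finset.range L,
        ‖w (j * L + (a : ℤ))‖ ^ 2 / κ (j * L + (a : ℤ)) := by
    intro j hj
    rw [hJ, Finset.mem_sdiff, goodBlocks, Finset.mem_filter] at hj
    have : ∃ a, block κ L j a ≤ K - η := by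
      by_contra! h
      exact hj.2 ⟨hj.1, h⟩
    obtain ⟨m, hm⟩ := this
    exact bad_block_form_le hΦ hK hη hδ hc hηδ (fun a => ‖w (j * L + (a : ℤ))‖)
      (fun a => κ (j * L + (a : ℤ))) (fun a => hκ0 _) (fun a => hκK _) m.2 hm
  have h2 := Finset.sum_le_sum hmain
  rw [Finset.sum_sub_distrib, ← Finset.mul_sum, ← Finset.mul_sum, ← Finset.mul_sum, ← hsumw,
    ← hsumv] at h2
  have h3 := mul_le_mul_of_nonneg_left hsumd hc0
  linarith

end Upper

/-! ### Modulated tents as trial vectors -/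

section Trial

/-- The tent function supported on `[0, 4 m)`. -/
def tent (m : ℕ) (n : ℤ) : ℝ := max 0 (min ((n : ℝ) + 1) (4 * m - n))

lemma tent_nonneg (m : ℕ) (n : ℤ) : 0 ≤ tent m n := le_max_left _ _

lemma tent_eq_zero {m : ℕ} {n : ℤ} (h : n < 0 ∨ 4 * (m : ℤ) ≤ n) : tent m n = 0 := by
  refine max_eq_left ?_
  rcases h with h | h
  · refine (min_le_left _ _).trans ?_
    have : (n : ℝ) + 1 ≤ 0 := by exact_mod_cast h
    exact this
  · refine (min_le_right _ _).trans ?_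
    have : (4 * m : ℝ) ≤ n := by exact_mod_cast h
    linarith

lemma sq_tent_sub_le (m : ℕ) (n : ℤ) : (tent m n - tent m (n - 1)) ^ 2 ≤ 1 := by
  rw [sq_le_one_iff_abs_le_one, tent, tent]
  refine (abs_max_sub_max_le_max _ _ _ _).trans (max_le (by simp) ?_)
  refine (abs_min_sub_min_le_max _ _ _ _).trans (max_le ?_ ?_) <;> push_cast
  · rw [show (n : ℝ) + 1 - (n - 1 + 1) = 1 by ring, abs_one]
  · rw [show (4 * m : ℝ) - n - (4 * m - (n - 1)) = -1 by ring, abs_neg, abs_one]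

/-- On the middle half [m, 3m) the tent has height at least `m`. -/
lemma le_sum_tent_sq (m : ℕ) : 2 * (m : ℝ) ^ 3 ≤ ∑ n ∈ Finset.Ico 0 (4 * (m : ℤ)), tent m n ^ 2 := by
  have hsub : Finset.Ico (m : ℤ) (3 * m) ⊆ Finset.Ico 0 (4 * (m : ℤ)) :=
    Finset.Ico_subset_Ico (by omega) (by omega)
  refine le_trans ?_ (Finset.sum_le_sum_of_subset_of_nonneg hsub fun _ _ _ => sq_nonneg _)
  have h1 : ∀ n ∈ Finset.Ico (m : ℤ) (3 * m), (m : ℝ) ^ 2 ≤ tent m n ^ 2 := by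
    intro n hn
    rw [Finset.mem_Ico] at hn
    have h2 : (m : ℝ) ≤ n := by exact_mod_cast hn.1
    have h3 : (n : ℝ) ≤ 3 * m := by exact_mod_cast hn.2.le
    refine pow_le_pow_left₀ (Nat.cast_nonneg _) (le_max_of_le_right (le_min ?_ ?_)) 2 <;> linarith
  refine le_trans (le_of_eq ?_) (Finset.card_nsmul_le_sum _ _ _ h1)
  rw [Int.card_Ico, nsmul_eq_mul, show (3 * (m : ℤ) - m).toNat = 2 * m by omega]
  push_cast
  ring

/-- The modulated tent function on the `j`-th block. -/
def modTent (θ : ℝ) (m : ℕ) (j n : ℤ) : ℂ :=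
  Complex.exp (Complex.I * θ * n) * tent m (n - j * (4 * m : ℕ))

lemma norm_exp_I_mul (θ : ℝ) (n : ℤ) : ‖Complex.exp (Complex.I * θ * n)‖ = 1 := by
  rw [show Complex.I * θ * n = ((θ * n : ℝ) : ℂ) * Complex.I by push_cast; ring]
  exact Complex.norm_exp_ofReal_mul_I _

lemma norm_modTent (θ : ℝ) (m : ℕ) (j n : ℤ) :
    ‖modTent θ m j n‖ = tent m (n - j * (4 * m : ℕ)) := by
  rw [modTent, norm_mul, norm_exp_I_mul, one_mul, Complex.norm_real,
    Real.norm_of_nonneg (tent_nonneg _ _)]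

lemma modTent_eq_zero {θ : ℝ} {m : ℕ} {j n : ℤ}
    (h : n ∉ Finset.Ico (j * (4 * m : ℕ)) (j * (4 * m : ℕ) + 4 * m)) : modTent θ m j n = 0 := by
  rw [modTent, tent_eq_zero, Complex.ofReal_zero, mul_zero]
  rw [Finset.mem_Ico] at h
  omega

/-- The modulation is exactly the phase that the twist removes, leaving the plain difference of
tents. -/
lemma norm_sq_twistDiff_modTent (θ : ℝ) (m : ℕ) (j n : ℤ) :
    ‖twistDiff θ (modTent θ m j) n‖ ^ 2 =
      (tent m (n - j * (4 * m : ℕ)) - tent m (n - j * (4 * m : ℕ) - 1)) ^ 2 := by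
  have h : twistDiff θ (modTent θ m j) n = Complex.exp (Complex.I * θ * n) *
      ((tent m (n - j * (4 * m : ℕ)) - tent m (n - j * (4 * m : ℕ) - 1) : ℝ) : ℂ) := by
    have h1 : Complex.exp (Complex.I * θ * n) =
        Complex.exp (Complex.I * θ) * Complex.exp (Complex.I * θ * (n - 1 : ℤ)) := by
      rw [← Complex.exp_add]; congr 1; push_cast; ring
    rw [twistDiff, modTent, modTent, sub_right_comm n 1, h1]
    push_cast
    ring
  rw [h, norm_mul, norm_exp_I_mul, one_mul, Complex.norm_real, Real.norm_eq_abs, sq_abs]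

lemma sum_norm_sq_modTent (θ : ℝ) (m : ℕ) (j : ℤ) {S : Finset ℤ}
    (hS : Finset.Ico (j * (4 * m : ℕ)) (j * (4 * m : ℕ) + 4 * m) ⊆ S) :
    2 * (m : ℝ) ^ 3 ≤ ∑ n ∈ S, ‖modTent θ m j n‖ ^ 2 := by
  refine (le_sum_tent_sq m).trans ?_
  refine le_trans (le_of_eq ?_)
    (Finset.sum_le_sum_of_subset_of_nonneg hS fun _ _ _ => sq_nonneg _)
  have himg : Finset.Ico (j * (4 * m : ℕ)) (j * (4 * m : ℕ) + 4 * (m : ℤ)) =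
      (Finset.Ico 0 (4 * (m : ℤ))).image (fun n => n + j * (4 * m : ℕ)) := by
    rw [Finset.image_add_right_Ico, zero_add, add_comm]
  rw [himg, Finset.sum_image (by intro a _ b _ hab; simpa using hab)]
  refine Finset.sum_congr rfl fun n _ => ?_
  rw [norm_modTent, add_sub_cancel_right]

/-- Each difference is at most one, and it vanishes outside the 4m sites of the block and the one
site after it; 4m + 1 ≤ 5m as `m` is positive. -/
lemma sum_twistDiff_modTent_le (θ : ℝ) {m : ℕ} (hm : 0 < m) (j : ℤ) (S : Finset ℤ) :
    ∑ n ∈ S, ‖twistDiff θ (modTent θ m j) n‖ ^ 2 ≤ 5 * m := by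
  have hpt : ∀ n ∈ S, ‖twistDiff θ (modTent θ m j) n‖ ^ 2 ≤
      if n ∈ Finset.Icc (j * (4 * m : ℕ)) (j * (4 * m : ℕ) + 4 * m) then 1 else 0 := by
    intro n _
    rw [norm_sq_twistDiff_modTent]
    split_ifs with h
    · exact sq_tent_sub_le _ _
    · rw [Finset.mem_Icc] at h
      rw [tent_eq_zero (by omega), tent_eq_zero (by omega)]
      simp
  refine (Finset.sum_le_sum hpt).trans ?_
  rw [← Finset.sum_filter, Finset.sum_const, nsmul_eq_mul, mul_one]
  have h1 : (S.filter fun n =>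
      n ∈ Finset.Icc (j * (4 * m : ℕ)) (j * (4 * m : ℕ) + 4 * (m : ℤ))).card ≤ 5 * m := by
    refine (Finset.card_le_card (t := Finset.Icc (j * (4 * m : ℕ)) (j * (4 * m : ℕ) + 4 * (m : ℤ)))
      fun n hn => (Finset.mem_filter.1 hn).2).trans ?_
    rw [Int.card_Icc]
    omega
  exact_mod_cast h1

variable {H : Type*} [NormedAddCommGroup H] [InnerProductSpace ℂ H] {ψ : ℤ → H}

/-- The trial vector on the `j`-th block. -/
def trialVec (θ : ℝ) (κ : ℤ → ℝ) (m N : ℕ) (j : ℤ) :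
    EuclideanSpace ℂ (Finset.Icc (-(N : ℤ)) (N : ℤ)) :=
  WithLp.toLp 2 fun n => modTent θ m j n / ((√(κ n) : ℝ) : ℂ)

lemma Ico_block_subset {m N : ℕ} {j : ℤ} (hj : j ∈ blockIndices (4 * m) N) :
    Finset.Ico (j * (4 * m : ℕ)) (j * (4 * m : ℕ) + 4 * m) ⊆
      Finset.Icc (-(N : ℤ)) (N : ℤ) := by
  intro n hn
  rw [Finset.mem_Ico] at hn
  have := mem_Icc_of_mem_blockIndices hj ⟨(n - j * (4 * m : ℕ)).toNat, by omega⟩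
  simp only at this
  rwa [Int.toNat_of_nonneg (by omega), add_sub_cancel] at this

lemma coeffs_trialVec {θ : ℝ} {κ : ℤ → ℝ} (hκ0 : ∀ n, 0 < κ n) {m N : ℕ} {j : ℤ}
    (hj : j ∈ blockIndices (4 * m) N) : coeffs κ (trialVec θ κ m N j) = modTent θ m j := by
  ext n
  rw [coeffs]
  split_ifs with h
  · have : ((√(κ n) : ℝ) : ℂ) ≠ 0 := by exact_mod_cast (Real.sqrt_pos.2 (hκ0 n)).ne'
    simp only [trialVec]
    field_simp
  · rw [modTent_eq_zero fun hn => h (Ico_block_subset hj hn)]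

lemma inner_trialVec_eq_zero (θ : ℝ) (κ : ℤ → ℝ) {m : ℕ} (N : ℕ) {i j : ℤ} (hij : i ≠ j) :
    inner ℂ (trialVec θ κ m N i) (trialVec θ κ m N j) = 0 := by
  rw [PiLp.inner_apply]
  refine Finset.sum_eq_zero fun n _ => ?_
  have h : modTent θ m i n = 0 ∨ modTent θ m j n = 0 := by
    by_contra! h
    have h1 := not_imp_comm.1 modTent_eq_zero h.1
    have h2 := not_imp_comm.1 modTent_eq_zero h.2
    rw [Finset.mem_Ico] at h1 h2
    rcases lt_or_gt_of_ne hij with h3 | h3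
    · have : i + 1 ≤ j := h3
      push_cast at h1 h2
      nlinarith
    · have : j + 1 ≤ i := h3
      push_cast at h1 h2
      nlinarith
  rcases h with h | h <;> simp [trialVec, h]

/-- Division by √κ makes the coefficients with respect to `ψ` exactly those of the tent. Of the
allowed deficit δ/2, one half pays for couplings down to K - ε (by `hεδ`), the other for the
Dirichlet energy at most 5m against the mass at least 2m³ (by `hmδ`). -/
lemma trialVec_form_ge {θ Φ K ε δ c : ℝ} (hc : 0 ≤ c) (hK : 0 < K) (hε : 0 < ε)
    (hεK : ε < K) (hεδ : 4 * (ε * Φ) ≤ δ) (hδ : δ ≤ 2 * (K * Φ))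
    (hform : ∀ (S : Finset ℤ) (w : ℤ → ℂ), (∀ n, w n ≠ 0 → n ∈ S ∧ n + 1 ∈ S) →
      Φ * ∑ n ∈ S, ‖w n‖ ^ 2 - ‖∑ n ∈ S, w n • ψ n‖ ^ 2 ≤
        c * ∑ n ∈ S, ‖twistDiff θ w n‖ ^ 2)
    {m : ℕ} (hm : 0 < m) (hmδ : 10 * K * c ≤ δ * (m : ℝ) ^ 2)
    {κ : ℤ → ℝ} (hκ0 : ∀ n, 0 < κ n) {N : ℕ} {j : ℤ}
    (hj : j ∈ goodBlocks κ (4 * m) N (K - ε)) :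
    0 < ‖trialVec θ κ m N j‖ ∧
      (K * Φ - δ / 2) * ‖trialVec θ κ m N j‖ ^ 2 ≤
        ‖synth (scaled ψ κ N) (trialVec θ κ m N j)‖ ^ 2 := by
  classical
  rw [goodBlocks, Finset.mem_filter] at hj
  obtain ⟨hj, hgood⟩ := hj
  have hcu : coeffs κ (trialVec θ κ m N j) = modTent θ m j := coeffs_trialVec hκ0 hj
  have hsubT := Ico_block_subset hj
  set T := Finset.Icc (-(N : ℤ)) (N : ℤ) with hT
  set u := trialVec θ κ m N j
  set w := modTent θ m j with hw
  set S := Finset.Icc (-(N : ℤ)) ((N : ℤ) + 1) with hS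
  have hTS : T ⊆ S := Finset.Icc_subset_Icc le_rfl (by omega)
  have hsupp : ∀ n, w n ≠ 0 → n ∈ S ∧ n + 1 ∈ S := by
    intro n hn
    have := hsubT (not_imp_comm.1 modTent_eq_zero hn)
    rw [hT, Finset.mem_Icc] at this
    rw [hS, Finset.mem_Icc, Finset.mem_Icc]
    omega
  have hκw : ∀ n, w n ≠ 0 → K - ε < κ n := by
    intro n hn
    have h1 := not_imp_comm.1 modTent_eq_zero hn
    rw [Finset.mem_Ico] at h1
    have h2 := hgood ⟨(n - j * (4 * m : ℕ)).toNat, by omega⟩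
    simp only [block] at h2
    rwa [Int.toNat_of_nonneg (by omega), add_sub_cancel] at h2
  have h1 := hform S w hsupp
  rw [← hcu, ← synth_scaled_eq ψ κ u hTS, hcu] at h1
  have hD := sum_twistDiff_modTent_le θ hm j S
  have hWT : ∑ n ∈ S, ‖w n‖ ^ 2 = ∑ n ∈ T, ‖w n‖ ^ 2 := by
    refine (Finset.sum_subset hTS fun n _ hn => ?_).symm
    rw [hw, modTent_eq_zero fun h => hn (hsubT h)]; simp
  have hW := sum_norm_sq_modTent θ m j hsubT
  rw [← hw] at hW hD
  rw [hWT] at h1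
  set W := ∑ n ∈ T, ‖w n‖ ^ 2 with hWdef
  have hm' : (1 : ℝ) ≤ m := by exact_mod_cast hm
  have hW0 : 0 < W := lt_of_lt_of_le (by positivity) hW
  have hu : ‖u‖ ^ 2 = ∑ n ∈ T, ‖w n‖ ^ 2 / κ n := by rw [norm_sq_coeffs_div hκ0 u, hcu]
  have hKε : 0 < K - ε := by linarith
  have huW : (K - ε) * ‖u‖ ^ 2 ≤ W := by
    rw [hu, Finset.mul_sum]
    refine Finset.sum_le_sum fun n _ => ?_
    by_cases h0 : w n = 0
    · simp [h0]
    · rw [mul_div_assoc', div_le_iff₀ (hκ0 n), mul_comm]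
      exact mul_le_mul_of_nonneg_left (hκw n h0).le (by positivity)
  have hu0 : 0 < ‖u‖ := by
    rw [norm_pos_iff]
    intro h0
    have h2 : ∀ n, w n = 0 := fun n => by rw [← hcu, h0, coeffs]; simp
    have : W = 0 := by rw [hWdef]; simp [h2]
    linarith
  refine ⟨hu0, ?_⟩
  have h2 : (K * Φ - δ / 2) * ((K - ε) * ‖u‖ ^ 2) ≤ (K * Φ - δ / 2) * W :=
    mul_le_mul_of_nonneg_left huW (by linarith)
  have h3 : (K * Φ - δ / 2) * W ≤ (K - ε) * (Φ * W - c * (5 * m)) := by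
    have h4 : ε * Φ * W ≤ δ / 4 * W := by
      refine mul_le_mul_of_nonneg_right ?_ hW0.le; linarith
    have hδ0 : 0 ≤ δ * (m : ℝ) ^ 2 := le_trans (by positivity) hmδ
    have hδ1 : 0 ≤ δ := by
      by_contra! h
      have : δ * (m : ℝ) ^ 2 < 0 := mul_neg_of_neg_of_pos h (by positivity)
      linarith
    have h5 : 5 * K * c * m ≤ δ / 4 * W := by
      calc 5 * K * c * m = (10 * K * c) * (m / 2) := by ring
        _ ≤ δ * (m : ℝ) ^ 2 * (m / 2) := by gcongr
        _ = δ / 4 * (2 * (m : ℝ) ^ 3) := by ring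
        _ ≤ δ / 4 * W := by gcongr
    have h6 : 0 ≤ ε * (c * (5 * m)) := by positivity
    nlinarith
  have h4 : (K - ε) * (Φ * W - c * (5 * m)) ≤
      (K - ε) * ‖synth (scaled ψ κ N) u‖ ^ 2 := by
    refine mul_le_mul_of_nonneg_left ?_ hKε.le
    have := mul_le_mul_of_nonneg_left hD hc
    linarith
  have h5 : (K - ε) * ((K * Φ - δ / 2) * ‖u‖ ^ 2) ≤ (K - ε) * ‖synth (scaled ψ κ N) u‖ ^ 2 := by
    calc _ = (K * Φ - δ / 2) * ((K - ε) * ‖u‖ ^ 2) := by ring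
      _ ≤ _ := h2.trans (h3.trans h4)
  exact le_of_mul_le_mul_left h5 hKε

lemma card_goodBlocks_le_sum_gramEig {θ Φ K ε δ c : ℝ} (hc : 0 ≤ c) (hK : 0 < K) (hε : 0 < ε)
    (hεK : ε < K) (hδ0 : 0 < δ) (hεδ : 4 * (ε * Φ) ≤ δ) (hδ : δ ≤ 2 * (K * Φ))
    (hform : ∀ (S : Finset ℤ) (w : ℤ → ℂ), (∀ n, w n ≠ 0 → n ∈ S ∧ n + 1 ∈ S) →
      Φ * ∑ n ∈ S, ‖w n‖ ^ 2 - ‖∑ n ∈ S, w n • ψ n‖ ^ 2 ≤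
        c * ∑ n ∈ S, ‖twistDiff θ w n‖ ^ 2)
    {m : ℕ} (hm : 0 < m) (hmδ : 10 * K * c ≤ δ * (m : ℝ) ^ 2)
    {κ : ℤ → ℝ} (hκ0 : ∀ n, 0 < κ n) (N : ℕ) (f : ℝ → ℝ) (hf0 : ∀ t, 0 ≤ f t)
    (hf : ∀ i, 1 - (K * Φ - gramEig (scaled ψ κ N) i) / δ ≤ f (gramEig (scaled ψ κ N) i)) :
    ((goodBlocks κ (4 * m) N (K - ε)).card : ℝ) / 2 ≤ ∑ i, f (gramEig (scaled ψ κ N) i) := by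
  set J := goodBlocks κ (4 * m) N (K - ε) with hJ
  have key := fun j : J => trialVec_form_ge (N := N) hc hK hε hεK hεδ hδ hform hm hmδ hκ0 j.2
  set v : J → EuclideanSpace ℂ (Finset.Icc (-(N : ℤ)) (N : ℤ)) := fun j =>
    ((‖trialVec θ κ m N j‖⁻¹ : ℝ) : ℂ) • trialVec θ κ m N j with hv
  have hon : Orthonormal ℂ v := by
    refine ⟨fun j => ?_, fun i j hij => ?_⟩
    · rw [hv]
      simp only [norm_smul, Complex.norm_real, norm_inv, norm_norm]
      exact inv_mul_cancel₀ (key j).1.ne'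
    · rw [hv]
      simp only [inner_smul_left, inner_smul_right]
      rw [inner_trialVec_eq_zero θ κ N fun h => hij (Subtype.ext h)]
      simp
  have hq : ∀ j, K * Φ - δ / 2 ≤ ‖synth (scaled ψ κ N) (v j)‖ ^ 2 := by
    intro j
    obtain ⟨h1, h2⟩ := key j
    rw [hv]
    simp only [map_smul, norm_smul, Complex.norm_real, norm_inv, norm_norm]
    rw [mul_pow, inv_pow, inv_mul_eq_div, le_div_iff₀ (by positivity)]
    exact h2
  have := card_le_sum_gramEig (scaled ψ κ N) v hon hδ0 hq f hf0 hf
  simpa using this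

end Trial

/-! ### Two-sided bounds on the IDS near the top edge -/

section Bounds

variable {H : Type*} [NormedAddCommGroup H] [InnerProductSpace ℂ H] {ψ : ℤ → H} {Φ K : ℝ}
  {P₀ : Measure ℝ} [IsProbabilityMeasure P₀] {ν : Measure ℝ}

/-- The block law of large numbers for the indicator that all couplings exceed `t`; the
normalisation is per site, hence the division by `L`. -/
lemma ae_tendsto_card_goodBlocks (P₀ : Measure ℝ) [IsProbabilityMeasure P₀] {L : ℕ} (hL : 0 < L)
    (t : ℝ) :
    ∀ᵐ κ ∂(Measure.infinitePi fun _ : ℤ => P₀),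
      Tendsto (fun N : ℕ => ((goodBlocks κ L N t).card : ℝ) / (2 * N + 1)) atTop
        (𝓝 (P₀.real (Ioi t) ^ L / L)) := by
  classical
  set A : Set (Fin L → ℝ) := Set.univ.pi fun _ => Ioi t with hA
  have hAm : MeasurableSet A := MeasurableSet.univ_pi fun _ => measurableSet_Ioi
  have hint : Integrable (A.indicator fun _ => (1 : ℝ)) (Measure.pi fun _ : Fin L => P₀) :=
    (integrable_const 1).indicator hAm
  have h := ae_tendsto_block_average P₀ hL (measurable_const.indicator hAm) hint
  rw [integral_indicator_const _ hAm, measureReal_def, hA, Measure.pi_pi, smul_eq_mul, mul_one,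
    Finset.prod_const, Finset.card_univ, Fintype.card_fin, ENNReal.toReal_pow] at h
  filter_upwards [h] with κ hκ
  refine hκ.congr fun N => ?_
  congr 1
  rw [goodBlocks, Finset.card_filter]
  push_cast
  refine Finset.sum_congr rfl fun j _ => ?_
  simp [Set.indicator, Set.mem_pi]

lemma IsIDSMeasure.ae_tendsto_eigAvg (hν : IsIDSMeasure ψ P₀ ν) (hψ : LinearIndependent ℂ ψ)
    (hP : ∀ᵐ x ∂P₀, x ∈ Ioc 0 K) :
    ∀ᵐ κ ∂(Measure.infinitePi fun _ : ℤ => P₀), (∀ n, κ n ∈ Ioc 0 K) ∧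
      ∀ f : ℝ → ℝ, Continuous f → Tendsto (fun N => eigAvg ψ κ N f) atTop (𝓝 (∫ x, f x ∂ν)) := by
  filter_upwards [hν.tendsto, ae_forall_mem hP] with κ h hκ
  refine ⟨hκ, fun f hf => ?_⟩
  have := h f hf
  simp only [integral_eigenvalueMeasure hψ fun n => (hκ n).1] at this
  exact this

/-- The continuous function vanishing on `(-∞, a]`, equal to `1` on `[a + δ, ∞)`, and affine in
between. -/
def ramp (a δ t : ℝ) : ℝ := max 0 (min 1 ((t - a) / δ))

lemma continuous_ramp (a δ : ℝ) : Continuous (ramp a δ) := by unfold ramp; fun_prop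

lemma ramp_nonneg (a δ t : ℝ) : 0 ≤ ramp a δ t := le_max_left _ _

lemma ramp_le_one (a δ t : ℝ) : ramp a δ t ≤ 1 := max_le zero_le_one (min_le_left _ _)

lemma ramp_eq_zero {a δ t : ℝ} (hδ : 0 < δ) (h : t ≤ a) : ramp a δ t = 0 :=
  max_eq_left ((min_le_right _ _).trans (div_nonpos_of_nonpos_of_nonneg (by linarith) hδ.le))

lemma ramp_pos {a δ t : ℝ} (hδ : 0 < δ) (h : a < t) : 0 < ramp a δ t :=
  lt_max_of_lt_right (lt_min zero_lt_one (div_pos (by linarith) hδ))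

lemma ramp_eq_one {a δ t : ℝ} (hδ : 0 < δ) (h : a + δ ≤ t) : ramp a δ t = 1 := by
  have : 1 ≤ (t - a) / δ := by rw [le_div_iff₀ hδ]; linarith
  rw [ramp, min_eq_left this, max_eq_right zero_le_one]

lemma le_ramp {a δ t : ℝ} (h : (t - a) / δ ≤ 1) : (t - a) / δ ≤ ramp a δ t := by
  rw [ramp, min_eq_right h]; exact le_max_right _ _

lemma integrable_ramp [IsFiniteMeasure ν] (a δ : ℝ) : Integrable (ramp a δ) ν := by
  refine Integrable.of_bound (continuous_ramp a δ).aestronglyMeasurable 1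
    (Eventually.of_forall fun t => ?_)
  rw [Real.norm_of_nonneg (ramp_nonneg _ _ _)]
  exact ramp_le_one _ _ _

lemma IsIDSMeasure.measure_Ioi_eq_zero (hν : IsIDSMeasure ψ P₀ ν) (hψ : LinearIndependent ℂ ψ)
    (hP : ∀ᵐ x ∂P₀, x ∈ Ioc 0 K) (hΦ : 0 ≤ Φ)
    (hform : ∀ (S : Finset ℤ) (w : ℤ → ℂ), ‖∑ n ∈ S, w n • ψ n‖ ^ 2 ≤ Φ * ∑ n ∈ S, ‖w n‖ ^ 2) :
    ν (Ioi (K * Φ)) = 0 := by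
  have := hν.isProbability
  obtain ⟨κ, hκ, h⟩ := (hν.ae_tendsto_eigAvg hψ hP).exists
  have h1 := h _ (continuous_ramp (K * Φ) 1)
  have h2 : ∀ N, eigAvg ψ κ N (ramp (K * Φ) 1) = 0 := fun N => by
    rw [eigAvg, Finset.sum_eq_zero, zero_div]
    intro i _
    exact ramp_eq_zero one_pos
      (gramEig_scaled_mem_Icc hΦ hform (fun n => (hκ n).1.le) (fun n => (hκ n).2) N i).2
  simp only [h2] at h1
  have h3 : ∫ x, ramp (K * Φ) 1 x ∂ν = 0 := (tendsto_nhds_unique tendsto_const_nhds h1).symm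
  rw [integral_eq_zero_iff_of_nonneg (fun t => ramp_nonneg _ _ _) (integrable_ramp _ _)] at h3
  refine measure_mono_null (fun t ht => ?_) (ae_iff.1 h3)
  exact (ramp_pos one_pos ht).ne'

/-- The upper bound on the density of states near the top edge. -/
lemma IsIDSMeasure.real_Ioc_le (hν : IsIDSMeasure ψ P₀ ν) (hψ : LinearIndependent ℂ ψ)
    (hP : ∀ᵐ x ∂P₀, x ∈ Ioc 0 K) {θ η δ c : ℝ} (hΦ : 0 < Φ) (hK : 0 < K) (hη : 0 < η)
    (hδ : 0 < δ) (hc0 : 0 ≤ c)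
    (hform : ∀ (S : Finset ℤ) (w : ℤ → ℂ), (∀ n, w n ≠ 0 → n ∈ S ∧ n + 1 ∈ S) →
      c * ∑ n ∈ S, ‖twistDiff θ w n‖ ^ 2 ≤
        Φ * ∑ n ∈ S, ‖w n‖ ^ 2 - ‖∑ n ∈ S, w n • ψ n‖ ^ 2)
    {L : ℕ} (hL : 0 < L)
    (hc : 4 * (L : ℝ) ^ 2 * δ ≤ K * c) (hηδ : 8 * (L : ℝ) ^ 2 * δ ≤ η * Φ) :
    ν.real (Ioc (K * Φ - δ) (K * Φ)) ≤ P₀.real (Ioi (K - η)) ^ L := by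
  classical
  have := hν.isProbability
  -- Starting the ramp at distance 2δ makes it equal to one on the whole interval. The bad-block
  -- estimate is therefore applied with 2δ, which accounts for the doubled constants in `hc` and
  -- `hηδ`.
  set E := K * Φ - 2 * δ with hE
  obtain ⟨κ, ⟨hκ, h⟩, hcard⟩ := ((hν.ae_tendsto_eigAvg hψ hP).and
    (ae_tendsto_card_goodBlocks P₀ hL (K - η))).exists
  have h1 : ν.real (Ioc (K * Φ - δ) (K * Φ)) ≤ ∫ t, ramp E δ t ∂ν := by
    rw [← integral_indicator_one measurableSet_Ioc]
    refine integral_mono ((integrable_const 1).indicator measurableSet_Ioc) (integrable_ramp _ _)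
      fun t => ?_
    by_cases ht : t ∈ Ioc (K * Φ - δ) (K * Φ)
    · rw [Set.indicator_of_mem ht, ramp_eq_one hδ (by rw [hE]; linarith [ht.1])]
      rfl
    · rw [Set.indicator_of_notMem ht]
      exact ramp_nonneg _ _ _
  refine h1.trans (le_of_tendsto_of_tendsto (h _ (continuous_ramp E δ))
    (g := fun N : ℕ => 2 * L / (2 * N + 1) +
      L * (((goodBlocks κ L N (K - η)).card : ℝ) / (2 * N + 1))) ?_
    (Eventually.of_forall fun N => ?_))
  · have h3 : Tendsto (fun N : ℕ => 2 * (N : ℝ) + 1) atTop atTop :=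
      tendsto_atTop_add_const_right _ _
        (tendsto_natCast_atTop_atTop.const_mul_atTop (by norm_num))
    have h4 := (h3.const_div_atTop (2 * (L : ℝ))).add (hcard.const_mul (L : ℝ))
    have hL' : (L : ℝ) ≠ 0 := by exact_mod_cast hL.ne'
    rwa [zero_add, mul_div_cancel₀ _ hL'] at h4
  · have h5 := card_gramEig_gt_le_goodBlocks hΦ hK hη (by positivity : 0 ≤ 2 * δ) hc0 hform hL
      (by linarith) (by linarith) (fun n => (hκ n).1) (fun n => (hκ n).2) N
    have h6 : ∑ i, ramp E δ (gramEig (scaled ψ κ N) i) ≤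
        (Fintype.card {i // K * Φ - 2 * δ < gramEig (scaled ψ κ N) i} : ℝ) := by
      rw [Fintype.card_subtype, Finset.card_filter]
      push_cast
      refine Finset.sum_le_sum fun i _ => ?_
      split_ifs with hi
      · exact ramp_le_one _ _ _
      · exact (ramp_eq_zero hδ (not_lt.1 hi)).le
    have h7 : (Fintype.card {i // K * Φ - 2 * δ < gramEig (scaled ψ κ N) i} : ℝ) ≤
        2 * L + L * (goodBlocks κ L N (K - η)).card := by exact_mod_cast h5
    simp only [eigAvg]
    rw [mul_div_assoc', ← add_div]
    gcongr
    exact h6.trans h7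

/-- The lower bound on the density of states near the top edge. -/
lemma IsIDSMeasure.le_real_Ioc (hν : IsIDSMeasure ψ P₀ ν) (hψ : LinearIndependent ℂ ψ)
    (hP : ∀ᵐ x ∂P₀, x ∈ Ioc 0 K) {θ ε δ c : ℝ} (hΦ : 0 ≤ Φ) (hc : 0 ≤ c) (hK : 0 < K) (hε : 0 < ε)
    (hεK : ε < K) (hδ0 : 0 < δ) (hεδ : 4 * (ε * Φ) ≤ δ) (hδ : δ ≤ 2 * (K * Φ))
    (hform' : ∀ (S : Finset ℤ) (w : ℤ → ℂ), ‖∑ n ∈ S, w n • ψ n‖ ^ 2 ≤ Φ * ∑ n ∈ S, ‖w n‖ ^ 2)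
    (hform : ∀ (S : Finset ℤ) (w : ℤ → ℂ), (∀ n, w n ≠ 0 → n ∈ S ∧ n + 1 ∈ S) →
      Φ * ∑ n ∈ S, ‖w n‖ ^ 2 - ‖∑ n ∈ S, w n • ψ n‖ ^ 2 ≤
        c * ∑ n ∈ S, ‖twistDiff θ w n‖ ^ 2)
    {m : ℕ} (hm : 0 < m) (hmδ : 10 * K * c ≤ δ * (m : ℝ) ^ 2) :
    P₀.real (Ioi (K - ε)) ^ (4 * m) / (8 * m) ≤ ν.real (Ioc (K * Φ - δ) (K * Φ)) := by
  have := hν.isProbability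
  -- This ramp stays below the indicator on the support of `ν`, and on the eigenvalues it dominates
  -- the affine function needed in `card_le_sum_gramEig`.
  set E := K * Φ - δ with hE
  have hm4 : 0 < 4 * m := by omega
  obtain ⟨κ, ⟨hκ, h⟩, hcard⟩ := ((hν.ae_tendsto_eigAvg hψ hP).and
    (ae_tendsto_card_goodBlocks P₀ hm4 (K - ε))).exists
  have h0 : ∀ᵐ t ∂ν, t ≤ K * Φ := by
    rw [ae_iff]
    simp only [not_le]
    exact hν.measure_Ioi_eq_zero hψ hP hΦ hform'
  have h1 : ∫ t, ramp E δ t ∂ν ≤ ν.real (Ioc E (K * Φ)) := by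
    rw [← integral_indicator_one measurableSet_Ioc]
    refine integral_mono_ae (integrable_ramp _ _) ((integrable_const 1).indicator measurableSet_Ioc)
      ?_
    filter_upwards [h0] with t ht
    by_cases hEt : E < t
    · rw [Set.indicator_of_mem (show t ∈ Ioc E (K * Φ) from ⟨hEt, ht⟩)]
      exact ramp_le_one _ _ _
    · rw [ramp_eq_zero hδ0 (not_lt.1 hEt)]
      exact Set.indicator_nonneg (fun _ _ => zero_le_one) _
  refine le_trans (le_of_tendsto_of_tendsto (hcard.div_const 2) (h _ (continuous_ramp E δ))
    (Eventually.of_forall fun N => ?_) |> le_trans (le_of_eq ?_)) h1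
  · push_cast
    field_simp
    ring
  · have h2 := card_goodBlocks_le_sum_gramEig hc hK hε hεK hδ0 hεδ hδ hform hm hmδ
      (fun n => (hκ n).1) N (ramp E δ) (ramp_nonneg E δ) fun i => by
        have h3 := (gramEig_scaled_mem_Icc hΦ hform' (fun n => (hκ n).1.le)
          (fun n => (hκ n).2) N i).2
        have h4 : 1 - (K * Φ - gramEig (scaled ψ κ N) i) / δ =
            (gramEig (scaled ψ κ N) i - E) / δ := by
          rw [hE]; field_simp; ring
        rw [h4]
        refine le_ramp ?_
        rw [div_le_one hδ0]; linarith
    simp only [eigAvg]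
    rw [div_right_comm]
    gcongr

end Bounds

/-! ### From two-sided bounds to the exponent -/

section LogLog

/-- Applied to `X` = -log ν. After taking logarithms the factor D + l |log δ| contributes only a
log-log term, negligible against log δ, so the power δ^(-1/2) alone decides the limit. -/
lemma tendsto_log_div_log {X : ℝ → ℝ} {c A D l : ℝ} (hc : 0 < c) (hA : 0 < A) (hl : 0 < l)
    (h : ∀ᶠ δ in 𝓝[>] (0 : ℝ), c / √δ ≤ X δ ∧ X δ ≤ A / √δ * (D + l * -Real.log δ)) :
    Tendsto (fun δ => Real.log (X δ) / Real.log δ) (𝓝[>] 0) (𝓝 (-1 / 2)) := by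
  have hs : Tendsto (fun δ : ℝ => -Real.log δ) (𝓝[>] 0) atTop :=
    tendsto_neg_atBot_atTop.comp Real.tendsto_log_nhdsGT_zero
  have hlin : Tendsto (fun s : ℝ => D + l * s) atTop atTop :=
    tendsto_atTop_add_const_left _ _ (tendsto_id.const_mul_atTop hl)
  have hlog : Tendsto (fun s : ℝ => Real.log (D + l * s) / s) atTop (𝓝 0) := by
    have h1 : Tendsto (fun x : ℝ => Real.log x / x) atTop (𝓝 0) :=
      Real.isLittleO_log_id_atTop.tendsto_div_nhds_zero
    have h2 : Tendsto (fun s : ℝ => (D + l * s) / s) atTop (𝓝 l) := by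
      have h3 : Tendsto (fun s : ℝ => D / s + l) atTop (𝓝 (0 + l)) :=
        (tendsto_id.const_div_atTop D).add_const l
      rw [zero_add] at h3
      refine h3.congr' ?_
      filter_upwards [eventually_gt_atTop 0] with s hs
      field_simp
    have h4 := (h1.comp hlin).mul h2
    rw [zero_mul] at h4
    refine h4.congr' ?_
    filter_upwards [hlin.eventually_gt_atTop 0] with s hs
    simp only [Function.comp_apply]
    field_simp
  have hlow : Tendsto (fun s : ℝ => -(Real.log A / s + Real.log (D + l * s) / s) - 1 / 2) atTop
      (𝓝 (-1 / 2)) := by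
    have := ((tendsto_id.const_div_atTop (Real.log A)).add hlog).neg.sub_const (1 / 2)
    rw [show (-1 / 2 : ℝ) = -(0 + 0) - 1 / 2 by norm_num]
    exact this
  have hupp : Tendsto (fun s : ℝ => -(Real.log c / s) - 1 / 2) atTop (𝓝 (-1 / 2)) := by
    have := (tendsto_id.const_div_atTop (Real.log c)).neg.sub_const (1 / 2)
    rw [show (-1 / 2 : ℝ) = -0 - 1 / 2 by norm_num]
    exact this
  refine tendsto_of_tendsto_of_tendsto_of_le_of_le' (hlow.comp hs) (hupp.comp hs) ?_ ?_
  · filter_upwards [h, hs.eventually_gt_atTop 0, (hlin.comp hs).eventually_gt_atTop 0,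
      self_mem_nhdsWithin] with δ hδ hs0 hD0 hδ0
    simp only [Function.comp_apply, mem_Ioi] at hD0 hδ0 ⊢
    have hsq : 0 < √δ := Real.sqrt_pos.2 hδ0
    have hX : 0 < X δ := lt_of_lt_of_le (by positivity) hδ.1
    have h1 := Real.log_le_log hX hδ.2
    rw [Real.log_mul (by positivity) hD0.ne', Real.log_div hA.ne' hsq.ne',
      Real.log_sqrt hδ0.le] at h1
    rw [← neg_div_neg_eq (Real.log (X δ)), le_div_iff₀ hs0]
    have h2 : (-(Real.log A / -Real.log δ + Real.log (D + l * -Real.log δ) / -Real.log δ) - 1 / 2) *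
        -Real.log δ = -(Real.log A + Real.log (D + l * -Real.log δ)) + Real.log δ / 2 := by
      have : Real.log δ ≠ 0 := by intro h0; rw [h0] at hs0; simp at hs0
      field_simp
      ring
    rw [h2]
    linarith
  · filter_upwards [h, hs.eventually_gt_atTop 0, self_mem_nhdsWithin] with δ hδ hs0 hδ0
    simp only [Function.comp_apply, mem_Ioi] at hδ0 ⊢
    have hsq : 0 < √δ := Real.sqrt_pos.2 hδ0
    have h1 := Real.log_le_log (by positivity) hδ.1
    rw [Real.log_div hc.ne' hsq.ne', Real.log_sqrt hδ0.le] at h1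
    rw [← neg_div_neg_eq (Real.log (X δ)), div_le_iff₀ hs0]
    have h2 : (-(Real.log c / -Real.log δ) - 1 / 2) * -Real.log δ =
        -Real.log c + Real.log δ / 2 := by
      have : Real.log δ ≠ 0 := by intro h0; rw [h0] at hs0; simp at hs0
      field_simp
      ring
    rw [h2]
    linarith

/-- Two-sided bounds at the scale `δ ^ (-1 / 2)` determine the Lifshitz exponent. -/
lemma tendsto_log_neg_log {n : ℝ → ℝ} {q b B C l D δ₀ : ℝ} (hq0 : 0 < q) (hq1 : q < 1) (hb : 0 < b)
    (hB : 0 < B) (hC : 0 < C) (hl : 0 < l) (hD : 0 < D) (hδ₀ : 0 < δ₀)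
    (hupper : ∀ (L : ℕ) (δ : ℝ), 0 < L → 0 < δ → (L : ℝ) ^ 2 * δ ≤ b → n δ ≤ q ^ L)
    (hlower : ∀ (m : ℕ) (δ : ℝ), 0 < m → 0 < δ → δ < δ₀ → B ≤ δ * (m : ℝ) ^ 2 →
      (C * (δ / D) ^ l) ^ (4 * m) / (8 * m) ≤ n δ) :
    Tendsto (fun δ => Real.log (-Real.log (n δ)) / Real.log δ) (𝓝[>] 0) (𝓝 (-1 / 2)) := by
  have hlq : 0 < -Real.log q := neg_pos.2 (Real.log_neg hq0 hq1)
  -- The block lengths are `L` = ⌊√(b/δ)⌋ ≥ √(b/δ)/2 and 4m with `m` = ⌈√(B/δ)⌉ ≤ 2√(B/δ), which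
  -- gives `c` and `A`. In the third constant, 2 comes from log(8m) ≤ 8m = 2 · 4m and the rest from
  -- the single-site probability C (δ/D)^l.
  refine tendsto_log_div_log (c := √b / 2 * -Real.log q) (A := 4 * (2 * √B))
    (D := 2 - Real.log C + l * Real.log D) (l := l) (by positivity) (by positivity) hl ?_
  have hs : Tendsto (fun δ : ℝ => -Real.log δ) (𝓝[>] 0) atTop :=
    tendsto_neg_atBot_atTop.comp Real.tendsto_log_nhdsGT_zero
  have hlin : Tendsto (fun s : ℝ => 2 - Real.log C + l * Real.log D + l * s) atTop atTop :=
    tendsto_atTop_add_const_left _ _ (tendsto_id.const_mul_atTop hl)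
  filter_upwards [Ioo_mem_nhdsGT hδ₀, Ioo_mem_nhdsGT hb, Ioo_mem_nhdsGT hB,
    (hlin.comp hs).eventually_gt_atTop 0] with δ h1 h2 h3 h4
  simp only [Function.comp_apply] at h4
  have hδ : 0 < δ := h1.1
  have hsq : 0 < √δ := Real.sqrt_pos.2 hδ
  have hsq2 : √δ ^ 2 = δ := Real.sq_sqrt hδ.le
  -- the lower bound
  set m := ⌈√B / √δ⌉₊ with hm
  have hmge : √B / √δ ≤ m := Nat.le_ceil _
  have hm1 : 1 ≤ √B / √δ := by
    rw [le_div_iff₀ hsq, one_mul]; exact Real.sqrt_le_sqrt h3.2.le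
  have hm0 : 0 < m := Nat.ceil_pos.2 (by linarith)
  have hmle : (m : ℝ) ≤ 2 * √B / √δ := by
    have := (Nat.ceil_lt_add_one (by linarith : 0 ≤ √B / √δ)).le
    rw [mul_div_assoc]; linarith
  have hmB : B ≤ δ * (m : ℝ) ^ 2 := by
    calc B = δ * (√B / √δ) ^ 2 := by
          rw [div_pow, hsq2, Real.sq_sqrt hB.le, mul_div_cancel₀ _ hδ.ne']
      _ ≤ _ := by gcongr
  have hlow := hlower m δ hm0 hδ h1.2 hmB
  have hm' : (0 : ℝ) < m := by exact_mod_cast hm0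
  have hpos : 0 < (C * (δ / D) ^ l) ^ (4 * m) / (8 * m) := by positivity
  have hn0 : 0 < n δ := lt_of_lt_of_le hpos hlow
  have hloglow := Real.log_le_log hpos hlow
  rw [Real.log_div (by positivity) (by positivity), Real.log_pow,
    Real.log_mul hC.ne' (by positivity), Real.log_rpow (by positivity),
    Real.log_div hδ.ne' hD.ne'] at hloglow
  have hlog8 : Real.log (8 * m) ≤ 8 * m := by
    have := Real.log_le_sub_one_of_pos (by positivity : (0 : ℝ) < 8 * m)
    linarith
  -- the upper bound
  set L := ⌊√b / √δ⌋₊ with hL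
  have hL1 : 1 ≤ √b / √δ := by
    rw [le_div_iff₀ hsq, one_mul]; exact Real.sqrt_le_sqrt h2.2.le
  have hL0 : 0 < L := Nat.floor_pos.2 hL1
  have hLle : (L : ℝ) ≤ √b / √δ := Nat.floor_le (by linarith)
  have hLge : √b / √δ / 2 ≤ L := by
    have h5 := (Nat.lt_floor_add_one (√b / √δ)).le
    have h6 : (1 : ℝ) ≤ L := by exact_mod_cast hL0
    linarith
  have hLb : (L : ℝ) ^ 2 * δ ≤ b := by
    calc (L : ℝ) ^ 2 * δ ≤ (√b / √δ) ^ 2 * δ := by gcongr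
      _ = b := by rw [div_pow, hsq2, Real.sq_sqrt hb.le, div_mul_cancel₀ _ hδ.ne']
  have hupp := Real.log_le_log hn0 (hupper L δ hL0 hδ hLb)
  rw [Real.log_pow] at hupp
  constructor
  · calc √b / 2 * -Real.log q / √δ = √b / √δ / 2 * -Real.log q := by ring
      _ ≤ L * -Real.log q := by gcongr
      _ ≤ -Real.log (n δ) := by linarith
  · push_cast at hloglow
    calc -Real.log (n δ) ≤ 4 * m * (2 - Real.log C + l * Real.log D + l * -Real.log δ) := by
          linarith
      _ ≤ 4 * (2 * √B / √δ) * (2 - Real.log C + l * Real.log D + l * -Real.log δ) := by gcongr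
      _ = _ := by ring

end LogLog

/-! ### Consequences of the assumptions on the single-site law -/

section Data

variable {H : Type*} [NormedAddCommGroup H] [InnerProductSpace ℂ H] {ψ : ℤ → H}

/-- A bound for the Gram form on finitely supported sequences. -/
lemma form_le_of_form_bound {Φ c θ : ℝ} (hc : 0 ≤ c)
    (hform : ∀ (S : Finset ℤ) (w : ℤ → ℂ), (∀ n, w n ≠ 0 → n ∈ S ∧ n + 1 ∈ S) →
      c * ∑ n ∈ S, ‖twistDiff θ w n‖ ^ 2 ≤
        Φ * ∑ n ∈ S, ‖w n‖ ^ 2 - ‖∑ n ∈ S, w n • ψ n‖ ^ 2) (S : Finset ℤ) (w : ℤ → ℂ) :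
    ‖∑ n ∈ S, w n • ψ n‖ ^ 2 ≤ Φ * ∑ n ∈ S, ‖w n‖ ^ 2 := by
  classical
  set w' : ℤ → ℂ := fun n => if n ∈ S then w n else 0 with hw'
  set S' := S ∪ S.image (· + 1) with hS'
  have hsub : S ⊆ S' := Finset.subset_union_left
  have h := hform S' w' fun n hn => by
    have hnS : n ∈ S := by
      by_contra h
      exact hn (by rw [hw']; simp [h])
    exact ⟨hsub hnS, Finset.mem_union_right _ (Finset.mem_image_of_mem _ hnS)⟩
  have e1 : ∑ n ∈ S', ‖w' n‖ ^ 2 = ∑ n ∈ S, ‖w n‖ ^ 2 := by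
    rw [← Finset.sum_subset hsub fun n _ hn => by simp [hw', hn]]
    exact Finset.sum_congr rfl fun n hn => by simp [hw', hn]
  have e2 : ∑ n ∈ S', w' n • ψ n = ∑ n ∈ S, w n • ψ n := by
    rw [← Finset.sum_subset hsub fun n _ hn => by simp [hw', hn]]
    exact Finset.sum_congr rfl fun n hn => by simp [hw', hn]
  rw [e1, e2] at h
  have h0 : 0 ≤ c * ∑ n ∈ S', ‖twistDiff θ w' n‖ ^ 2 := by positivity
  linarith

variable {P₀ : Measure ℝ}

lemma ae_mem_Ioc_kappaMax (hcompact : IsCompact P₀.support) (hpos : P₀.support ⊆ Ioi 0) :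
    ∀ᵐ x ∂P₀, x ∈ Ioc 0 (kappaMax P₀) := by
  filter_upwards [Measure.support_mem_ae (μ := P₀)] with x hx
  exact ⟨hpos hx, le_csSup hcompact.bddAbove hx⟩

variable [IsProbabilityMeasure P₀]

lemma kappaMax_pos (hcompact : IsCompact P₀.support) (hpos : P₀.support ⊆ Ioi 0) :
    0 < kappaMax P₀ := by
  obtain ⟨x, hx⟩ := Measure.nonempty_support (IsProbabilityMeasure.ne_zero P₀)
  exact lt_of_lt_of_le (hpos hx) (le_csSup hcompact.bddAbove hx)

/-- The infimum of the compact support belongs to it, so the half-line below `t` has positive mass.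
-/
lemma real_Ioi_lt_one (hcompact : IsCompact P₀.support) {t : ℝ} (ht : kappaMin P₀ < t) :
    P₀.real (Ioi t) < 1 := by
  have hmem : kappaMin P₀ ∈ P₀.support :=
    hcompact.sInf_mem (Measure.nonempty_support (IsProbabilityMeasure.ne_zero P₀))
  have h1 := (Measure.mem_support_iff_forall _).1 hmem (Iio t) (Iio_mem_nhds ht)
  have h2 : 0 < P₀.real (Iio t) := ENNReal.toReal_pos h1.ne' (measure_ne_top _ _)
  have h3 : P₀.real (Ioi t) ≤ P₀.real (Iio t)ᶜ :=
    measureReal_mono fun x hx => not_lt.2 (le_of_lt (mem_Ioi.1 hx))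
  rw [probReal_compl_eq_one_sub measurableSet_Iio] at h3
  linarith

end Data

end RankOneSums

end

/-! ### Assembly -/

theorem mainTheorem3
    {H : Type*} [NormedAddCommGroup H] [InnerProductSpace ℂ H] [CompleteSpace H]
    (ψ : ℤ → H) (hnorm : ∀ n, ‖ψ n‖ = 1)
    (hbdd : RankOneSums.GramBounded ψ) (hshift : RankOneSums.GramShiftInvariant ψ)
    (P₀ : Measure ℝ) [IsProbabilityMeasure P₀]
    (hcompact : IsCompact P₀.support) (hpos : P₀.support ⊆ Ioi 0)
    (φ : ℝ → ℝ) (hφ : RankOneSums.IsSymbol ψ φ) (hsmooth : ContDiff ℝ 2 φ)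
    (kmax : ℝ) (hmax : ∀ k, φ k ≤ φ kmax)
    (hsingle : ∀ k, φ k = φ kmax → ∃ m : ℤ, k = kmax + m * (2 * Real.pi))
    (hnondeg : iteratedDeriv 2 φ kmax ≠ 0)
    (hκ : RankOneSums.kappaMin P₀ < RankOneSums.kappaMax P₀)
    (htail : ∃ C > (0 : ℝ), ∃ ℓ > (0 : ℝ), ∃ ε₀ > (0 : ℝ), ∀ ε : ℝ, 0 < ε → ε < ε₀ →
      C * ε ^ ℓ ≤ P₀.real (Ioc (RankOneSums.kappaMax P₀ - ε) (RankOneSums.kappaMax P₀))) :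
    (∃! ν : Measure ℝ, RankOneSums.IsIDSMeasure ψ P₀ ν) ∧
    ∀ ν : Measure ℝ, RankOneSums.IsIDSMeasure ψ P₀ ν →
      Tendsto
        (fun δ : ℝ =>
          Real.log (-Real.log (ν.real
            (Ioc (RankOneSums.sigmaMax P₀ φ - δ) (RankOneSums.sigmaMax P₀ φ)))) / Real.log δ)
        (𝓝[>] 0) (𝓝 (-1 / 2)) := by
  have hs := hbdd.summable
  have hψ := RankOneSums.linearIndependent_of_summable hnorm hshift hs
  obtain ⟨c₁, hc₁, c₂, hc₂, hb⟩ :=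
    RankOneSums.exists_form_bounds hshift hφ hsmooth hmax hsingle hnondeg
  have hform := RankOneSums.form_le_of_form_bound hc₂.le fun S w hw => (hb S w hw).1
  have hσ : RankOneSums.sigmaMax P₀ φ = RankOneSums.kappaMax P₀ * φ kmax := by
    rw [RankOneSums.sigmaMax, RankOneSums.symbolMax_eq hφ.periodic hsmooth.continuous hmax]
  have hP := RankOneSums.ae_mem_Ioc_kappaMax hcompact hpos
  have hK := RankOneSums.kappaMax_pos hcompact hpos
  rw [hσ]
  set K := RankOneSums.kappaMax P₀ with hKdef
  set Φ := φ kmax with hΦdef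
  -- Testing the form bound on a single unit vector gives Φ ≥ 1.
  have hΦ : 0 < Φ := by
    have := hform {0} fun _ => 1
    simp [hnorm] at this
    linarith
  refine ⟨?_, fun ν hν => ?_⟩
  · obtain ⟨ν, hν⟩ := RankOneSums.exists_isIDSMeasure hψ hshift hs hΦ.le hform hP
    exact ⟨ν, hν, fun ν' hν' => hν'.unique hν⟩
  obtain ⟨C, hC, l, hl, ε₀, hε₀, htail⟩ := htail
  -- Half the width keeps `K - η` above κ_min, so a site is bad with positive probability.
  set η := (K - RankOneSums.kappaMin P₀) / 2 with hη
  have hη0 : 0 < η := by rw [hη]; linarith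
  have hq := RankOneSums.real_Ioi_lt_one hcompact (t := K - η) (by rw [hη]; linarith)
  -- The floor 1/2 keeps `q` positive. The two terms of `b` are the two conditions of the upper
  -- bound. The lower bound is applied with ε = δ/(4Φ), whence `D`, and δ₀ enforces δ ≤ 2KΦ, ε < K
  -- and ε < ε₀.
  refine RankOneSums.tendsto_log_neg_log (q := max (P₀.real (Ioi (K - η))) (1 / 2))
    (b := min (K * c₂ / 4) (η * Φ / 8)) (B := 10 * K * c₁) (C := C) (l := l) (D := 4 * Φ)
    (δ₀ := min (2 * (K * Φ)) (min (4 * Φ * K) (4 * Φ * ε₀)))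
    (lt_max_of_lt_right (by norm_num)) (max_lt hq (by norm_num)) (by positivity) (by positivity)
    hC hl (by positivity) (by positivity) ?_ ?_
  · intro L δ hL hδ hLδ
    have h1 := hLδ.trans (min_le_left _ _)
    have h2 := hLδ.trans (min_le_right _ _)
    refine (hν.real_Ioc_le hψ hP hΦ hK hη0 hδ hc₂.le (fun S w hw => (hb S w hw).1) hL
      (by linarith) (by linarith)).trans ?_
    exact pow_le_pow_left₀ measureReal_nonneg (le_max_left _ _) L
  · intro m δ hm hδ hδ₀ hmδ
    rw [lt_min_iff, lt_min_iff] at hδ₀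
    obtain ⟨h1, h2, h3⟩ := hδ₀
    have hε : 0 < δ / (4 * Φ) := by positivity
    have hεK : δ / (4 * Φ) < K := by rw [div_lt_iff₀ (by positivity)]; linarith
    have hεε : δ / (4 * Φ) < ε₀ := by rw [div_lt_iff₀ (by positivity)]; linarith
    refine le_trans ?_ (hν.le_real_Ioc hψ hP hΦ.le hc₁.le hK hε hεK hδ
      (by field_simp; exact le_rfl) h1.le hform (fun S w hw => (hb S w hw).2) hm hmδ)
    gcongr
    exact (htail _ hε hεε).trans (measureReal_mono Ioc_subset_Ioi_self)
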